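/- **Theorem (soundness and completeness of VSecGraph and VSecGraph-A).** *Setting.* A graph is a set of edges $(w,id,weight)$, where the keyword $w$ is a source vertex together with an edge type; at most one edge has given $(w,id)$. An enclave with secret keys $K_T,K_Z,K_X$ and an untrusted server store it as follows. For the $i$-th entry $(id,weight)$ of the posting list of $w$ the server holds $TSet[F_1(K_T,w\|i)]=(id\|weight\|i)\oplus F_2(K_Z,w)$ and $ITSet[F_3(K_X,w\|id)]=(i\|id)\oplus F_2(K_Z,w)$. It also holds a logarithmic dynamic cuckoo filter (a binary tree of sub-filters) containing the fingerprints $H_2(w\|id)$ in one of the candidate buckets $H_1(w\|id)$ and $H_1(w\|id)\oplus H_1(H_2(w\|id))$. The enclave keeps the length of every posting list and, for every sub-filter, its hash under $H_3$. In *VSecGraph* it also keeps, for each $w$, the multiset hash $h_w=\mathcal H(PL_w)$ of the posting list $PL_w$ (the multiset of all $id\|weight$). In *VSecGraph-A* the values $h_w$ are kept by the server under the key $H_4(w)$; the keywords are divided into groups, and for every group the enclave keeps only an RSA accumulation value $g^{\prod_w H_p(H_4(w)\|h_w)}\bmod n$, where $n=pq$, and $H_p$ maps strings to prime representatives; the enclave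 knows $p,q$. Insertions and deletions update these data; the enclave verifies every item it loads and aborts if this fails or if the filter cannot take a fingerprint. In a conjunctive search $w_1\wedge\dots\wedge w_m$ the enclave loads the posting list of $w_1$, and rejects unless its multiset hash equals $h_{w_1}$ (in VSecGraph-A: equals a value $h$ sent by the server with a witness $\pi$ such that $\pi^{H_p(H_4(w_1)\|h)}\bmod n$ is the accumulation value of the group of $w_1$); then it keeps those $id$ for which every $w_i\|id$, $i\ge 2$, passes the membership check in the responsible sub-filter, each loaded sub-filter being rejected unless its hash is the stored one. *Attack.* A PPT adversary is given the security parameter and the public parameters (the seeds of the hash functions; for VSecGraph-A also $n,g$), and chooses a sequence of edge insertions and deletions, which the protocol executes honestly. It is given the authenticated data structure and the encrypted graph, chooses a conjunctive query, and plays the server in the search, with arbitrary answers to the enclave's requests. It wins if the enclave accepts and the set $R$ it outputs differs from the correct result $\hat R$, i.e. $R\setminus\hat R\neq\emptyset$ or $\hat R\setminus R\ne\emptyset$. Here $\hat R$ is the set of all $id$ such that $(w_1,id,\cdot)$ is an edge of the final graph and for every $i\ge2$ there is an edge $(w',id',\cdot)$ such that $w_i\|id$ and $w'\|id'$ have the same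 fingerprint and the same pair of candidate buckets; that is, the true conjunctive result up to the false positives inherent in the cuckoo filter. A scheme is *sound and complete* if every PPT adversary wins with negligible probability only. *Claim.* Suppose that the multiset hash $\mathcal H$ and the hash function $H_3$ are collision resistant. 1. VSecGraph is sound and complete. 2. If moreover $H_4$ is collision resistant and the RSA accumulator with prime representatives $H_p$ is secure (no PPT algorithm, given $n$, $g$ and the seed of $H_p$, finds strings $x_1,\dots,x_k$, a string $y\notin\{x_1,\dots,x_k\}$ and $\pi$ with $\pi^{H_p(y)}\equiv g^{\prod_j H_p(x_j)} \pmod n$, except with negligible probability), then VSecGraph-A is sound and complete. 3. If moreover the fingerprint function $H_2$ is collision resistant, then 1 and 2 also hold with $\hat R$ replaced by the exact result, the set of all $id$ such that $(w_i,id,\cdot)$ is an edge for every $i\ge1$. All functions used are computable in polynomial time. The RSA setup yields, except with negligible probability, distinct safe primes $p,q$ and a unit $g$ modulo $n$, such that all values of $H_p$ are odd primes smaller than $(p-1)/2$ and $(q-1)/2$. -/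

import Mathlib

/-! ## A programming language with a step count

Data are binary trees whose leaves are natural numbers.  Programs are built from elementary
operations by tupling, composition, branching and `while` loops.  An elementary operation is charged
the square of the bit size of its argument and its result (so arithmetic is charged at school-book
cost); hence time polynomial in the input size is the usual polynomial time. -/

inductive Val : Type
  | nat (n : ℕ)
  | pair (a b : Val)
  deriving DecidableEq

/-- Bit size of a datum. -/
def Val.size : Val → ℕ
  | .nat n => Nat.size n + 1
  | .pair a b => a.size + b.size + 1

inductive Op : Type
  | id
  | const (n : ℕ)
  | fst
  | snd
  | isPair
  | eq
  | add
  | sub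
  | mul
  | div
  | mod

/-- Result of an elementary operation; `0` on arguments of the wrong shape. -/
def Op.eval : Op → Val → Val
  | .id, v => v
  | .const n, _ => .nat n
  | .fst, .pair a _ => a
  | .snd, .pair _ b => b
  | .isPair, .pair _ _ => .nat 1
  | .eq, .pair a b => if a = b then .nat 1 else .nat 0
  | .add, .pair (.nat a) (.nat b) => .nat (a + b)
  | .sub, .pair (.nat a) (.nat b) => .nat (a - b)
  | .mul, .pair (.nat a) (.nat b) => .nat (a * b)
  | .div, .pair (.nat a) (.nat b) => .nat (a / b)
  | .mod, .pair (.nat a) (.nat b) => .nat (a % b)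
  | _, _ => .nat 0

inductive Prog : Type
  | op (o : Op)
  | pair (f g : Prog)
  | comp (g f : Prog)
  | cond (c t e : Prog)
  | loop (c b : Prog)

/-- `Run p v w t`: program `p` on input `v` halts with output `w` after `t` steps. -/
inductive Run : Prog → Val → Val → ℕ → Prop
  | op (o : Op) (v : Val) : Run (.op o) v (o.eval v) ((v.size + (o.eval v).size) ^ 2)
  | pair {f g : Prog} {v a b : Val} {s t : ℕ} :
      Run f v a s → Run g v b t → Run (.pair f g) v (.pair a b) (s + t + 1)
  | comp {f g : Prog} {v a b : Val} {s t : ℕ} :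
      Run f v a s → Run g a b t → Run (.comp g f) v b (s + t + 1)
  | condTrue {c p e : Prog} {v a b : Val} {s t : ℕ} :
      Run c v a s → a ≠ .nat 0 → Run p v b t → Run (.cond c p e) v b (s + t + 1)
  | condFalse {c p e : Prog} {v b : Val} {s t : ℕ} :
      Run c v (.nat 0) s → Run e v b t → Run (.cond c p e) v b (s + t + 1)
  | loopStop {c b : Prog} {v : Val} {s : ℕ} :
      Run c v (.nat 0) s → Run (.loop c b) v v (s + 1)
  | loopStep {c b : Prog} {v a v' w : Val} {s t u : ℕ} :
      Run c v a s → a ≠ .nat 0 → Run b v v' t → Run (.loop c b) v' w u →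
      Run (.loop c b) v w (s + t + u + 1)

/-- Encoding of mathematical objects as data. -/
class Enc (α : Type) where
  enc : α → Val

instance : Enc ℕ := ⟨Val.nat⟩

instance : Enc Bool := ⟨fun b => .nat b.toNat⟩

instance {α β : Type} [Enc α] [Enc β] : Enc (α × β) :=
  ⟨fun x => .pair (Enc.enc x.1) (Enc.enc x.2)⟩

instance {α : Type} [Enc α] : Enc (List α) :=
  ⟨fun l => l.foldr (fun a v => .pair (Enc.enc a) v) (.nat 0)⟩

/-- `f` is computed by a program in time polynomial in the size of the input. -/
def PolyTime {α β : Type} [Enc α] [Enc β] (f : α → β) : Prop :=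
  ∃ (p : Prog) (q : Polynomial ℕ), ∀ x : α,
    ∃ t ≤ q.eval (Enc.enc x).size, Run p (Enc.enc x) (Enc.enc (f x)) t

/-- Bit strings. -/
abbrev Bits := List Bool

/-- The security parameter in unary. -/
def unary (lam : ℕ) : Bits := List.replicate lam true

/-- A length that is computable in polynomial time from the unary security parameter. -/
def PolyLength (l : ℕ → ℕ) : Prop := PolyTime fun u : Bits => unary (l u.length)

/-! ## Probability, probabilistic polynomial time, and negligible functions -/

/-- `n` coin tosses. -/
abbrev Tape (n : ℕ) := Fin n → Bool

/-- The tosses as a bit string. -/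
def Tape.bits {n : ℕ} (r : Tape n) : Bits := List.ofFn r

open Classical in
/-- Probability of an event under the uniform distribution on a finite set. -/
noncomputable def prob {Ω : Type} [Fintype Ω] (E : Ω → Prop) : ℝ :=
  ((Finset.univ.filter E).card : ℝ) / (Fintype.card Ω : ℝ)

/-- Negligible: smaller than every inverse polynomial. -/
def Negligible (f : ℕ → ℝ) : Prop :=
  Asymptotics.SuperpolynomialDecay Filter.atTop (fun lam : ℕ => (lam : ℝ)) f

/-- A probabilistic polynomial-time algorithm.  Its input is the unary security parameter, its coins
and the actual input. -/
structure PPT (α β : Type) [Enc α] [Enc β] where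
  coins : ℕ → ℕ
  coins_poly : PolyLength coins
  run : Bits × Bits × α → β
  run_poly : PolyTime run

/-- Collision resistance of a family of functions with a uniformly random public seed.
`rep` tells which element of the domain is meant by a datum that the adversary outputs. -/
def CollisionResistant {X Y : Type} [Enc X] (seedLen : ℕ → ℕ) (rep : X → Y)
    (H : ℕ → Bits → Y → Bits) : Prop :=
  ∀ B : PPT Bits (X × X), Negligible fun lam =>
    prob fun o : Tape (B.coins lam) × Tape (seedLen lam) =>
      let x := B.run (unary lam, o.1.bits, o.2.bits)
      rep x.1 ≠ rep x.2 ∧ H lam o.2.bits (rep x.1) = H lam o.2.bits (rep x.2)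

/-! ## Logarithmic dynamic cuckoo filter

A sub-filter is stored as the list of its occupied slots, a slot being a pair of a bucket index and a
stored fingerprint.  The identifier of a sub-filter is its position in the binary tree, i.e. the
prefix of the fingerprints that belong to it; that prefix is not stored in the slots. -/

abbrev SubFilter := List (Bits × Bits)

def xorB (a b : Bits) : Bits := List.zipWith xor a b

/-- Number of occupied slots of bucket `m`. -/
def load (sf : SubFilter) (m : Bits) : ℕ := (sf.filter fun e => e.1 == m).length

section LDCF

variable (H1 : Bits → Bits) (bucketSize maxKicks : ℕ)

/-- The other candidate bucket of the fingerprint `d`. -/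
def altBucket (d m : Bits) : Bits := xorB (H1 d) m

/-- Put the fingerprint `idf ++ s` into bucket `m`; if that is full, evict a fingerprint of it and
move the evicted one to its other bucket, and so on, at most `n` times.  Also returns the fingerprint
that found no place, together with the bucket it should have gone to. -/
def kick (idf : Bits) : ℕ → SubFilter → Bits → Bits → SubFilter × Option (Bits × Bits)
  | 0, sf, m, s => (sf, some (m, s))
  | n + 1, sf, m, s =>
    if load sf m < bucketSize then (sf ++ [(m, s)], none)
    else
      match sf.find? fun e => e.1 == m with
      | none => (sf, some (m, s))
      | some e => kick idf n (sf.erase e ++ [(m, s)]) (altBucket H1 (idf ++ e.2) m) e.2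

/-- Insertion of the fingerprint `idf ++ s` with candidate bucket `m`. -/
def insertSF (idf : Bits) (sf : SubFilter) (s m : Bits) : SubFilter × Option (Bits × Bits) :=
  if load sf m < bucketSize then (sf ++ [(m, s)], none)
  else
    let n := altBucket H1 (idf ++ s) m
    if load sf n < bucketSize then (sf ++ [(n, s)], none)
    else kick H1 bucketSize idf maxKicks sf m s

/-- The fingerprints with first bit `c`, without that bit. -/
def halfSF (c : Bool) (sf : SubFilter) : SubFilter :=
  sf.filterMap fun e =>
    match e.2 with
    | [] => none
    | c' :: s => if c' = c then some (e.1, s) else none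

/-- Distribute the content of a sub-filter and the left-over fingerprint to two new sub-filters; if a
fingerprint is left over again, the new sub-filter concerned is split in turn.  Fails if the
fingerprints have no bit left (`n` is the number of bits left). -/
def splitSF : ℕ → Bits → SubFilter → Bits × Bits → Option (List (Bits × SubFilter))
  | 0, _, _, _ => none
  | _ + 1, _, _, (_, []) => none
  | n + 1, idf, sf, (m, c :: s) =>
    let other := (idf ++ [!c], halfSF (!c) sf)
    match insertSF H1 bucketSize maxKicks (idf ++ [c]) (halfSF c sf) s m with
    | (sf', none) => some [other, (idf ++ [c], sf')]
    | (sf', some left) => (splitSF n (idf ++ [c]) sf' left).map fun l => other :: l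

/-- Is the fingerprint `idf ++ s` in one of its two candidate buckets? -/
def memberSF (idf : Bits) (sf : SubFilter) (s m : Bits) : Bool :=
  sf.contains (m, s) || sf.contains (altBucket H1 (idf ++ s) m, s)

def deleteSF (idf : Bits) (sf : SubFilter) (s m : Bits) : SubFilter :=
  if sf.contains (m, s) then sf.erase (m, s) else sf.erase (altBucket H1 (idf ++ s) m, s)

end LDCF

/-! ## Finite maps as association lists -/

/-- Set the value at a key; a new key is appended at the end. -/
def put {κ β : Type} [DecidableEq κ] (m : List (κ × β)) (k : κ) (v : β) : List (κ × β) :=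
  if (m.lookup k).isSome then m.map fun e => if e.1 = k then (k, v) else e else m ++ [(k, v)]

def del {κ β : Type} [DecidableEq κ] (m : List (κ × β)) (k : κ) : List (κ × β) :=
  m.filter fun e => e.1 ≠ k

/-! ## The primitives -/

/-- A multiset hash function on multisets of bit strings, with fixed output length. -/
structure MultisetHash where
  seedLen : ℕ → ℕ
  outLen : ℕ → ℕ
  hash : ℕ → Bits → Multiset Bits → Bits
  add : ℕ → Bits → Bits → Bits → Bits
  sub : ℕ → Bits → Bits → Bits → Bits
  hash_length : ∀ lam s M, (hash lam s M).length = outLen lam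
  hash_cons : ∀ lam s x M, hash lam s (x ::ₘ M) = add lam s (hash lam s M) (hash lam s {x})
  hash_erase : ∀ lam s M, ∀ x ∈ M,
    hash lam s (M.erase x) = sub lam s (hash lam s M) (hash lam s {x})
  seedLen_poly : PolyLength seedLen
  hash_poly : PolyTime fun x : Bits × Bits × List Bits => hash x.1.length x.2.1 (x.2.2 : Multiset Bits)
  add_poly : PolyTime fun x : Bits × Bits × Bits × Bits => add x.1.length x.2.1 x.2.2.1 x.2.2.2
  sub_poly : PolyTime fun x : Bits × Bits × Bits × Bits => sub x.1.length x.2.1 x.2.2.1 x.2.2.2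

/-- Infeasible to find two distinct multisets with the same hash. -/
def MultisetHash.IsCollisionResistant (M : MultisetHash) : Prop :=
  CollisionResistant M.seedLen (fun l : List Bits => (l : Multiset Bits)) M.hash

/-- A hash function with a public seed and fixed output length. -/
structure HashFamily (X : Type) [Enc X] where
  seedLen : ℕ → ℕ
  outLen : ℕ → ℕ
  hash : ℕ → Bits → X → Bits
  hash_length : ∀ lam s x, (hash lam s x).length = outLen lam
  seedLen_poly : PolyLength seedLen
  hash_poly : PolyTime fun x : Bits × Bits × X => hash x.1.length x.2.1 x.2.2

def HashFamily.IsCollisionResistant {X : Type} [Enc X] (H : HashFamily X) : Prop :=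
  CollisionResistant H.seedLen (fun x : X => x) H.hash

/-- A function `{0,1}^λ × {0,1}^* → {0,1}^λ` for every `λ`, as is used for the three keyed functions. -/
structure KeyedFun where
  eval : Bits → Bits → Bits
  eval_length : ∀ k x, (eval k x).length = k.length
  eval_poly : PolyTime fun x : Bits × Bits => eval x.1 x.2

/-- Setup of the RSA accumulator and the map `rep` to prime representatives. -/
structure RSAAccumulator where
  coins : ℕ → ℕ
  /-- `(p, q, g)` -/
  setup : ℕ → Bits → ℕ × ℕ × ℕ
  repSeedLen : ℕ → ℕ
  rep : ℕ → Bits → Bits → ℕ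
  rep_prime : ∀ lam s x, (rep lam s x).Prime
  coins_poly : PolyLength coins
  repSeedLen_poly : PolyLength repSeedLen
  setup_poly : PolyTime fun x : Bits × Bits => setup x.1.length x.2
  rep_poly : PolyTime fun x : Bits × Bits × Bits => rep x.1.length x.2.1 x.2.2
  /-- Except with negligible probability `p` and `q` are distinct safe primes, `g` is a unit modulo
  `n = p q`, and all representatives are odd and smaller than `(p-1)/2` and `(q-1)/2` (so that they
  are invertible modulo `φ(n)`). -/
  setup_safe : Negligible fun lam => prob fun r : Tape (coins lam) =>
    ¬ (let (p, q, g) := setup lam r.bits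
       p.Prime ∧ q.Prime ∧ p ≠ q ∧ ((p - 1) / 2).Prime ∧ ((q - 1) / 2).Prime ∧ g.Coprime (p * q) ∧
       ∀ s x, rep lam s x ≠ 2 ∧ rep lam s x < (p - 1) / 2 ∧ rep lam s x < (q - 1) / 2)

/-- Verification of the witness `w` for the prime `x` against the accumulation value `ac`. -/
def accVerify (n x w ac : ℕ) : Bool := w ^ x % n == ac

/-- Add the prime `x` to the accumulation value. -/
def accInsert (n x ac : ℕ) : ℕ := ac ^ x % n

/-- Remove the prime `x` from the accumulation value: raise to the inverse of `x` modulo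
`φ(n) = (p-1)(q-1)`. -/
def accDelete (p q x ac : ℕ) : ℕ := ac ^ ((x : ZMod ((p - 1) * (q - 1)))⁻¹).val % (p * q)

/-- Given `n`, `g` and the seed of the representatives, it is infeasible to find a list of strings, a
string that is not in it, and a valid witness that it is. -/
def RSAAccumulator.IsSecure (K : RSAAccumulator) : Prop :=
  ∀ B : PPT (ℕ × ℕ × Bits) (List Bits × Bits × ℕ), Negligible fun lam =>
    prob fun o : Tape (B.coins lam) × Tape (K.coins lam) × Tape (K.repSeedLen lam) =>
      let (p, q, g) := K.setup lam o.2.1.bits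
      let n := p * q
      let s := o.2.2.bits
      let (xs, y, w) := B.run (unary lam, o.1.bits, (n, g, s))
      y ∉ xs ∧ accVerify n (K.rep lam s y) w (g ^ (xs.map (K.rep lam s)).prod % n) = true

/-- Everything the two schemes are built from. -/
structure Primitives where
  /-- Bit lengths of vertex identifiers, weights and counters. -/
  idLen : ℕ → ℕ
  wtLen : ℕ → ℕ
  ctLen : ℕ → ℕ
  idLen_poly : PolyLength idLen
  wtLen_poly : PolyLength wtLen
  ctLen_poly : PolyLength ctLen
  lengths_fit : ∀ lam, idLen lam + wtLen lam + ctLen lam ≤ lam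
  F1 : KeyedFun
  F2 : KeyedFun
  F3 : KeyedFun
  /-- Candidate bucket. -/
  H1 : ℕ → Bits → Bits
  alpha : ℕ → ℕ
  H1_length : ∀ lam x, (H1 lam x).length = alpha lam
  H1_poly : PolyTime fun x : Bits × Bits => H1 x.1.length x.2
  /-- Fingerprint. -/
  H2 : ℕ → Bits → Bits
  xi : ℕ → ℕ
  H2_length : ∀ lam x, (H2 lam x).length = xi lam
  H2_poly : PolyTime fun x : Bits × Bits => H2 x.1.length x.2
  H3 : HashFamily SubFilter
  H4 : HashFamily Bits
  MH : MultisetHash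
  Acc : RSAAccumulator
  bucketSize : ℕ
  maxKicks : ℕ
  /-- Number of keywords that share one accumulation value; `0` stands for no bound. -/
  groupSize : ℕ

namespace Primitives

variable (P : Primitives)

/-! ## Graphs and the correct result of a conjunctive search -/

/-- Edges `(w, id, weight)`, where the keyword `w` is the source vertex with the type of the edge. -/
abbrev Graph := List (Bits × Bits × Bits)

/-- Update token `(w, id, weight, op)`, where `op = true` is insertion and `op = false` deletion. -/
abbrev Token := Bits × Bits × Bits × Bool

/-- A conjunctive query `w₁ ∧ … ∧ wₙ` as `(w₁, [w₂, …, wₙ])`. -/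
abbrev Query := Bits × List Bits

/-- One update of the plaintext graph: a new edge is inserted or an existing one is deleted. -/
def graphStep (lam : ℕ) (G : Graph) (t : Token) : Option Graph :=
  let (w, id, wt, op) := t
  if id.length = P.idLen lam ∧ wt.length = P.wtLen lam then
    if op then
      if G.any fun e => e.1 == w && e.2.1 == id then none else some (G ++ [(w, id, wt)])
    else if G.contains (w, id, wt) then some (G.erase (w, id, wt)) else none
  else none

/-- The vertices that are connected to all keywords of the query. -/
def exactResult (_lam : ℕ) (G : Graph) (q : Query) : Set Bits :=
  {id | ∀ w ∈ q.1 :: q.2, ∃ wt, (w, id, wt) ∈ G}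

/-- Two cross tags are indistinguishable for a cuckoo filter: they have the same fingerprint and the
same pair of candidate buckets. -/
def SameSlot (lam : ℕ) (x y : Bits) : Prop :=
  P.H2 lam x = P.H2 lam y ∧
    (P.H1 lam x = P.H1 lam y ∨ P.H1 lam x = altBucket (P.H1 lam) (P.H2 lam y) (P.H1 lam y))

/-- The same with membership in the posting lists of `w₂, …, wₙ` decided through the fingerprints and
candidate buckets of the cross tags, i.e. up to the false positives inherent in a cuckoo filter. -/
def filterResult (lam : ℕ) (G : Graph) (q : Query) : Set Bits :=
  {id | (∃ wt, (q.1, id, wt) ∈ G) ∧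
    ∀ w ∈ q.2, ∃ e ∈ G, P.SameSlot lam (w ++ id) (e.1 ++ e.2.1)}

/-! ## Data common to both schemes -/

/-- The keys `(K_T, K_Z, K_X)`. -/
abbrev Keys := Bits × Bits × Bits

/-- `UpdateCnt`, and the `IndexTree` as the list of its leaves, each with its position in the tree and
the hash of the sub-filter at that position. -/
structure Enclave where
  cnt : List (Bits × ℕ)
  index : List (Bits × Bits)

/-- The encrypted graph. -/
structure Server where
  tset : List (Bits × Bits)
  itset : List (Bits × Bits)
  xset : List (Bits × SubFilter)

/-- A counter as a string of fixed length. -/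
def ctBits (lam c : ℕ) : Bits := (List.range (P.ctLen lam)).map fun i => c.testBit i

def stag (lam : ℕ) (K : Keys) (w : Bits) (c : ℕ) : Bits := P.F1.eval K.1 (w ++ P.ctBits lam c)

/-- Encryption (and decryption) with the pad that belongs to the keyword. -/
def mask (K : Keys) (w x : Bits) : Bits := xorB x (P.F2.eval K.2.1 w)

/-- Split a decrypted `id_e` into `id`, `weight` and counter. -/
def parseIdE (lam : ℕ) (x : Bits) : Option (Bits × Bits × Bits) :=
  if x.length = P.idLen lam + P.wtLen lam + P.ctLen lam then
    some (x.take (P.idLen lam), (x.drop (P.idLen lam)).take (P.wtLen lam),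
      x.drop (P.idLen lam + P.wtLen lam))
  else none

/-- Split a decrypted `stag_e` into counter and `id`. -/
def parseStagE (lam : ℕ) (x : Bits) : Option (Bits × Bits) :=
  if x.length = P.ctLen lam + P.idLen lam then some (x.take (P.ctLen lam), x.drop (P.ctLen lam))
  else none

/-- The leaf of the `IndexTree` that is responsible for a fingerprint. -/
def leafOf (index : List (Bits × Bits)) (d : Bits) : Option (Bits × Bits) :=
  index.find? fun e => e.1.isPrefixOf d

def initEnclave (lam : ℕ) (s3 : Bits) : Enclave := ⟨[], [([], P.H3.hash lam s3 [])]⟩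

def initServer : Server := ⟨[], [], [([], [])]⟩

/-- The update protocol without the multiset hash.  Items that the enclave loads from the server are
verified; `none` means that a verification fails or that the filter cannot take the fingerprint. -/
def coreUpdate (lam : ℕ) (s3 : Bits) (K : Keys) (E : Enclave) (S : Server) (t : Token) :
    Option (Enclave × Server) := do
  let (w, id, wt, op) := t
  let m := P.H1 lam (w ++ id)
  let d := P.H2 lam (w ++ id)
  let (idf, h) ← leafOf E.index d
  let sf ← S.xset.lookup idf
  guard (P.H3.hash lam s3 sf = h)
  let ind := P.F3.eval K.2.2 (w ++ id)
  if op then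
    let c := (E.cnt.lookup w).getD 0 + 1
    let idE := P.mask K w (id ++ wt ++ P.ctBits lam c)
    let stagE := P.mask K w (P.ctBits lam c ++ id)
    let s := d.drop idf.length
    let new ← match insertSF (P.H1 lam) P.bucketSize P.maxKicks idf sf s m with
      | (sf', none) => some [(idf, sf')]
      | (sf', some left) => splitSF (P.H1 lam) P.bucketSize P.maxKicks s.length idf sf' left
    some (⟨put E.cnt w c, del E.index idf ++ new.map fun x => (x.1, P.H3.hash lam s3 x.2)⟩,
      ⟨put S.tset (P.stag lam K w c) idE, put S.itset ind stagE, del S.xset idf ++ new⟩)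
  else
    let c ← E.cnt.lookup w
    let idE ← S.tset.lookup (P.stag lam K w c)
    let (id', wt', c') ← P.parseIdE lam (P.mask K w idE)
    guard (c' = P.ctBits lam c)
    let ind' := P.F3.eval K.2.2 (w ++ id')
    let stagE ← S.itset.lookup ind
    let (i, id'') ← P.parseStagE lam (P.mask K w stagE)
    guard (id'' = id)
    let sf' := deleteSF (P.H1 lam) idf sf (d.drop idf.length) m
    some (⟨put E.cnt w (c - 1), del E.index idf ++ [(idf, P.H3.hash lam s3 sf')]⟩,
      ⟨put S.tset (P.F1.eval K.1 (w ++ i)) (P.mask K w (id' ++ wt' ++ i)),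
        del (put S.itset ind' (P.mask K w (i ++ id'))) ind, del S.xset idf ++ [(idf, sf')]⟩)

/-- The strings `stag` whose entries make up the posting list of `w`. -/
def stagList (lam : ℕ) (K : Keys) (w : Bits) (c : ℕ) : List Bits :=
  (List.range c).map fun j => P.stag lam K w (j + 1)

/-- Decrypt the loaded entries of the posting list of `w`. -/
def decryptPL (lam : ℕ) (K : Keys) (w : Bits) (c : ℕ) (es : List Bits) :
    Option (List (Bits × Bits)) :=
  if es.length = c then
    es.mapM fun e => (P.parseIdE lam (P.mask K w e)).map fun x => (x.1, x.2.1)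
  else none

/-- Multiset hash of a posting list. -/
def hashPL (lam : ℕ) (sM : Bits) (pl : List (Bits × Bits)) : Bits :=
  P.MH.hash lam sM ((pl.map fun x => x.1 ++ x.2 : List Bits) : Multiset Bits)

/-- Multiset hash after one update. -/
def hashStep (lam : ℕ) (sM h : Bits) (t : Token) : Bits :=
  let x := P.MH.hash lam sM {t.2.1 ++ t.2.2.1}
  if t.2.2.2 then P.MH.add lam sM h x else P.MH.sub lam sM h x

/-- Check one `id` against the keywords.  `srv` is the (untrusted) server: it is given the identifiers
of all sub-filters that were requested so far, the last being the requested one, and its answer is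
verified against the `IndexTree`.  Verified sub-filters are kept in the cache. -/
def filterOne (lam : ℕ) (s3 : Bits) (index : List (Bits × Bits)) (srv : List Bits → SubFilter)
    (id : Bits) : List Bits → List (Bits × SubFilter) → Option (Bool × List (Bits × SubFilter))
  | [], cache => some (true, cache)
  | w :: ws, cache => do
    let m := P.H1 lam (w ++ id)
    let d := P.H2 lam (w ++ id)
    let (idf, h) ← leafOf index d
    let (sf, cache') ← match cache.lookup idf with
      | some sf => some (sf, cache)
      | none =>
        let sf := srv (cache.map Prod.fst ++ [idf])
        if P.H3.hash lam s3 sf = h then some (sf, cache ++ [(idf, sf)]) else none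
    if memberSF (P.H1 lam) idf sf (d.drop idf.length) m then
      filterOne lam s3 index srv id ws cache'
    else some (false, cache')

/-- Filter a verified posting list; `none` means that a loaded sub-filter was rejected. -/
def filterAll (lam : ℕ) (s3 : Bits) (index : List (Bits × Bits)) (srv : List Bits → SubFilter)
    (ws : List Bits) : List (Bits × Bits) → List (Bits × SubFilter) → Option (List Bits)
  | [], _ => some []
  | x :: pl, cache => do
    let (ok, cache') ← P.filterOne lam s3 index srv x.1 ws cache
    let rest ← filterAll lam s3 index srv ws pl cache'
    some (if ok then x.1 :: rest else rest)

/-! ## The adversary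

It knows the public parameters, chooses the graph through a sequence of updates, is then given the
authenticated data structure and the encrypted graph, chooses the query, and acts as the server in
the search.  All its algorithms share the same coins. -/

structure Adversary (Pub View Ans : Type) [Enc Pub] [Enc View] [Enc Ans] where
  coins : ℕ → ℕ
  coins_poly : PolyLength coins
  graph : Bits × Bits × Pub → List Token
  graph_poly : PolyTime graph
  query : (Bits × Bits × Pub) × View → Query
  query_poly : PolyTime query
  /-- Answer to the request of a posting list by the list of its `stag`s. -/
  posting : ((Bits × Bits × Pub) × View) × List Bits → Ans
  posting_poly : PolyTime posting
  /-- Answer to the last one of the given requests of sub-filters. -/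
  subFilter : (((Bits × Bits × Pub) × View) × List Bits) × List Bits → SubFilter
  subFilter_poly : PolyTime subFilter

/-- The attack succeeds: the search was accepted, and its result has an element that the correct
result lacks, or lacks one that the correct result has. -/
def Wrong (correct : Graph → Query → Set Bits) (out : Option (Graph × Query × List Bits)) : Prop :=
  ∃ G q R, out = some (G, q, R) ∧
    ((∃ r ∈ R, r ∉ correct G q) ∨ (∃ r ∈ correct G q, r ∉ R))

/-! ## VSecGraph -/

/-- The enclave also keeps the map `M_h`. -/
structure VState where
  enc : Enclave
  mh : List (Bits × Bits)
  srv : Server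

/-- Seeds of the multiset hash and of `H₃`. -/
abbrev VPub := Bits × Bits

/-- `UpdateCnt`, `IndexTree`, `M_h`; `TSet`, `ITSet`, `XSet`. -/
abbrev VView :=
  (List (Bits × ℕ) × List (Bits × Bits) × List (Bits × Bits)) ×
  (List (Bits × Bits) × List (Bits × Bits) × List (Bits × SubFilter))

def VState.view (st : VState) : VView :=
  ((st.enc.cnt, st.enc.index, st.mh), (st.srv.tset, st.srv.itset, st.srv.xset))

def vUpdate (lam : ℕ) (pub : VPub) (K : Keys) (st : VState) (t : Token) : Option VState := do
  let (E, S) ← P.coreUpdate lam pub.2 K st.enc st.srv t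
  let h := (st.mh.lookup t.1).getD (P.MH.hash lam pub.1 0)
  some ⟨E, put st.mh t.1 (P.hashStep lam pub.1 h t), S⟩

def vSearch (lam : ℕ) (pub : VPub) (K : Keys) (st : VState) (q : Query)
    (posting : List Bits → List Bits) (subFilter : List Bits → List Bits → SubFilter) :
    Option (List Bits) :=
  match st.enc.cnt.lookup q.1 with
  | none => some []
  | some c => do
    let sl := P.stagList lam K q.1 c
    let pl ← P.decryptPL lam K q.1 c (posting sl)
    let h ← st.mh.lookup q.1
    guard (P.hashPL lam pub.1 pl = h)
    P.filterAll lam pub.2 st.enc.index (subFilter sl) q.2 pl []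

/-- The final graph, the query and the accepted result, or `none` if the updates are not possible or
the enclave rejects. -/
def vGame (A : Adversary VPub VView (List Bits)) (lam : ℕ) (coins : Bits) (pub : VPub) (K : Keys) :
    Option (Graph × Query × List Bits) := do
  let inp := (unary lam, coins, pub)
  let ts := A.graph inp
  let G ← ts.foldlM (P.graphStep lam) []
  let st ← ts.foldlM (P.vUpdate lam pub K) ⟨P.initEnclave lam pub.2, [], initServer⟩
  let q := A.query (inp, st.view)
  let R ← P.vSearch lam pub K st q (fun sl => A.posting ((inp, st.view), sl))
    (fun sl ids => A.subFilter (((inp, st.view), sl), ids))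
  some (G, q, R)

/-- VSecGraph is sound and complete with respect to the given notion of correct result. -/
def VSecGraphCorrect (correct : ℕ → Graph → Query → Set Bits) : Prop :=
  ∀ A : Adversary VPub VView (List Bits), Negligible fun lam =>
    prob fun o : Tape (A.coins lam) × (Tape (P.MH.seedLen lam) × Tape (P.H3.seedLen lam)) ×
        (Tape lam × Tape lam × Tape lam) =>
      Wrong (correct lam) (P.vGame A lam o.1.bits (o.2.1.1.bits, o.2.1.2.bits)
        (o.2.2.1.bits, o.2.2.2.1.bits, o.2.2.2.2.bits))

/-! ## VSecGraph-A -/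

/-- `M_h` is moved to the server, indexed by `H₄(w)`.  The keywords are numbered in the order of
their first insertion and divided into groups.  For every group the enclave keeps an accumulation
value, and the server the product of the accumulated primes. -/
structure AState where
  enc : Enclave
  ac : List (ℕ × ℕ)
  srv : Server
  mh : List (Bits × Bits)
  xp : List (ℕ × ℕ)

/-- Seeds of the multiset hash, of `H₃`, of `H₄` and of the prime representatives; `n` and `g`. -/
abbrev APub := (Bits × Bits × Bits × Bits) × (ℕ × ℕ)

/-- `UpdateCnt`, `IndexTree`, accumulation values; `TSet`, `ITSet`, `XSet`, `M_h`, products. -/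
abbrev AView :=
  (List (Bits × ℕ) × List (Bits × Bits) × List (ℕ × ℕ)) ×
  (List (Bits × Bits) × List (Bits × Bits) × List (Bits × SubFilter) ×
    List (Bits × Bits) × List (ℕ × ℕ))

/-- The entries of the posting list, the multiset hash and the witness. -/
abbrev AAns := List Bits × Bits × ℕ

def AState.view (st : AState) : AView :=
  ((st.enc.cnt, st.enc.index, st.ac), (st.srv.tset, st.srv.itset, st.srv.xset, st.mh, st.xp))

/-- Group of a keyword (of the next new keyword, if `w` has not been inserted yet). -/
def group (E : Enclave) (w : Bits) : ℕ := (E.cnt.map Prod.fst).idxOf w / P.groupSize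

/-- The accumulation value of a group, initially that of the empty set. -/
def acOf (pub : APub) (st : AState) (j : ℕ) : ℕ := (st.ac.lookup j).getD (pub.2.2 % pub.2.1)

def aUpdate (lam : ℕ) (pub : APub) (pq : ℕ × ℕ) (K : Keys) (st : AState) (t : Token) :
    Option AState := do
  let ((sM, s3, s4, sR), (n, g)) := pub
  let (E, S) ← P.coreUpdate lam s3 K st.enc st.srv t
  let j := P.group st.enc t.1
  let ac := acOf pub st j
  let xp := (st.xp.lookup j).getD 1
  let tau := P.H4.hash lam s4 t.1
  match st.enc.cnt.lookup t.1 with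
  | none =>
    let h := P.hashStep lam sM (P.MH.hash lam sM 0) t
    let x := P.Acc.rep lam sR (tau ++ h)
    some ⟨E, put st.ac j (accInsert n x ac), S, put st.mh tau h, put st.xp j (xp * x)⟩
  | some _ =>
    let h ← st.mh.lookup tau
    let x := P.Acc.rep lam sR (tau ++ h)
    let wit := g ^ (xp / x) % n
    guard (accVerify n x wit ac)
    let h' := P.hashStep lam sM h t
    let x' := P.Acc.rep lam sR (tau ++ h')
    some ⟨E, put st.ac j (accInsert n x' (accDelete pq.1 pq.2 x ac)), S, put st.mh tau h',
      put st.xp j (xp / x * x')⟩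

def aSearch (lam : ℕ) (pub : APub) (K : Keys) (st : AState) (q : Query)
    (posting : List Bits → AAns) (subFilter : List Bits → List Bits → SubFilter) :
    Option (List Bits) :=
  let ((sM, s3, s4, sR), (n, _)) := pub
  match st.enc.cnt.lookup q.1 with
  | none => some []
  | some c => do
    let sl := P.stagList lam K q.1 c
    let (es, h, wit) := posting sl
    guard (accVerify n (P.Acc.rep lam sR (P.H4.hash lam s4 q.1 ++ h)) wit
      (acOf pub st (P.group st.enc q.1)))
    let pl ← P.decryptPL lam K q.1 c es
    guard (P.hashPL lam sM pl = h)
    P.filterAll lam s3 st.enc.index (subFilter sl) q.2 pl []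

def aGame (A : Adversary APub AView AAns) (lam : ℕ) (coins : Bits) (seeds : Bits × Bits × Bits × Bits)
    (pqg : ℕ × ℕ × ℕ) (K : Keys) : Option (Graph × Query × List Bits) := do
  let pub : APub := (seeds, (pqg.1 * pqg.2.1, pqg.2.2))
  let inp := (unary lam, coins, pub)
  let ts := A.graph inp
  let G ← ts.foldlM (P.graphStep lam) []
  let st ← ts.foldlM (P.aUpdate lam pub (pqg.1, pqg.2.1) K)
    ⟨P.initEnclave lam seeds.2.1, [], initServer, [], []⟩
  let q := A.query (inp, st.view)
  let R ← P.aSearch lam pub K st q (fun sl => A.posting ((inp, st.view), sl))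
    (fun sl ids => A.subFilter (((inp, st.view), sl), ids))
  some (G, q, R)

/-- VSecGraph-A is sound and complete with respect to the given notion of correct result. -/
def VSecGraphACorrect (correct : ℕ → Graph → Query → Set Bits) : Prop :=
  ∀ A : Adversary APub AView AAns, Negligible fun lam =>
    prob fun o : Tape (A.coins lam) ×
        (Tape (P.MH.seedLen lam) × Tape (P.H3.seedLen lam) × Tape (P.H4.seedLen lam) ×
          Tape (P.Acc.repSeedLen lam)) ×
        Tape (P.Acc.coins lam) × (Tape lam × Tape lam × Tape lam) =>
      Wrong (correct lam) (P.aGame A lam o.1.bits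
        (o.2.1.1.bits, o.2.1.2.1.bits, o.2.1.2.2.1.bits, o.2.1.2.2.2.bits)
        (P.Acc.setup lam o.2.2.1.bits)
        (o.2.2.2.1.bits, o.2.2.2.2.1.bits, o.2.2.2.2.2.bits))

/-- Collision resistance of the fingerprint function. -/
def FingerprintCollisionResistant : Prop :=
  CollisionResistant (fun _ => 0) (fun x : Bits => x) (fun lam _ x => P.H2 lam x)

end Primitives

/-! The server is bound by hashes. If an accepted search has a wrong result, then either the loaded
posting list differs as a multiset from the true one and has the same multiset hash, or some loaded
sub-filter differs from the genuine one with the same identifier and has the same hash under `H3`.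
Either way there is a collision (`collision_of_wrong`). Encryption plays no part in this: whatever
the loaded entries decrypt to, the decrypted list is judged by its hash.

That the result is right when everything loaded is genuine rests on an invariant of the cuckoo
filter. A stored fingerprint is regarded up to its class: the full fingerprint and the unordered
pair of its candidate buckets. Xor with a fixed string is an involution, so a kick leaves the class
unchanged, and a split merely sorts the slots by their next bit. Hence the classes in all
sub-filters together form the multiset of the classes of all edges (`Represents`, preserved by
`Represents.coreUpdate`). The identifiers of the sub-filters are pairwise incomparable, so the
sub-filter responsible for a fingerprint decides alone whether its class occurs, and the test agrees
with `filterResult` (`filterAll_spec`).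

In VSecGraph-A the accumulation value of a group is `g` to the product of the representatives of its
strings `H4(w) ++ h_w` (`ARepresents`). Deletion preserves this because the representatives are
invertible modulo `φ(n)` (`accDelete_pow`). If the server gets a hash other than `h_w` accepted, and
no two keywords collide under `H4`, then the verified string is not among the accumulated ones, and
the witness is a forgery (`aGame_collision`). A reduction to the accumulator does not know `p` and
`q`, but it can compute the same value as a power of `g` from the graph (`aUpd`).

For exact results, a false positive of the filter is a pair of different cross tags with the same
fingerprint (`crossTagPair_spec`).

Every reduction runs the entire attack: it plays the enclave and the honest server, puts the
challenge into its place and draws all other seeds and keys from its own coins. A rearrangement of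
the random tape identifies this with the real attack, and a union bound finishes the proof. The bulk
of the work is to show that the reductions are polynomial in the language with step count. Closure
lemmas for `PolyTime` are combined by `fun_prop`; loops need explicit bounds on all intermediate
states, because iterating a polynomial-time step can produce exponential sizes. Two facts keep the
states small: every update lengthens the components of the state by a bounded amount
(`CoreBdd.step`), and the requests of sub-filters consist of identifiers only, so that large answers
do not lead to larger requests (`CacheBdd.filterKeyword`). -/

/-! ## Sizes and polynomial bounds -/

/-- Size of the encoding. -/
def esize {α : Type} [Enc α] (x : α) : ℕ := (Enc.enc x).size

/-- Bounded by a polynomial in the size of the argument. -/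
def PolyBdd {α : Type} [Enc α] (f : α → ℕ) : Prop :=
  ∃ q : Polynomial ℕ, ∀ x, f x ≤ q.eval (esize x)

theorem Polynomial.eval_mono_nat (q : Polynomial ℕ) {a b : ℕ} (h : a ≤ b) :
    q.eval a ≤ q.eval b := by
  simp only [Polynomial.eval_eq_sum, Polynomial.sum]
  gcongr

section PolyBdd

variable {α β γ : Type} [Enc α] [Enc β] [Enc γ]

-- Polynomial bounds and polynomial time are proved by syntactic decomposition of the function; the
-- closure lemmas tagged below serve as the rules.
attribute [fun_prop] PolyBdd PolyTime

theorem PolyBdd.mono {f g : α → ℕ} (hg : PolyBdd g) (h : ∀ x, f x ≤ g x) : PolyBdd f :=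
  hg.imp fun _ hq x => (h x).trans (hq x)

@[fun_prop]
theorem PolyBdd.id_nat : PolyBdd fun x : α => esize x := ⟨Polynomial.X, fun x => by simp⟩

@[fun_prop]
theorem PolyBdd.const (n : ℕ) : PolyBdd fun _ : α => n := ⟨Polynomial.C n, fun x => by simp⟩

@[fun_prop]
theorem PolyBdd.add {f g : α → ℕ} (hf : PolyBdd f) (hg : PolyBdd g) :
    PolyBdd fun x => f x + g x := by
  obtain ⟨p, hp⟩ := hf
  obtain ⟨q, hq⟩ := hg
  exact ⟨p + q, fun x => by simpa using Nat.add_le_add (hp x) (hq x)⟩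

@[fun_prop]
theorem PolyBdd.mul {f g : α → ℕ} (hf : PolyBdd f) (hg : PolyBdd g) :
    PolyBdd fun x => f x * g x := by
  obtain ⟨p, hp⟩ := hf
  obtain ⟨q, hq⟩ := hg
  exact ⟨p * q, fun x => by simpa using Nat.mul_le_mul (hp x) (hq x)⟩

@[fun_prop]
theorem PolyBdd.pow {f : α → ℕ} (hf : PolyBdd f) (n : ℕ) : PolyBdd fun x => f x ^ n := by
  obtain ⟨p, hp⟩ := hf
  exact ⟨p ^ n, fun x => by simpa using Nat.pow_le_pow_left (hp x) n⟩

@[fun_prop]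
theorem PolyBdd.eval (q : Polynomial ℕ) {f : α → ℕ} (hf : PolyBdd f) :
    PolyBdd fun x => q.eval (f x) := by
  obtain ⟨p, hp⟩ := hf
  exact ⟨q.comp p, fun x => by simpa using q.eval_mono_nat (hp x)⟩

end PolyBdd

/-! ### Running time, and closure of polynomial time under the program constructors. -/

theorem Val.size_pos (v : Val) : 1 ≤ v.size := by cases v <;> simp [Val.size]

/-- An elementary operation costs the square of the sum of two positive sizes, which exceeds either
of them, and every other rule adds one step. Thus a time bound is also a bound for the size of the
output. -/
theorem Run.size_le {p : Prog} {v w : Val} {t : ℕ} (h : Run p v w t) :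
    v.size + 1 ≤ t ∧ w.size + 1 ≤ t := by
  induction h with
  | op o v =>
    have := v.size_pos
    have := (o.eval v).size_pos
    constructor <;> nlinarith
  | pair _ _ ih1 ih2 => simp only [Val.size]; omega
  | comp _ _ ih1 ih2 => omega
  | condTrue _ _ _ ih1 ih2 => omega
  | condFalse _ _ ih1 ih2 => omega
  | loopStop _ ih => omega
  | loopStep _ _ _ _ ih1 ih2 ih3 => omega

section PolyTime

variable {α β γ δ : Type} [Enc α] [Enc β] [Enc γ] [Enc δ]

theorem PolyTime.of_bdd {f : α → β} (p : Prog) {T : α → ℕ} (hT : PolyBdd T)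
    (h : ∀ x, ∃ t ≤ T x, Run p (Enc.enc x) (Enc.enc (f x)) t) : PolyTime f := by
  obtain ⟨q, hq⟩ := hT
  refine ⟨p, q, fun x => ?_⟩
  obtain ⟨t, ht, hr⟩ := h x
  exact ⟨t, ht.trans (hq x), hr⟩

theorem PolyTime.exists_run {f : α → β} (hf : PolyTime f) :
    ∃ (p : Prog) (T : α → ℕ), PolyBdd T ∧ ∀ x, ∃ t ≤ T x, Run p (Enc.enc x) (Enc.enc (f x)) t := by
  obtain ⟨p, q, h⟩ := hf
  exact ⟨p, fun x => q.eval (esize x), ⟨q, fun x => le_rfl⟩, h⟩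

theorem PolyTime.size_bdd {f : α → β} (hf : PolyTime f) :
    ∃ q : Polynomial ℕ, ∀ x, esize (f x) ≤ q.eval (esize x) := by
  obtain ⟨p, q, h⟩ := hf
  refine ⟨q, fun x => ?_⟩
  obtain ⟨t, ht, hr⟩ := h x
  exact (Nat.le_of_succ_le hr.size_le.2).trans ht

@[fun_prop]
theorem PolyTime.polyBdd {f : α → β} (hf : PolyTime f) : PolyBdd fun x => esize (f x) :=
  hf.size_bdd

theorem PolyTime.of_op {f : α → β} (o : Op) (hf : ∀ x, o.eval (Enc.enc x) = Enc.enc (f x))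
    (hb : PolyBdd fun x => esize (f x)) : PolyTime f := by
  refine .of_bdd (.op o) (T := fun x => (esize x + esize (f x)) ^ 2) (by fun_prop) fun x => ?_
  refine ⟨_, le_rfl, ?_⟩
  have := Run.op o (Enc.enc x)
  rwa [hf x] at this

/-- Only encodings matter, so values of different types with equal encodings are interchangeable.
This covers structures, subtypes, options and `cons` without new programs. -/
theorem PolyTime.of_enc_eq {f : α → β} {g : α → γ} (hf : PolyTime f)
    (h : ∀ x, Enc.enc (f x) = Enc.enc (g x)) : PolyTime g := by
  obtain ⟨p, q, hp⟩ := hf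
  exact ⟨p, q, fun x => h x ▸ hp x⟩

theorem PolyTime.congr {f g : α → β} (hf : PolyTime f) (h : ∀ x, f x = g x) : PolyTime g :=
  hf.of_enc_eq fun x => by rw [h x]

@[fun_prop]
theorem PolyTime.id : PolyTime fun x : α => x := .of_op .id (fun _ => rfl) (by fun_prop)

@[fun_prop]
theorem PolyTime.comp {g : β → γ} {f : α → β} (hg : PolyTime g) (hf : PolyTime f) :
    PolyTime fun x => g (f x) := by
  -- The second program runs on `f x`; its time is polynomial in the size of `x` because the size of
  -- `f x` is.
  have hf' := hf.polyBdd
  obtain ⟨p, T, hT, hp⟩ := hf.exists_run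
  obtain ⟨r, q, hr⟩ := hg
  refine .of_bdd (.comp r p) (T := fun x => T x + q.eval (esize (f x)) + 1) (by fun_prop) fun x => ?_
  obtain ⟨s, hs, h1⟩ := hp x
  obtain ⟨t, ht, h2⟩ := hr (f x)
  exact ⟨_, by gcongr; exact ht, h1.comp h2⟩

@[fun_prop]
theorem PolyTime.prodMk {f : α → β} {g : α → γ} (hf : PolyTime f) (hg : PolyTime g) :
    PolyTime fun x => (f x, g x) := by
  obtain ⟨p, T, hT, hp⟩ := hf.exists_run
  obtain ⟨r, U, hU, hr⟩ := hg.exists_run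
  refine .of_bdd (.pair p r) (T := fun x => T x + U x + 1) (by fun_prop) fun x => ?_
  obtain ⟨s, hs, h1⟩ := hp x
  obtain ⟨t, ht, h2⟩ := hr x
  exact ⟨_, by gcongr, h1.pair h2⟩

theorem esize_pair (a : α) (b : β) : esize (a, b) = esize a + esize b + 1 := rfl

@[fun_prop]
theorem PolyTime.fst {f : α → β × γ} (hf : PolyTime f) : PolyTime fun x => (f x).1 :=
  PolyTime.comp (g := Prod.fst) (.of_op .fst (fun _ => rfl) (PolyBdd.id_nat.mono fun ⟨a, b⟩ => by
    simp only [esize_pair]; omega)) hf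

@[fun_prop]
theorem PolyTime.snd {f : α → β × γ} (hf : PolyTime f) : PolyTime fun x => (f x).2 :=
  PolyTime.comp (g := Prod.snd) (.of_op .snd (fun _ => rfl) (PolyBdd.id_nat.mono fun ⟨a, b⟩ => by
    simp only [esize_pair]; omega)) hf

/-- A program with a fixed output. -/
def Val.prog : Val → Prog
  | .nat n => .op (.const n)
  | .pair a b => .pair a.prog b.prog

@[fun_prop]
theorem PolyTime.const (c : β) : PolyTime fun _ : α => c := by
  have key : ∀ w : Val, ∃ T : α → ℕ, PolyBdd T ∧ ∀ x, ∃ t ≤ T x, Run w.prog (Enc.enc x) w t := by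
    intro w
    induction w with
    | nat n =>
      exact ⟨fun x => (esize x + (Val.nat n).size) ^ 2, by fun_prop,
        fun x => ⟨_, le_rfl, Run.op (.const n) _⟩⟩
    | pair a b iha ihb =>
      obtain ⟨T, hT, h1⟩ := iha
      obtain ⟨U, hU, h2⟩ := ihb
      refine ⟨fun x => T x + U x + 1, by fun_prop, fun x => ?_⟩
      obtain ⟨s, hs, h1⟩ := h1 x
      obtain ⟨t, ht, h2⟩ := h2 x
      exact ⟨_, by dsimp only; omega, h1.pair h2⟩
  obtain ⟨T, hT, h⟩ := key (Enc.enc c)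
  exact .of_bdd _ hT h

@[fun_prop]
theorem PolyTime.bool_ite {c : α → Bool} {f g : α → β} (hc : PolyTime c) (hf : PolyTime f)
    (hg : PolyTime g) : PolyTime fun x => if c x = true then f x else g x := by
  obtain ⟨p, T, hT, hp⟩ := hc.exists_run
  obtain ⟨r, U, hU, hr⟩ := hf.exists_run
  obtain ⟨l, V, hV, hl⟩ := hg.exists_run
  refine .of_bdd (.cond p r l) (T := fun x => T x + (U x + V x) + 1) (by fun_prop) fun x => ?_
  obtain ⟨s, hs, h1⟩ := hp x
  obtain ⟨t, ht, h2⟩ := hr x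
  obtain ⟨u, hu, h3⟩ := hl x
  cases hx : c x with
  | true =>
    rw [hx] at h1
    refine ⟨_, ?_, h1.condTrue (by simp [Enc.enc]) h2⟩
    omega
  | false =>
    rw [hx] at h1
    refine ⟨_, ?_, h1.condFalse h3⟩
    omega

instance {p : α → Prop} : Enc (Subtype p) := ⟨fun x => Enc.enc x.1⟩

theorem PolyTime.val {p : α → Prop} : PolyTime (Subtype.val : Subtype p → α) :=
  PolyTime.id.of_enc_eq (f := fun x : Subtype p => x) fun _ => rfl

/-- A branch has to be polynomial only on the inputs that reach it. This admits partial operations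
such as reading the content of an option. -/
theorem PolyTime.dite {c : α → Bool} {f : {x // c x = true} → β} {g : {x // ¬ c x = true} → β}
    (hc : PolyTime c) (hf : PolyTime f) (hg : PolyTime g) :
    PolyTime fun x => if h : c x = true then f ⟨x, h⟩ else g ⟨x, h⟩ := by
  obtain ⟨p, T, hT, hp⟩ := hc.exists_run
  obtain ⟨r, U, hr⟩ := hf
  obtain ⟨l, V, hl⟩ := hg
  refine .of_bdd (.cond p r l) (T := fun x => T x + (U.eval (esize x) + V.eval (esize x)) + 1)
    (by fun_prop) fun x => ?_
  obtain ⟨s, hs, h1⟩ := hp x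
  by_cases hx : c x = true
  · obtain ⟨t, ht, h2⟩ := hr ⟨x, hx⟩
    rw [hx] at h1
    refine ⟨_, ?_, by rw [dif_pos hx]; exact h1.condTrue (by simp [Enc.enc]) h2⟩
    simp only [Enc.enc, esize] at ht ⊢
    omega
  · obtain ⟨t, ht, h2⟩ := hl ⟨x, hx⟩
    rw [Bool.eq_false_of_not_eq_true hx] at h1
    refine ⟨_, ?_, by rw [dif_neg hx]; exact h1.condFalse h2⟩
    simp only [Enc.enc, esize] at ht ⊢
    omega

theorem PolyTime.ite {c : α → Prop} [DecidablePred c] {f g : α → β}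
    (hc : PolyTime fun x => decide (c x)) (hf : PolyTime f)
    (hg : PolyTime g) : PolyTime fun x => if c x then f x else g x :=
  (hc.bool_ite hf hg).congr fun x => by simp

/-- The total time is the number of iterations times the cost of one, and the latter is controlled
by the bound `B` for the states. Such a bound is indispensable: repeated squaring has polynomial
steps but iterates of exponential size. -/
theorem PolyTime.iterate {init : α → β} {c : β → Bool} {b : β → β} {N B : α → ℕ}
    (hi : PolyTime init) (hc : PolyTime c) (hb : PolyTime b) (hN : PolyBdd N) (hB : PolyBdd B)
    (h1 : ∀ x, ∀ k < N x, c (b^[k] (init x)) = true) (h2 : ∀ x, c (b^[N x] (init x)) = false)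
    (h3 : ∀ x, ∀ k ≤ N x, esize (b^[k] (init x)) ≤ B x) :
    PolyTime fun x => b^[N x] (init x) := by
  obtain ⟨p, T, hT, hp⟩ := hi.exists_run
  obtain ⟨pc, qc, hqc⟩ := hc
  obtain ⟨pb, qb, hqb⟩ := hb
  refine .of_bdd (.comp (.loop pc pb) p)
    (T := fun x => T x + ((N x + 1) * (qc.eval (B x) + qb.eval (B x) + 1)) + 1)
    (by fun_prop) fun x => ?_
  obtain ⟨s, hs, hr⟩ := hp x
  -- `j` counts the remaining iterations: the rule for loops peels off the first iteration, so the
  -- induction runs backwards from the final state. The summand 1 in `j + 1` pays for the last,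
  -- failing test.
  have key : ∀ j ≤ N x, ∃ t ≤ (j + 1) * (qc.eval (B x) + qb.eval (B x) + 1),
      Run (.loop pc pb) (Enc.enc (b^[N x - j] (init x))) (Enc.enc (b^[N x] (init x))) t := by
    intro j
    induction j with
    | zero =>
      intro _
      obtain ⟨t, ht, h⟩ := hqc (b^[N x] (init x))
      rw [h2 x] at h
      have := qc.eval_mono_nat (h3 x (N x) le_rfl)
      refine ⟨t + 1, ?_, h.loopStop⟩
      unfold esize at this
      omega
    | succ j ih =>
      intro hj
      obtain ⟨u, hu, hu'⟩ := ih (by omega)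
      obtain ⟨t, ht, h⟩ := hqc (b^[N x - (j + 1)] (init x))
      obtain ⟨r, hr, h'⟩ := hqb (b^[N x - (j + 1)] (init x))
      rw [h1 x _ (by omega)] at h
      rw [← Function.iterate_succ_apply' b, show (N x - (j + 1)).succ = N x - j by omega] at h'
      have e1 := qc.eval_mono_nat (h3 x (N x - (j + 1)) (by omega))
      have e2 := qb.eval_mono_nat (h3 x (N x - (j + 1)) (by omega))
      refine ⟨t + r + u + 1, ?_, h.loopStep (by simp [Enc.enc]) h' hu'⟩
      unfold esize at e1 e2
      rw [add_mul, one_mul]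
      omega
  obtain ⟨t, ht, h⟩ := key (N x) le_rfl
  rw [Nat.sub_self] at h
  exact ⟨_, by gcongr, hr.comp h⟩

end PolyTime

/-! ## Equality tests, arithmetic, options and lists in polynomial time -/

/-- The operation `eq` compares encodings, so it decides equality of the encoded objects only under
injectivity. -/
class EncInj (α : Type) [Enc α] : Prop where
  inj : Function.Injective (Enc.enc : α → Val)

/-- `none` is a leaf and `some a` is a pair: `isPair` tells them apart and `snd` extracts the
content. -/
instance {α : Type} [Enc α] : Enc (Option α) :=
  ⟨fun o => o.elim (.nat 0) fun a => .pair (.nat 0) (Enc.enc a)⟩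

instance : Enc Val := ⟨id⟩

instance : EncInj ℕ := ⟨fun _ _ h => by injection h⟩

instance : EncInj Bool := ⟨fun a b h => by
  cases a <;> cases b <;> simp_all [Enc.enc]⟩

instance {α β : Type} [Enc α] [Enc β] [EncInj α] [EncInj β] : EncInj (α × β) := ⟨by
  rintro ⟨a, b⟩ ⟨c, d⟩ h
  injection h with h1 h2
  exact Prod.ext (EncInj.inj h1) (EncInj.inj h2)⟩

instance {α : Type} [Enc α] [EncInj α] : EncInj (List α) := ⟨fun l => by
  induction l with
  | nil => intro m h; cases m <;> first | rfl | cases h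
  | cons a l ih =>
    intro m h
    cases m with
    | nil => cases h
    | cons b m =>
      injection h with h1 h2
      rw [EncInj.inj h1, ih h2]⟩

section

variable {α β γ δ σ : Type} [Enc α] [Enc β] [Enc γ] [Enc δ] [Enc σ]

theorem esize_nil : esize ([] : List α) = 1 := rfl

theorem esize_cons (a : α) (l : List α) : esize (a :: l) = esize a + esize l + 1 := rfl

theorem esize_none : esize (none : Option α) = 1 := rfl

theorem esize_some (a : α) : esize (some a) = esize a + 2 := by
  change 1 + esize a + 1 = _
  omega

theorem esize_nat (n : ℕ) : esize n = Nat.size n + 1 := rfl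

theorem esize_bool (b : Bool) : esize b ≤ 2 := by cases b <;> simp [esize, Enc.enc, Val.size]

theorem esize_pos (a : α) : 1 ≤ esize a := Val.size_pos _

/-! ### Arithmetic -/

@[fun_prop]
theorem PolyTime.decide_eq [EncInj β] [DecidableEq β] {f g : α → β}
    (hf : PolyTime f) (hg : PolyTime g) : PolyTime fun x => decide (f x = g x) := by
  refine PolyTime.comp (g := fun p : β × β => decide (p.1 = p.2)) (.of_op .eq ?_ ?_) (hf.prodMk hg)
  · rintro ⟨a, b⟩
    by_cases h : a = b
    · simp [Enc.enc, Op.eval, h]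
    · have : ¬ Enc.enc a = Enc.enc b := fun h' => h (EncInj.inj h')
      simp [h]
      simp [Enc.enc, Op.eval, this]
  · exact (PolyBdd.const 2).mono fun _ => esize_bool _

@[fun_prop]
theorem PolyTime.beq [EncInj β] [BEq β] [LawfulBEq β] {f g : α → β}
    (hf : PolyTime f) (hg : PolyTime g) : PolyTime fun x => f x == g x := by
  classical
  exact (PolyTime.decide_eq hf hg).congr fun x => by by_cases h : f x = g x <;> simp [h]

theorem PolyTime.nat_op {op : ℕ → ℕ → ℕ} (o : Op)
    (ho : ∀ a b, o.eval (.pair (.nat a) (.nat b)) = .nat (op a b))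
    (hs : ∀ a b, (op a b).size ≤ a.size + b.size + 1) {f g : α → ℕ}
    (hf : PolyTime f) (hg : PolyTime g) : PolyTime fun x => op (f x) (g x) := by
  refine PolyTime.comp (g := fun p : ℕ × ℕ => op p.1 p.2) (.of_op o ?_ ?_) (hf.prodMk hg)
  · rintro ⟨a, b⟩
    exact ho a b
  · refine PolyBdd.id_nat.mono ?_
    rintro ⟨a, b⟩
    have := hs a b
    simp only [esize_pair, esize_nat] at this ⊢
    omega

theorem Nat.size_add_le (a b : ℕ) : (a + b).size ≤ a.size + b.size + 1 := by
  rw [Nat.size_le]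
  have ha := Nat.lt_size_self a
  have hb := Nat.lt_size_self b
  have h1 : 2 ^ a.size ≤ 2 ^ (a.size + b.size) := Nat.pow_le_pow_right (by norm_num) (by omega)
  have h2 : 2 ^ b.size ≤ 2 ^ (a.size + b.size) := Nat.pow_le_pow_right (by norm_num) (by omega)
  rw [pow_succ]
  omega

theorem Nat.size_mul_le (a b : ℕ) : (a * b).size ≤ a.size + b.size := by
  rw [Nat.size_le, pow_add]
  exact Nat.mul_lt_mul'' (Nat.lt_size_self a) (Nat.lt_size_self b)

@[fun_prop]
theorem PolyTime.add {f g : α → ℕ} (hf : PolyTime f) (hg : PolyTime g) :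
    PolyTime fun x => f x + g x :=
  .nat_op .add (fun _ _ => rfl) Nat.size_add_le hf hg

@[fun_prop]
theorem PolyTime.sub {f g : α → ℕ} (hf : PolyTime f) (hg : PolyTime g) :
    PolyTime fun x => f x - g x :=
  .nat_op .sub (fun _ _ => rfl) (fun a b => (Nat.size_le_size (Nat.sub_le a b)).trans (by omega)) hf hg

@[fun_prop]
theorem PolyTime.mul {f g : α → ℕ} (hf : PolyTime f) (hg : PolyTime g) :
    PolyTime fun x => f x * g x :=
  .nat_op .mul (fun _ _ => rfl) (fun a b => (Nat.size_mul_le a b).trans (by omega)) hf hg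

@[fun_prop]
theorem PolyTime.div {f g : α → ℕ} (hf : PolyTime f) (hg : PolyTime g) :
    PolyTime fun x => f x / g x :=
  .nat_op .div (fun _ _ => rfl) (fun a b => (Nat.size_le_size (Nat.div_le_self a b)).trans (by omega))
    hf hg

@[fun_prop]
theorem PolyTime.mod {f g : α → ℕ} (hf : PolyTime f) (hg : PolyTime g) :
    PolyTime fun x => f x % g x :=
  .nat_op .mod (fun _ _ => rfl) (fun a b => (Nat.size_le_size (Nat.mod_le a b)).trans (by omega)) hf hg

@[fun_prop]
theorem PolyTime.not {c : α → Bool} (hc : PolyTime c) : PolyTime fun x => !c x :=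
  (hc.bool_ite (.const false) (.const true)).congr fun x => by cases c x <;> rfl

@[fun_prop]
theorem PolyTime.and {c d : α → Bool} (hc : PolyTime c) (hd : PolyTime d) :
    PolyTime fun x => c x && d x :=
  (hc.bool_ite hd (.const false)).congr fun x => by cases c x <;> rfl

@[fun_prop]
theorem PolyTime.or {c d : α → Bool} (hc : PolyTime c) (hd : PolyTime d) :
    PolyTime fun x => c x || d x :=
  (hc.bool_ite (.const true) hd).congr fun x => by cases c x <;> rfl

@[fun_prop]
theorem PolyTime.decide_not {c : α → Prop} [DecidablePred c] (hc : PolyTime fun x => decide (c x)) :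
    PolyTime fun x => decide (¬ c x) :=
  hc.not.congr fun x => by simp

@[fun_prop]
theorem PolyTime.decide_and {c d : α → Prop} [DecidablePred c] [DecidablePred d]
    (hc : PolyTime fun x => decide (c x)) (hd : PolyTime fun x => decide (d x)) :
    PolyTime fun x => decide (c x ∧ d x) :=
  (hc.and hd).congr fun x => by simp

-- The language has no comparison of numbers; truncated subtraction replaces it.
@[fun_prop]
theorem PolyTime.decide_lt {f g : α → ℕ} (hf : PolyTime f) (hg : PolyTime g) :
    PolyTime fun x => decide (f x < g x) :=
  (PolyTime.not (.decide_eq (hg.sub hf) (.const 0))).congr fun x => by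
    by_cases h : f x < g x <;> simp [h] <;> omega

attribute [fun_prop] PolyTime.ite

/-! ### Options -/

@[fun_prop]
theorem PolyTime.some {f : α → β} (hf : PolyTime f) : PolyTime fun x => some (f x) :=
  PolyTime.of_enc_eq (f := fun x => ((0 : ℕ), f x)) (by fun_prop) fun _ => rfl

theorem PolyTime.isPair {f : α → β} (hf : PolyTime f) :
    PolyTime fun x => match Enc.enc (f x) with
      | .pair _ _ => true
      | .nat _ => false := by
  refine PolyTime.comp (g := fun y : β => match Enc.enc y with
      | .pair _ _ => true
      | .nat _ => false) (.of_op .isPair ?_ ?_) hf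
  · intro y
    rcases h : Enc.enc y with _ | _ <;> simp [Op.eval, Enc.enc]
  · exact (PolyBdd.const 2).mono fun _ => esize_bool _

@[fun_prop]
theorem PolyTime.isSome {o : α → Option β} (ho : PolyTime o) : PolyTime fun x => (o x).isSome :=
  ho.isPair.congr fun x => by cases h : o x <;> simp [Enc.enc]

@[fun_prop]
theorem PolyTime.isNone {o : α → Option β} (ho : PolyTime o) : PolyTime fun x => (o x).isNone :=
  ho.isSome.not.congr fun x => by simp

@[fun_prop]
theorem PolyTime.option_elim {o : α → Option β} {g : α → γ} {f : α → β → γ} (ho : PolyTime o)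
    (hg : PolyTime g) (hf : PolyTime fun p : α × β => f p.1 p.2) :
    PolyTime fun x => (o x).elim (g x) (f x) := by
  -- On the values `some b` the content is the second component of the encoding; `PolyTime.dite`
  -- confines the extraction to them.
  have hget : PolyTime fun o : {o : Option β // o.isSome = true} => o.1.get o.2 := by
    refine .of_op .snd ?_ ?_
    · rintro ⟨_ | b, h⟩
      · cases h
      · rfl
    · refine PolyBdd.id_nat.mono ?_
      rintro ⟨_ | b, h⟩
      · cases h
      · change esize b ≤ esize (Option.some b)
        rw [esize_some]
        omega
  have hx : PolyTime fun x : {x : α // (o x).isSome = true} =>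
      (⟨o x.1, x.2⟩ : {o : Option β // o.isSome = true}) :=
    (ho.comp .val).of_enc_eq fun _ => rfl
  have h1 : PolyTime fun x : {x : α // (o x).isSome = true} => f x.1 ((o x.1).get x.2) :=
    hf.comp (PolyTime.val.prodMk (hget.comp hx))
  have h2 : PolyTime fun x : {x : α // ¬ (o x).isSome = true} => g x.1 := hg.comp .val
  refine (PolyTime.dite ho.isSome h1 h2).congr fun x => ?_
  by_cases h : (o x).isSome = true
  · rw [dif_pos h]
    obtain ⟨b, hb⟩ := Option.isSome_iff_exists.1 h
    simp [hb]
  · rw [dif_neg h]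
    simp [Option.not_isSome_iff_eq_none.1 h]

@[fun_prop]
theorem PolyTime.option_bind {o : α → Option β} {f : α → β → Option γ} (ho : PolyTime o)
    (hf : PolyTime fun p : α × β => f p.1 p.2) : PolyTime fun x => (o x).bind (f x) :=
  (PolyTime.option_elim ho (.const none) hf).congr fun x => by cases o x <;> rfl

@[fun_prop]
theorem PolyTime.option_map {o : α → Option β} {f : α → β → γ} (ho : PolyTime o)
    (hf : PolyTime fun p : α × β => f p.1 p.2) : PolyTime fun x => (o x).map (f x) :=
  (PolyTime.option_elim ho (.const none) hf.some).congr fun x => by cases o x <;> rfl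

@[fun_prop]
theorem PolyTime.getD {o : α → Option β} {f : α → β} (ho : PolyTime o)
    (hf : PolyTime f) : PolyTime fun x => (o x).getD (f x) :=
  (PolyTime.option_elim ho hf (f := fun _ b => b) (by fun_prop)).congr fun x => by cases o x <;> rfl

/-! ### Lists -/

@[fun_prop]
theorem PolyTime.cons {f : α → β} {l : α → List β} (hf : PolyTime f) (hl : PolyTime l) :
    PolyTime fun x => f x :: l x :=
  (hf.prodMk hl).of_enc_eq fun _ => rfl

/-- Head and tail. -/
def List.uncons (l : List β) : Option (β × List β) :=
  l.casesOn none fun a l => some (a, l)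

@[fun_prop]
theorem PolyTime.uncons {l : α → List β} (hl : PolyTime l) : PolyTime fun x => (l x).uncons := by
  -- A nonempty list is already encoded as the pair of its head and its tail, so a leaf in front of
  -- it gives the encoding of `some`.
  have h1 : PolyTime fun x => (Val.pair (.nat 0) (Enc.enc (l x))) :=
    (PolyTime.prodMk (.const (0 : ℕ)) hl).of_enc_eq fun _ => rfl
  have h2 : PolyTime fun _ : α => Val.nat 0 := .const _
  refine PolyTime.of_enc_eq (hl.isPair.bool_ite h1 h2) fun x => ?_
  cases l x <;> rfl

@[fun_prop]
theorem PolyTime.head? {l : α → List β} (hl : PolyTime l) : PolyTime fun x => (l x).head? :=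
  (PolyTime.option_map hl.uncons (f := fun _ p => p.1) (by fun_prop)).congr fun x => by
    cases l x <;> rfl

theorem esize_append (l m : List α) : esize (l ++ m) + 1 = esize l + esize m := by
  induction l with
  | nil => rw [esize_nil, List.nil_append]; omega
  | cons a l ih => rw [List.cons_append, esize_cons, esize_cons]; omega

theorem length_le_esize (l : List α) : l.length + 1 ≤ esize l := by
  induction l with
  | nil => exact le_rfl
  | cons a l ih => rw [esize_cons, List.length_cons]; omega

theorem esize_lt_of_mem {a : α} {l : List α} (h : a ∈ l) : esize a < esize l := by
  induction l with
  | nil => cases h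
  | cons b l ih =>
    rw [esize_cons]
    rcases List.mem_cons.1 h with rfl | h
    · omega
    · have := ih h
      omega

theorem esize_le_of_forall {l : List α} {M : ℕ} (h : ∀ a ∈ l, esize a ≤ M) :
    esize l ≤ l.length * (M + 1) + 1 := by
  induction l with
  | nil => simp [esize_nil]
  | cons a l ih =>
    rw [esize_cons, List.length_cons, add_mul]
    have := ih fun b hb => h b (List.mem_cons_of_mem _ hb)
    have := h a List.mem_cons_self
    omega

theorem esize_le_of_sublist {l m : List α} (h : l.Sublist m) : esize l ≤ esize m := by
  induction h with
  | slnil => exact le_rfl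
  | cons a _ ih => rw [esize_cons]; omega
  | cons_cons a _ ih => rw [esize_cons, esize_cons]; omega

/-- A fold is a loop whose state consists of the parameter, the rest of the list and the
accumulator. The accumulator has to be bounded after every prefix. -/
theorem PolyTime.foldl {init : α → σ} {l : α → List β} {step : α → σ → β → σ}
    (hi : PolyTime init) (hl : PolyTime l)
    (hs : PolyTime fun p : α × σ × β => step p.1 p.2.1 p.2.2) {B : α → ℕ} (hB : PolyBdd B)
    (h : ∀ x, ∀ m, m <+: l x → esize (m.foldl (step x) (init x)) ≤ B x) :
    PolyTime fun x => (l x).foldl (step x) (init x) := by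
  let b : α × List β × σ → α × List β × σ := fun p =>
    p.2.1.uncons.elim p fun q => (p.1, q.2, step p.1 p.2.2 q.1)
  have hb : PolyTime b := by
    refine PolyTime.option_elim (by fun_prop) (by fun_prop) (.prodMk (by fun_prop) (.prodMk (by fun_prop) ?_))
    exact hs.comp (f := fun p : (α × List β × σ) × β × List β => (p.1.1, p.1.2.2, p.2.1)) (by fun_prop)
  have hit : ∀ x, ∀ k ≤ (l x).length, b^[k] (x, l x, init x) =
      (x, (l x).drop k, ((l x).take k).foldl (step x) (init x)) := by
    intro x k
    induction k with
    | zero => intro _; simp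
    | succ k ih =>
      intro hk
      rw [Function.iterate_succ_apply', ih (by omega), ← List.take_append_getElem (by omega)]
      simp only [b]
      rw [List.drop_eq_getElem_cons (by omega), List.foldl_append]
      rfl
  have key := PolyTime.iterate (init := fun x => (x, l x, init x)) (c := fun p => p.2.1.uncons.isSome)
    (b := b) (N := fun x => (l x).length) (B := fun x => esize x + esize (l x) + B x + 2)
    (by fun_prop) (by fun_prop) hb (hl.polyBdd.mono fun x => (Nat.le_succ _).trans (length_le_esize _))
    (by fun_prop) ?_ ?_ ?_
  · refine key.snd.snd.congr fun x => ?_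
    rw [hit x _ le_rfl, List.take_length]
  · intro x k hk
    rw [hit x k hk.le]
    simp only
    rw [List.drop_eq_getElem_cons hk]
    rfl
  · intro x
    rw [hit x _ le_rfl, List.drop_length]
    rfl
  · intro x k hk
    rw [hit x k hk, esize_pair, esize_pair]
    have := h x _ (List.take_prefix k (l x))
    have := esize_le_of_sublist (List.drop_sublist k (l x))
    omega

/-- A fold is polynomial if every step adds a bounded amount to the size of the accumulator. -/
theorem PolyTime.foldl_of_add {init : α → σ} {l : α → List β} {step : α → σ → β → σ}
    (hi : PolyTime init) (hl : PolyTime l)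
    (hs : PolyTime fun p : α × σ × β => step p.1 p.2.1 p.2.2) {B : α → ℕ} (hB : PolyBdd B)
    (h : ∀ x s, ∀ b ∈ l x, esize (step x s b) ≤ esize s + B x) :
    PolyTime fun x => (l x).foldl (step x) (init x) := by
  refine PolyTime.foldl hi hl hs (B := fun x => esize (init x) + esize (l x) * B x) (by fun_prop) ?_
  intro x m hm
  have key : ∀ (m : List β) (s : σ), (∀ b ∈ m, b ∈ l x) →
      esize (m.foldl (step x) s) ≤ esize s + m.length * B x := by
    intro m
    induction m with
    | nil => intro s _; simp
    | cons b m ih =>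
      intro s hm
      have h1 := ih (step x s b) fun c hc => hm c (List.mem_cons_of_mem _ hc)
      have h2 := h x s b (hm b List.mem_cons_self)
      rw [List.foldl_cons, List.length_cons, add_mul]
      omega
  refine (key m _ hm.subset).trans ?_
  have := length_le_esize (l x)
  have := hm.length_le
  gcongr
  omega

@[fun_prop]
theorem PolyTime.reverse {l : α → List β} (hl : PolyTime l) : PolyTime fun x => (l x).reverse := by
  refine (PolyTime.foldl_of_add (init := fun _ => []) (step := fun _ s b => b :: s)
    (.const _) hl (by fun_prop) (B := fun x => esize (l x) + 1) (by fun_prop) ?_).congr fun x => ?_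
  · intro x s b hb
    have := esize_lt_of_mem hb
    rw [esize_cons]
    omega
  · simp

@[fun_prop]
theorem PolyTime.append {l m : α → List β} (hl : PolyTime l) (hm : PolyTime m) :
    PolyTime fun x => l x ++ m x := by
  refine (PolyTime.foldl_of_add (init := m) (step := fun _ s b => b :: s)
    hm hl.reverse (by fun_prop) (B := fun x => esize (l x) + 1) (by fun_prop) ?_).congr fun x => ?_
  · intro x s b hb
    have := esize_lt_of_mem (List.mem_reverse.1 hb)
    rw [esize_cons]
    omega
  · simp

theorem PolyTime.exists_elem_bdd {l : α → List β} {f : α → β → γ} (hl : PolyTime l)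
    (hf : PolyTime fun p : α × β => f p.1 p.2) :
    ∃ B : α → ℕ, PolyBdd B ∧ ∀ x, ∀ b ∈ l x, esize (f x b) ≤ B x := by
  obtain ⟨q, hq⟩ := hf.size_bdd
  refine ⟨fun x => q.eval (esize x + esize (l x)), by fun_prop, fun x b hb => ?_⟩
  refine (hq (x, b)).trans (q.eval_mono_nat ?_)
  have := esize_lt_of_mem hb
  rw [esize_pair]
  omega

@[fun_prop]
theorem PolyTime.flatMap {l : α → List β} {f : α → β → List γ} (hl : PolyTime l)
    (hf : PolyTime fun p : α × β => f p.1 p.2) : PolyTime fun x => (l x).flatMap (f x) := by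
  obtain ⟨B, hB, h⟩ := PolyTime.exists_elem_bdd hl hf
  refine (PolyTime.foldl_of_add (init := fun _ => []) (step := fun x s b => s ++ f x b)
    (.const _) hl (.append (by fun_prop) (hf.comp (f := fun p : α × List γ × β => (p.1, p.2.2))
      (by fun_prop))) hB ?_).congr fun x => ?_
  · intro x s b hb
    have := esize_append s (f x b)
    have := h x b hb
    omega
  · suffices ∀ (m : List β) (s : List γ), m.foldl (fun s b => s ++ f x b) s = s ++ m.flatMap (f x) by
      simpa using this (l x) []
    intro m
    induction m with
    | nil => intro s; simp
    | cons b m ih => intro s; simp [ih]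

@[fun_prop]
theorem PolyTime.map {l : α → List β} {f : α → β → γ} (hl : PolyTime l)
    (hf : PolyTime fun p : α × β => f p.1 p.2) : PolyTime fun x => (l x).map (f x) :=
  (PolyTime.flatMap hl (f := fun x b => [f x b]) (by fun_prop)).congr fun x => by
    rw [List.map_eq_flatMap]

theorem PolyTime.toList {o : α → Option β} (ho : PolyTime o) : PolyTime fun x => (o x).toList :=
  (PolyTime.option_elim ho (.const []) (f := fun _ b => [b]) (by fun_prop)).congr fun x => by
    cases o x <;> rfl

@[fun_prop]
theorem PolyTime.filterMap {l : α → List β} {f : α → β → Option γ} (hl : PolyTime l)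
    (hf : PolyTime fun p : α × β => f p.1 p.2) : PolyTime fun x => (l x).filterMap (f x) :=
  (PolyTime.flatMap hl (f := fun x b => (f x b).toList) hf.toList).congr fun x => by
    induction l x with
    | nil => rfl
    | cons b l ih => cases h : f x b <;> simp [h, ih]

@[fun_prop]
theorem PolyTime.filter {l : α → List β} {f : α → β → Bool} (hl : PolyTime l)
    (hf : PolyTime fun p : α × β => f p.1 p.2) : PolyTime fun x => (l x).filter (f x) :=
  (PolyTime.filterMap hl (f := fun x b => if f x b then Option.some b else none)
    (by fun_prop)).congr fun x => by
    rw [← List.filterMap_eq_filter]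
    congr 1

@[fun_prop]
theorem PolyTime.find? {l : α → List β} {f : α → β → Bool} (hl : PolyTime l)
    (hf : PolyTime fun p : α × β => f p.1 p.2) : PolyTime fun x => (l x).find? (f x) :=
  (PolyTime.filter hl hf).head?.congr fun x => by rw [List.head?_filter]

@[fun_prop]
theorem PolyTime.any {l : α → List β} {f : α → β → Bool} (hl : PolyTime l)
    (hf : PolyTime fun p : α × β => f p.1 p.2) : PolyTime fun x => (l x).any (f x) :=
  (PolyTime.find? hl hf).isSome.congr fun x => by
    rw [Bool.eq_iff_iff, List.find?_isSome, List.any_eq_true]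

@[fun_prop]
theorem PolyTime.all {l : α → List β} {f : α → β → Bool} (hl : PolyTime l)
    (hf : PolyTime fun p : α × β => f p.1 p.2) : PolyTime fun x => (l x).all (f x) :=
  (PolyTime.any hl (f := fun x b => !f x b) hf.not).not.congr fun x => by
    rw [List.not_any_eq_all_not]; simp

@[fun_prop]
theorem PolyTime.contains [EncInj β] [BEq β] [LawfulBEq β] {l : α → List β} {f : α → β}
    (hl : PolyTime l) (hf : PolyTime f) : PolyTime fun x => (l x).contains (f x) :=
  (PolyTime.any hl (f := fun x b => f x == b) (by fun_prop)).congr fun x => by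
    rw [List.contains_eq_any_beq]

@[fun_prop]
theorem PolyTime.lookup [EncInj β] [BEq β] [LawfulBEq β] {l : α → List (β × γ)} {f : α → β}
    (hl : PolyTime l) (hf : PolyTime f) : PolyTime fun x => (l x).lookup (f x) :=
  (PolyTime.option_map (PolyTime.find? hl (f := fun x b => f x == b.1) (by fun_prop))
    (f := fun _ p => p.2) (by fun_prop)).congr fun x => by
    induction l x with
    | nil => rfl
    | cons b l ih =>
      cases h : f x == b.1 <;> simp [List.lookup, List.find?, h, ih]

@[fun_prop]
theorem PolyTime.length {l : α → List β} (hl : PolyTime l) : PolyTime fun x => (l x).length := by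
  refine (PolyTime.foldl_of_add (init := fun _ => 0) (step := fun _ s _ => s + 1)
    (.const _) hl (by fun_prop) (B := fun x => 2) (by fun_prop) ?_).congr fun x => ?_
  · intro x s b _
    have := Nat.size_add_le s 1
    simp only [esize_nat]
    simp only [Nat.size_one] at this
    omega
  · suffices ∀ (m : List β) (n : ℕ), m.foldl (fun n _ => n + 1) n = n + m.length by
      simp [this]
    intro m
    induction m with
    | nil => intro n; simp
    | cons b m ih => intro n; simp only [List.foldl_cons, ih, List.length_cons]; omega

end

section

variable {α β γ δ σ : Type} [Enc α] [Enc β] [Enc γ] [Enc δ] [Enc σ]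

@[fun_prop]
theorem PolyTime.drop {n : α → ℕ} {l : α → List β} (hn : PolyTime n) (hl : PolyTime l) :
    PolyTime fun x => (l x).drop (n x) := by
  have h := PolyTime.foldl_of_add (init := fun x => (n x, ([] : List β))) (l := l)
    (step := fun _ s b => if s.1 = 0 then (0, b :: s.2) else (s.1 - 1, s.2))
    (by fun_prop) hl (by fun_prop) (B := fun x => esize (l x) + 1) (by fun_prop) ?_
  · refine h.snd.reverse.congr fun x => ?_
    suffices ∀ (m : List β) (k : ℕ) (acc : List β), (m.foldl (fun s b =>
        if s.1 = 0 then (0, b :: s.2) else (s.1 - 1, s.2)) (k, acc)).2.reverse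
        = acc.reverse ++ m.drop k by simpa using this (l x) (n x) []
    intro m
    induction m with
    | nil => intro k acc; simp
    | cons b m ih =>
      intro k acc
      rcases k with _ | k
      · simp [ih]
      · simp [ih]
  · rintro x ⟨k, acc⟩ b hb
    have := esize_lt_of_mem hb
    have h1 : Nat.size 0 ≤ Nat.size k := Nat.size_le_size (Nat.zero_le _)
    have h2 : Nat.size (k - 1) ≤ Nat.size k := Nat.size_le_size (Nat.sub_le _ _)
    dsimp only
    split_ifs <;> simp only [esize_pair, esize_cons, esize_nat] <;> omega

@[fun_prop]
theorem PolyTime.take {n : α → ℕ} {l : α → List β} (hn : PolyTime n) (hl : PolyTime l) :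
    PolyTime fun x => (l x).take (n x) :=
  (PolyTime.reverse (.drop (n := fun x => (l x).length - n x) (l := fun x => (l x).reverse)
    (by fun_prop) (by fun_prop))).congr fun x => by
    rw [List.reverse_drop, List.reverse_reverse, List.length_reverse]
    by_cases h : n x ≤ (l x).length
    · rw [Nat.sub_sub_self h]
    · rw [List.take_of_length_le (i := n x) (by omega), List.take_of_length_le (by omega)]

@[fun_prop]
theorem PolyTime.isPrefixOf [EncInj β] [BEq β] [LawfulBEq β] {l m : α → List β}
    (hl : PolyTime l) (hm : PolyTime m) : PolyTime fun x => (l x).isPrefixOf (m x) := by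
  classical
  refine PolyTime.congr (f := fun x => decide (l x = (m x).take (l x).length)) (by fun_prop) fun x => ?_
  rw [Bool.eq_iff_iff, decide_eq_true_iff, List.isPrefixOf_iff_prefix, List.prefix_iff_eq_take]

@[fun_prop]
theorem PolyTime.zip {l : α → List β} {m : α → List γ} (hl : PolyTime l) (hm : PolyTime m) :
    PolyTime fun x => (l x).zip (m x) := by
  have h := PolyTime.foldl_of_add (init := fun x => (m x, ([] : List (β × γ)))) (l := l)
    (step := fun _ s b => s.1.uncons.elim s fun c => (c.2, (b, c.1) :: s.2))
    (by fun_prop) hl (by fun_prop) (B := fun x => esize (l x) + 1) (by fun_prop) ?_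
  · refine h.snd.reverse.congr fun x => ?_
    suffices ∀ (l : List β) (m : List γ) (acc : List (β × γ)), (l.foldl (fun s b =>
        s.1.uncons.elim s fun c => (c.2, (b, c.1) :: s.2)) (m, acc)).2.reverse
        = acc.reverse ++ l.zip m by simpa using this (l x) (m x) []
    intro l
    induction l with
    | nil => intro m acc; simp
    | cons b l ih =>
      intro m acc
      cases m with
      | nil =>
        have := ih [] acc
        simp only [List.zip_nil_right] at this
        simpa [List.uncons] using this
      | cons c m => exact (ih m ((b, c) :: acc)).trans (by simp)
  · rintro x ⟨m, acc⟩ b hb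
    have := esize_lt_of_mem hb
    cases m with
    | nil => exact Nat.le_add_right _ _
    | cons c m =>
      simp only [List.uncons, Option.elim, esize_pair, esize_cons]
      omega

@[fun_prop]
theorem PolyTime.xorB {l m : α → Bits} (hl : PolyTime l) (hm : PolyTime m) :
    PolyTime fun x => xorB (l x) (m x) :=
  (PolyTime.map (PolyTime.zip hl hm) (f := fun _ p => !(p.1 == p.2)) (by fun_prop)).congr fun x => by
    rw [_root_.xorB, ← List.map_uncurry_zip_eq_zipWith]
    refine List.map_congr_left fun p _ => ?_
    rcases p with ⟨_ | _, _ | _⟩ <;> rfl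

@[fun_prop]
theorem PolyTime.erase [EncInj β] [BEq β] [LawfulBEq β] {l : α → List β} {a : α → β}
    (hl : PolyTime l) (ha : PolyTime a) : PolyTime fun x => (l x).erase (a x) := by
  have h := PolyTime.foldl_of_add (init := fun x => (false, ([] : List β))) (l := l)
    (step := fun x s b => if s.1 then (true, b :: s.2) else
      if b == a x then (true, s.2) else (false, b :: s.2))
    (by fun_prop) hl (by fun_prop) (B := fun x => esize (l x) + 2) (by fun_prop) ?_
  · refine h.snd.reverse.congr fun x => ?_
    have key : ∀ (m : List β) (acc : List β), (m.foldl (fun s b => if s.1 then (true, b :: s.2) else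
        if b == a x then (true, s.2) else (false, b :: s.2)) (true, acc)).2.reverse
        = acc.reverse ++ m := by
      intro m
      induction m with
      | nil => intro acc; simp
      | cons b m ih =>
        intro acc
        rw [List.foldl_cons, if_pos rfl, ih]
        simp
    suffices ∀ (m : List β) (acc : List β), (m.foldl (fun s b => if s.1 then (true, b :: s.2) else
        if b == a x then (true, s.2) else (false, b :: s.2)) (false, acc)).2.reverse
        = acc.reverse ++ m.erase (a x) by simpa using this (l x) []
    intro m
    induction m with
    | nil => intro acc; simp
    | cons b m ih =>
      intro acc
      rw [List.foldl_cons, if_neg (by simp), List.erase_cons]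
      by_cases hb : (b == a x) = true
      · rw [if_pos hb, if_pos hb, key]
      · rw [if_neg hb, if_neg hb, ih]
        simp
  · rintro x ⟨k, acc⟩ b hb
    have := esize_lt_of_mem hb
    have := esize_bool true
    have := esize_bool false
    have := esize_pos k
    dsimp only
    split_ifs <;> simp only [esize_pair, esize_cons] <;> omega

@[fun_prop]
theorem PolyTime.idxOf [EncInj β] [BEq β] [LawfulBEq β] {l : α → List β} {a : α → β}
    (ha : PolyTime a) (hl : PolyTime l) : PolyTime fun x => (l x).idxOf (a x) := by
  have h := PolyTime.foldl_of_add (init := fun x => (false, 0)) (l := l)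
    (step := fun x s b => if s.1 then s else if b == a x then (true, s.2) else (false, s.2 + 1))
    (by fun_prop) hl (by fun_prop) (B := fun x => 4) (by fun_prop) ?_
  · refine h.snd.congr fun x => ?_
    have key : ∀ (m : List β) (k : ℕ), (m.foldl (fun s b => if s.1 then s else
        if b == a x then (true, s.2) else (false, s.2 + 1)) (true, k)).2 = k := by
      intro m
      induction m with
      | nil => intro k; rfl
      | cons b m ih =>
        intro k
        rw [List.foldl_cons, if_pos rfl, ih]
    suffices ∀ (m : List β) (k : ℕ), (m.foldl (fun s b => if s.1 then s else
        if b == a x then (true, s.2) else (false, s.2 + 1)) (false, k)).2 = k + m.idxOf (a x) by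
      simpa using this (l x) 0
    intro m
    induction m with
    | nil => intro k; simp
    | cons b m ih =>
      intro k
      rw [List.foldl_cons, if_neg (by simp), List.idxOf_cons]
      by_cases hb : (b == a x) = true
      · rw [if_pos hb, key, hb]
        rfl
      · rw [if_neg hb, ih, Bool.eq_false_of_not_eq_true hb]
        simp only [cond_false]
        omega
  · rintro x ⟨c, k⟩ b hb
    have := esize_bool true
    have := esize_bool false
    have := esize_pos c
    have h1 := Nat.size_add_le k 1
    simp only [Nat.size_one] at h1
    dsimp only
    split_ifs <;> simp only [esize_pair, esize_nat] <;> omega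

-- The length of a list serves as the upper end: numbers are encoded in binary, so the range below a
-- number that is given as such may be exponentially long.
@[fun_prop]
theorem PolyTime.range {l : α → List β} (hl : PolyTime l) :
    PolyTime fun x => List.range (l x).length := by
  have key : ∀ m : List β, m.foldl (fun (s : ℕ × List ℕ) _ => (s.1 + 1, s.1 :: s.2)) (0, []) =
      (m.length, (List.range m.length).reverse) := by
    intro m
    induction m using List.reverseRecOn with
    | nil => rfl
    | append_singleton m b ih =>
      rw [List.foldl_append, ih, List.length_append, List.length_singleton, List.range_succ]
      simp
  have h := PolyTime.foldl (init := fun _ => (0, ([] : List ℕ))) (l := l)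
    (step := fun _ s _ => (s.1 + 1, s.1 :: s.2)) (by fun_prop) hl (by fun_prop)
    (B := fun x => esize (l x) + esize (l x) * (esize (l x) + 1) + 2) (by fun_prop) ?_
  · refine h.snd.reverse.congr fun x => ?_
    rw [key, List.reverse_reverse]
  · intro x m hm
    have h1 := hm.length_le
    have h2 := length_le_esize (l x)
    have hsize : ∀ n, Nat.size n ≤ n := fun n => Nat.size_le.2 Nat.lt_two_pow_self
    have h3 := hsize m.length
    have h4 : esize (List.range m.length).reverse ≤
        (List.range m.length).reverse.length * (esize (l x) + 1) + 1 :=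
      esize_le_of_forall fun n hn => by
        rw [List.mem_reverse, List.mem_range] at hn
        have := hsize n
        rw [esize_nat]
        omega
    rw [List.length_reverse, List.length_range] at h4
    have h5 : m.length * (esize (l x) + 1) ≤ esize (l x) * (esize (l x) + 1) := by
      gcongr
      omega
    rw [key, esize_pair, esize_nat]
    omega

/-- Separating failure from the values reduces `mapM` to `all` and `filterMap`. -/
theorem List.mapM_option_eq {β γ : Type} {f : β → Option γ} (l : List β) :
    l.mapM f = if l.all fun b => (f b).isSome then some (l.filterMap f) else none := by
  induction l with
  | nil => rfl
  | cons b l ih =>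
    rw [List.mapM_cons, ih]
    cases h : f b with
    | none => simp [h]
    | some c =>
      simp only [List.all_cons, h, Option.isSome_some, Bool.true_and, List.filterMap_cons]
      split_ifs <;> rfl

@[fun_prop]
theorem PolyTime.mapM {l : α → List β} {f : α → β → Option γ} (hl : PolyTime l)
    (hf : PolyTime fun p : α × β => f p.1 p.2) : PolyTime fun x => (l x).mapM (f x) :=
  (PolyTime.bool_ite (PolyTime.all hl (f := fun x b => (f x b).isSome) (by fun_prop))
    (PolyTime.some (PolyTime.filterMap hl hf)) (.const none)).congr fun x => by
    rw [List.mapM_option_eq]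

@[fun_prop]
theorem PolyTime.put [EncInj β] [DecidableEq β] {m : α → List (β × γ)} {k : α → β} {v : α → γ}
    (hm : PolyTime m) (hk : PolyTime k) (hv : PolyTime v) :
    PolyTime fun x => put (m x) (k x) (v x) := by
  unfold _root_.put
  refine PolyTime.bool_ite (by fun_prop) (PolyTime.map hm (f := fun x e => if e.1 = k x then (k x, v x) else e)
    (.ite (by fun_prop) (by fun_prop) (by fun_prop))) (by fun_prop)

@[fun_prop]
theorem PolyTime.del [EncInj β] [DecidableEq β] {m : α → List (β × γ)} {k : α → β}
    (hm : PolyTime m) (hk : PolyTime k) : PolyTime fun x => del (m x) (k x) := by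
  unfold _root_.del
  fun_prop

/-! ### Binary digits and modular powers -/

@[fun_prop]
theorem PolyTime.testBits {l : α → List β} {c : α → ℕ} (hl : PolyTime l) (hc : PolyTime c) :
    PolyTime fun x => (List.range (l x).length).map fun i => (c x).testBit i := by
  have h := PolyTime.foldl_of_add (init := fun x => (c x, ([] : List Bool))) (l := l)
    (step := fun _ s _ => (s.1 / 2, (s.1 % 2 == 1) :: s.2))
    (by fun_prop) hl (by fun_prop) (B := fun x => 3) (by fun_prop) ?_
  · refine h.snd.reverse.congr fun x => ?_
    suffices ∀ (m : List β) (c : ℕ) (acc : List Bool), (m.foldl (fun s _ =>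
        (s.1 / 2, (s.1 % 2 == 1) :: s.2)) (c, acc)).2.reverse
        = acc.reverse ++ (List.range m.length).map fun i => c.testBit i by
      simpa using this (l x) (c x) []
    intro m
    induction m with
    | nil => intro c acc; simp
    | cons b m ih =>
      intro c acc
      rw [List.foldl_cons, ih, List.length_cons, List.range_succ_eq_map]
      simp [Nat.testBit_succ, Nat.testBit_zero, Function.comp_def]
      rw [Bool.eq_iff_iff]
      simp
  · rintro x ⟨k, acc⟩ b _
    have := esize_bool (k % 2 == 1)
    have h1 : Nat.size (k / 2) ≤ Nat.size k := Nat.size_le_size (Nat.div_le_self _ _)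
    simp only [esize_pair, esize_nat, esize_cons]
    omega

/-- Value of a list of binary digits, the most significant first, appended to those of `n`. -/
def digitsValue (n : ℕ) (l : List Bool) : ℕ := l.foldl (fun v b => 2 * v + b.toNat) n

/-- The number is halved until it vanishes, which takes `n.size` steps, and each remainder is put in
front of the list. The invariant `h3` says that the quotient followed by the digits found so far
always has the value `n`. -/
theorem exists_binaryDigits :
    ∃ f : ℕ → List Bool, PolyTime f ∧ ∀ n, digitsValue 0 (f n) = n := by
  let b : ℕ × List Bool → ℕ × List Bool := fun s => (s.1 / 2, (s.1 % 2 == 1) :: s.2)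
  have hb : PolyTime b := by fun_prop
  have h1 : ∀ n k, (b^[k] (n, [])).1 = n / 2 ^ k := by
    intro n k
    induction k with
    | zero => simp
    | succ k ih => rw [Function.iterate_succ_apply', pow_succ, ← Nat.div_div_eq_div_mul, ← ih]
  have h2 : ∀ n k, esize (b^[k] (n, [])).2 ≤ 3 * k + 1 := by
    intro n k
    induction k with
    | zero => simp [esize_nil]
    | succ k ih =>
      rw [Function.iterate_succ_apply', esize_cons]
      have := esize_bool ((b^[k] (n, [])).1 % 2 == 1)
      omega
  have h3 : ∀ n k, digitsValue (b^[k] (n, [])).1 (b^[k] (n, [])).2 = n := by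
    intro n k
    induction k with
    | zero => simp [digitsValue]
    | succ k ih =>
      rw [Function.iterate_succ_apply']
      refine Eq.trans ?_ ih
      simp only [b, digitsValue, List.foldl_cons]
      congr 1
      rcases Nat.mod_two_eq_zero_or_one (b^[k] (n, [])).1 with h | h <;> simp only [b] at h <;>
        simp [h] <;> omega
  have hN : ∀ n, (b^[n.size] (n, [])).1 = 0 := fun n => by
    rw [h1, Nat.div_eq_of_lt (Nat.lt_size_self n)]
  refine ⟨fun n => (b^[n.size] (n, [])).2, ?_, fun n => ?_⟩
  · refine (PolyTime.iterate (init := fun n : ℕ => (n, ([] : List Bool))) (c := fun s => !(s.1 == 0))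
      (b := b) (N := fun n => n.size) (B := fun n => esize n + 3 * esize n + 2)
      (by fun_prop) (by fun_prop) hb (PolyBdd.id_nat.mono fun n => by simp [esize_nat])
      (by fun_prop) ?_ ?_ ?_).snd
    · intro n k hk
      have := Nat.lt_size.1 hk
      have : n / 2 ^ k ≠ 0 := (Nat.div_pos this (by positivity)).ne'
      simp only [h1]
      simpa using this
    · intro n
      simp only [hN]
      rfl
    · intro n k hk
      rw [show b^[k] (n, []) = ((b^[k] (n, [])).1, (b^[k] (n, [])).2) from rfl, esize_pair]
      have h := h2 n k
      have h' : Nat.size (n / 2 ^ k) ≤ n.size := Nat.size_le_size (Nat.div_le_self _ _)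
      rw [h1, esize_nat, esize_nat]
      omega
  · have := h3 n n.size
    rwa [hN] at this

/-- Power modulo `n`, and `0` if `n = 0`. -/
def powMod (g e n : ℕ) : ℕ := if n = 0 then 0 else g ^ e % n

theorem size_powMod_le (g e n : ℕ) : esize (powMod g e n) ≤ esize n := by
  unfold powMod
  split_ifs with h
  · rw [h]
  · rw [esize_nat, esize_nat]
    have := Nat.size_le_size (Nat.mod_lt (g ^ e) (Nat.pos_of_ne_zero h)).le
    omega

-- Square and multiply, from the most significant digit. All intermediate values are reduced modulo
-- `n`, so they stay as small as `n` although the unreduced power is exponentially long.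
@[fun_prop]
theorem PolyTime.powMod {g e n : α → ℕ} (hg : PolyTime g) (he : PolyTime e) (hn : PolyTime n) :
    PolyTime fun x => powMod (g x) (e x) (n x) := by
  obtain ⟨f, hf, hv⟩ := exists_binaryDigits
  have h := PolyTime.foldl (init := fun x => if n x = 0 then 0 else 1 % n x) (l := fun x => f (e x))
    (step := fun x s b => if n x = 0 then 0 else s * s * (if b = true then g x else 1) % n x)
    (.ite (by fun_prop) (by fun_prop) (by fun_prop)) (hf.comp he)
    (.ite (by fun_prop) (by fun_prop) (by fun_prop)) (B := fun x => esize (n x)) (by fun_prop) ?_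
  · refine h.congr fun x => ?_
    unfold _root_.powMod
    by_cases hx : n x = 0
    · simp only [hx, if_true]
      induction f (e x) with
      | nil => rfl
      | cons b l ih => simpa using ih
    · simp only [hx, if_false]
      conv_rhs => rw [← hv (e x)]
      suffices ∀ (l : List Bool) (v : ℕ), l.foldl (fun s b => s * s * (if b = true then g x else 1) % n x)
          (g x ^ v % n x) = g x ^ digitsValue v l % n x by simpa using this (f (e x)) 0
      intro l
      induction l with
      | nil => intro v; rfl
      | cons b l ih =>
        intro v
        rw [List.foldl_cons, digitsValue, List.foldl_cons]
        refine Eq.trans ?_ (ih (2 * v + b.toNat))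
        congr 1
        have : g x ^ (2 * v + b.toNat) = g x ^ v * g x ^ v * (if b = true then g x else 1) := by
          rw [pow_add, two_mul, pow_add]
          cases b <;> simp
        rw [this]
        exact Nat.ModEq.mul_right _ ((Nat.mod_modEq _ _).mul (Nat.mod_modEq _ _))
  · intro x m _
    by_cases hx : n x = 0
    · simp only [hx, if_true]
      have : ∀ m : List Bool, m.foldl (fun _ _ => 0) 0 = 0 := fun m => by
        induction m with
        | nil => rfl
        | cons b l ih => simpa using ih
      rw [this]
    · have : m.foldl (fun s b => if n x = 0 then 0 else
          s * s * (if b = true then g x else 1) % n x) (if n x = 0 then 0 else 1 % n x) < n x := by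
        have hp := Nat.pos_of_ne_zero hx
        simp only [hx, if_false]
        rcases List.eq_nil_or_concat m with rfl | ⟨m, b, rfl⟩
        · exact Nat.mod_lt _ hp
        · rw [List.concat_eq_append, List.foldl_append]
          exact Nat.mod_lt _ hp
      rw [esize_nat, esize_nat]
      have := Nat.size_le_size this.le
      omega

/-! ### Lengths -/

@[fun_prop]
theorem PolyTime.unary_length {l : α → List β} (hl : PolyTime l) :
    PolyTime fun x => unary (l x).length :=
  (PolyTime.map hl (f := fun _ _ => true) (by fun_prop)).congr fun x => by
    rw [unary, List.map_const']

theorem PolyLength.unary_length {l : ℕ → ℕ} (h : PolyLength l) {u : α → Bits} (hu : PolyTime u) :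
    PolyTime fun x => unary (l (u x).length) :=
  PolyTime.comp (g := fun u : Bits => unary (l u.length)) h hu

theorem PolyLength.length {l : ℕ → ℕ} (h : PolyLength l) {u : α → Bits} (hu : PolyTime u) :
    PolyTime fun x => l (u x).length :=
  (h.unary_length hu).length.congr fun x => by simp [unary]

theorem PolyLength.id : PolyLength fun n => n := by
  unfold PolyLength
  fun_prop

theorem PolyLength.add {l m : ℕ → ℕ} (hl : PolyLength l) (hm : PolyLength m) :
    PolyLength fun n => l n + m n :=
  (PolyTime.append hl hm).congr fun x => by simp [unary]

end

/-! ## The cuckoo filter in polynomial time -/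

theorem esize_bits (l : Bits) : esize l ≤ 3 * l.length + 1 := by
  induction l with
  | nil => simp [esize_nil]
  | cons b l ih =>
    have := esize_bool b
    rw [esize_cons, List.length_cons]
    omega

theorem xorB_length (a b : Bits) : (xorB a b).length = min a.length b.length := by
  simp [xorB]

/-- Bounds for the lengths of the bucket index and of the stored part of the fingerprint. -/
def SlotBdd (A S : ℕ) (e : Bits × Bits) : Prop := e.1.length ≤ A ∧ e.2.length ≤ S

section Bounds

variable {H1 : Bits → Bits} {bs mk A S : ℕ}

theorem SlotBdd.esize_le {e : Bits × Bits} (h : SlotBdd A S e) : esize e ≤ 3 * A + 3 * S + 3 := by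
  have h1 := esize_bits e.1
  have h2 := esize_bits e.2
  obtain ⟨h3, h4⟩ := h
  rw [show e = (e.1, e.2) from rfl, esize_pair]
  omega

theorem altBucket_length_le (hH : ∀ x, (H1 x).length ≤ A) (d m : Bits) :
    (altBucket H1 d m).length ≤ A := by
  rw [altBucket, xorB_length]
  exact (min_le_left _ _).trans (hH d)

/-- An eviction removes one slot and adds one. The fingerprints come from the input, and a new
bucket index is an xor, truncated to the shorter string, with a value of `H1`. -/
theorem kick_bdd (hH : ∀ x, (H1 x).length ≤ A) (idf : Bits) (n : ℕ) (sf : SubFilter) (m s : Bits)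
    (hsf : ∀ e ∈ sf, SlotBdd A S e) (hms : SlotBdd A S (m, s)) :
    (∀ e ∈ (kick H1 bs idf n sf m s).1, SlotBdd A S e) ∧
    (kick H1 bs idf n sf m s).1.length ≤ sf.length + 1 ∧
    ∀ e, (kick H1 bs idf n sf m s).2 = some e → SlotBdd A S e := by
  induction n generalizing sf m s with
  | zero =>
    refine ⟨hsf, Nat.le_succ _, fun e he => ?_⟩
    rw [← Option.some.inj he]
    exact hms
  | succ n ih =>
    rw [kick]
    split_ifs with hl
    · refine ⟨?_, by simp, by simp⟩
      intro e he
      rcases List.mem_append.1 he with he | he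
      · exact hsf e he
      · rw [List.mem_singleton.1 he]
        exact hms
    · split
      · refine ⟨hsf, Nat.le_succ _, fun e he => ?_⟩
        rw [← Option.some.inj he]
        exact hms
      · rename_i e he
        have hmem := List.mem_of_find?_eq_some he
        obtain ⟨h1, h2, h3⟩ := ih (sf.erase e ++ [(m, s)]) (altBucket H1 (idf ++ e.2) m) e.2 (by
          intro e' he'
          rcases List.mem_append.1 he' with he' | he'
          · exact hsf e' (List.mem_of_mem_erase he')
          · rw [List.mem_singleton.1 he']
            exact hms) ⟨altBucket_length_le hH _ _, (hsf e hmem).2⟩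
        refine ⟨h1, h2.trans ?_, h3⟩
        have := List.length_erase_of_mem hmem
        have := List.length_pos_of_mem hmem
        rw [List.length_append, List.length_singleton]
        omega

theorem insertSF_bdd (hH : ∀ x, (H1 x).length ≤ A) (idf : Bits) (sf : SubFilter) (s m : Bits)
    (hsf : ∀ e ∈ sf, SlotBdd A S e) (hms : SlotBdd A S (m, s)) :
    (∀ e ∈ (insertSF H1 bs mk idf sf s m).1, SlotBdd A S e) ∧
    (insertSF H1 bs mk idf sf s m).1.length ≤ sf.length + 1 ∧
    ∀ e, (insertSF H1 bs mk idf sf s m).2 = some e → SlotBdd A S e := by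
  have key : ∀ m', SlotBdd A S (m', s) → ∀ e ∈ sf ++ [(m', s)], SlotBdd A S e := by
    intro m' hm' e he
    rcases List.mem_append.1 he with he | he
    · exact hsf e he
    · rw [List.mem_singleton.1 he]
      exact hm'
  unfold insertSF
  dsimp only
  split_ifs
  · exact ⟨key m hms, by simp, by simp⟩
  · exact ⟨key _ ⟨altBucket_length_le hH _ _, hms.2⟩, by simp, by simp⟩
  · exact kick_bdd hH idf mk sf m s hsf hms

theorem mem_halfSF {c : Bool} {sf : SubFilter} {e : Bits × Bits} :
    e ∈ halfSF c sf ↔ (e.1, c :: e.2) ∈ sf := by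
  unfold halfSF
  rw [List.mem_filterMap]
  constructor
  · rintro ⟨⟨m, s⟩, h1, h2⟩
    cases s with
    | nil => simp at h2
    | cons c' s =>
      simp only [Option.ite_none_right_eq_some, Option.some.injEq] at h2
      obtain ⟨rfl, rfl⟩ := h2
      exact h1
  · intro h
    exact ⟨_, h, by simp⟩

theorem halfSF_bdd (c : Bool) (sf : SubFilter) (hsf : ∀ e ∈ sf, SlotBdd A S e) :
    (∀ e ∈ halfSF c sf, SlotBdd A S e) ∧ (halfSF c sf).length ≤ sf.length := by
  refine ⟨fun e he => ?_, List.length_filterMap_le _ _⟩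
  have := hsf _ (mem_halfSF.1 he)
  exact ⟨this.1, (Nat.le_succ _).trans this.2⟩

/-- Bounds for a sub-filter and its identifier. -/
def FilterBdd (A S I L : ℕ) (x : Bits × SubFilter) : Prop :=
  x.1.length ≤ I ∧ x.2.length ≤ L ∧ ∀ e ∈ x.2, SlotBdd A S e

theorem FilterBdd.mono {I I' L L' : ℕ} {x : Bits × SubFilter} (h : FilterBdd A S I L x)
    (hI : I ≤ I') (hL : L ≤ L') : FilterBdd A S I' L' x :=
  ⟨h.1.trans hI, h.2.1.trans hL, h.2.2⟩

theorem FilterBdd.esize_le {I L : ℕ} {x : Bits × SubFilter} (h : FilterBdd A S I L x) :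
    esize x ≤ 3 * I + L * (3 * A + 3 * S + 4) + 3 := by
  have h1 := esize_bits x.1
  obtain ⟨h2, h3, h4⟩ := h
  have h5 : esize x.2 ≤ x.2.length * (3 * A + 3 * S + 4) + 1 :=
    esize_le_of_forall fun e he => (h4 e he).esize_le
  have h6 := Nat.mul_le_mul_right (3 * A + 3 * S + 4) h3
  rw [show x = (x.1, x.2) from rfl, esize_pair]
  omega

/-- One step of `splitSF`: the finished sub-filters, and the sub-filter and left-over fingerprint
that have to be split next. -/
def splitStep (H1 : Bits → Bits) (bs mk : ℕ) (cur : Bits × SubFilter × Bits × Bits) :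
    Option (List (Bits × SubFilter) × Option (Bits × SubFilter × Bits × Bits)) :=
  cur.2.2.2.uncons.elim none fun c => some
    ((insertSF H1 bs mk (cur.1 ++ [c.1]) (halfSF c.1 cur.2.1) c.2 cur.2.2.1).2.elim
      ([(cur.1 ++ [!c.1], halfSF (!c.1) cur.2.1), (cur.1 ++ [c.1],
        (insertSF H1 bs mk (cur.1 ++ [c.1]) (halfSF c.1 cur.2.1) c.2 cur.2.2.1).1)], none)
      fun left => ([(cur.1 ++ [!c.1], halfSF (!c.1) cur.2.1)], some (cur.1 ++ [c.1],
        (insertSF H1 bs mk (cur.1 ++ [c.1]) (halfSF c.1 cur.2.1) c.2 cur.2.2.1).1, left)))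

/-- State of the iteration that computes `splitSF`. -/
abbrev SplitState := Option (List (Bits × SubFilter) × Option (Bits × SubFilter × Bits × Bits))

def splitIter (H1 : Bits → Bits) (bs mk : ℕ) (st : SplitState) : SplitState :=
  st.bind fun p => p.2.elim (some p) fun cur =>
    (splitStep H1 bs mk cur).map fun q => (p.1 ++ q.1, q.2)

/-- The recursion on the number of bits becomes a fold over any list of that length. In the state,
the outer `none` is failure and the inner `none` means that nothing remains to be split; both are
absorbing. A fingerprint left over at the end counts as failure, as does the recursion at `0`. -/
theorem splitSF_eq_foldl {β : Type} (l : List β) (acc : List (Bits × SubFilter)) (idf : Bits)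
    (sf : SubFilter) (left : Bits × Bits) :
    ((l.foldl (fun st _ => splitIter H1 bs mk st) (some (acc, some (idf, sf, left)))).bind fun p =>
      if p.2.isNone = true then some p.1 else none) =
    (splitSF H1 bs mk l.length idf sf left).map fun r => acc ++ r := by
  have hnone : ∀ l : List β, l.foldl (fun st _ => splitIter H1 bs mk st) none = none := by
    intro l
    induction l with
    | nil => rfl
    | cons b l ih => exact ih
  have hdone : ∀ (l : List β) acc, l.foldl (fun st _ => splitIter H1 bs mk st) (some (acc, none)) =
      some (acc, none) := by
    intro l acc
    induction l with
    | nil => rfl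
    | cons b l ih => exact ih
  induction l generalizing acc idf sf left with
  | nil => rfl
  | cons b l ih =>
    obtain ⟨m, s⟩ := left
    cases s with
    | nil =>
      rw [List.foldl_cons]
      change (l.foldl _ none).bind _ = _
      rw [hnone]
      rfl
    | cons c s =>
      rw [List.foldl_cons]
      simp only [splitIter, splitStep, List.uncons, Option.bind_some, Option.elim_some,
        Option.map_some, List.length_cons, splitSF]
      rcases insertSF H1 bs mk (idf ++ [c]) (halfSF c sf) s m with ⟨sf', _ | left⟩
      · simp only [Option.elim_none, Option.map_some]
        have := hdone l (acc ++ [(idf ++ [!c], halfSF (!c) sf), (idf ++ [c], sf')])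
        simp only [splitIter, splitStep, List.uncons] at this
        rw [this]
        rfl
      · simp only [Option.elim_some]
        have := ih (acc ++ [(idf ++ [!c], halfSF (!c) sf)]) (idf ++ [c]) sf' left
        simp only [splitIter, splitStep, List.uncons] at this
        rw [this]
        rw [Option.map_map]
        congr 1
        funext r
        simp

/-- Invariant of the iteration that computes `splitSF`. -/
def SplitBdd (A S I L k : ℕ) (st : SplitState) : Prop :=
  -- Every step finishes one sub-filter and the last one finishes two, whence the additional 1 if
  -- nothing is pending.
  ∀ p, st = some p → p.1.length + 1 ≤ k + 1 + (if p.2.isNone then 1 else 0) ∧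
    (∀ x ∈ p.1, FilterBdd A S (I + k) (L + k) x) ∧
    ∀ c, p.2 = some c → FilterBdd A S (I + k) (L + k) (c.1, c.2.1) ∧ SlotBdd A S c.2.2

theorem SplitBdd.iter (hH : ∀ x, (H1 x).length ≤ A) {I L k : ℕ} {st : SplitState}
    (h : SplitBdd A S I L k st) : SplitBdd A S I L (k + 1) (splitIter H1 bs mk st) := by
  rintro p hp
  rcases st with _ | ⟨acc, _ | ⟨idf, sf, m, s⟩⟩
  · cases hp
  · obtain ⟨h1, h2, h3⟩ := h _ rfl
    cases hp
    refine ⟨by simp at h1 ⊢; omega, fun x hx => (h2 x hx).mono (by omega) (by omega), by simp⟩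
  · obtain ⟨h1, h2, h3⟩ := h _ rfl
    obtain ⟨⟨h4, h5, h6⟩, h7⟩ := h3 _ rfl
    cases s with
    | nil => cases hp
    | cons c s =>
      have hms : SlotBdd A S (m, s) := ⟨h7.1, (Nat.le_succ _).trans h7.2⟩
      obtain ⟨g1, g2⟩ := halfSF_bdd (!c) sf h6
      obtain ⟨g3, g4⟩ := halfSF_bdd c sf h6
      obtain ⟨e1, e2, e3⟩ := insertSF_bdd (bs := bs) (mk := mk) hH (idf ++ [c]) (halfSF c sf) s m g3 hms
      simp only [splitIter, splitStep, List.uncons, Option.bind_some, Option.elim_some,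
        Option.map_some] at hp
      dsimp only at h4 h5 h1
      have other : FilterBdd A S (I + (k + 1)) (L + (k + 1)) (idf ++ [!c], halfSF (!c) sf) :=
        ⟨by simp; omega, by dsimp only; omega, g1⟩
      revert hp e1 e2 e3
      rcases insertSF H1 bs mk (idf ++ [c]) (halfSF c sf) s m with ⟨sf', _ | left⟩ <;>
        intro hp e1 e2 e3
      · have this : FilterBdd A S (I + (k + 1)) (L + (k + 1)) (idf ++ [c], sf') :=
          ⟨by simp; omega, by dsimp only at e2 ⊢; omega, e1⟩
        cases hp
        refine ⟨?_, ?_, by simp⟩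
        · simp at h1 ⊢
          omega
        · intro x hx
          simp only [List.mem_append, Option.elim_none, List.mem_cons, List.not_mem_nil, or_false] at hx
          rcases hx with hx | rfl | rfl
          · exact (h2 x hx).mono (by omega) (by omega)
          · exact other
          · exact this
      · have this : FilterBdd A S (I + (k + 1)) (L + (k + 1)) (idf ++ [c], sf') :=
          ⟨by simp; omega, by dsimp only at e2 ⊢; omega, e1⟩
        cases hp
        refine ⟨?_, ?_, ?_⟩
        · simp at h1 ⊢
          omega
        · intro x hx
          simp only [List.mem_append, Option.elim_some, List.mem_cons, List.not_mem_nil, or_false] at hx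
          rcases hx with hx | rfl
          · exact (h2 x hx).mono (by omega) (by omega)
          · exact other
        · intro c' hc'
          cases hc'
          exact ⟨this, e3 _ rfl⟩

theorem SplitBdd.foldl (hH : ∀ x, (H1 x).length ≤ A) {β : Type} (l : List β) {I L k : ℕ}
    {st : SplitState} (h : SplitBdd A S I L k st) :
    SplitBdd A S I L (k + l.length) (l.foldl (fun st _ => splitIter H1 bs mk st) st) := by
  induction l generalizing k st with
  | nil => exact h
  | cons b l ih =>
    rw [List.length_cons, ← add_assoc, add_right_comm]
    exact ih (h.iter hH)

theorem SplitBdd.init {I L : ℕ} {c : Bits × SubFilter × Bits × Bits}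
    (h1 : FilterBdd A S I L (c.1, c.2.1)) (h2 : SlotBdd A S c.2.2) :
    SplitBdd A S I L 0 (some ([], some c)) := by
  intro p hp
  cases hp
  refine ⟨by simp, by simp, fun c' hc' => ?_⟩
  cases hc'
  exact ⟨h1, h2⟩

theorem splitSF_bdd (hH : ∀ x, (H1 x).length ≤ A) {I L n : ℕ} {idf : Bits} {sf : SubFilter}
    {left : Bits × Bits} {r : List (Bits × SubFilter)}
    (h1 : FilterBdd A S I L (idf, sf)) (h2 : SlotBdd A S left)
    (hr : splitSF H1 bs mk n idf sf left = some r) :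
    r.length ≤ n + 1 ∧ ∀ x ∈ r, FilterBdd A S (I + n) (L + n) x := by
  have h3 := SplitBdd.foldl (bs := bs) (mk := mk) hH (List.replicate n ())
    (SplitBdd.init (c := (idf, sf, left)) h1 h2)
  have h4 := splitSF_eq_foldl (H1 := H1) (bs := bs) (mk := mk) (List.replicate n ()) [] idf sf left
  rw [List.length_replicate, hr] at h4
  rw [List.length_replicate] at h3
  obtain ⟨p, hp, h5⟩ := Option.bind_eq_some_iff.1 h4
  obtain ⟨h6, h7, _⟩ := h3 p hp
  split_ifs at h5 with hn
  obtain rfl : p.1 = r := by simpa using h5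
  rw [if_pos hn] at h6
  refine ⟨by omega, fun x hx => ?_⟩
  simpa using h7 x hx

theorem SplitBdd.esize_le {I L k : ℕ} {st : SplitState} (h : SplitBdd A S I L k st) :
    esize st ≤ (k + 4) * (3 * (I + k) + (L + k) * (3 * A + 3 * S + 4) + 3 * A + 3 * S + 16) := by
  rcases st with _ | ⟨acc, o⟩
  · rw [esize_none]
    exact Nat.succ_le_of_lt (by positivity)
  · obtain ⟨h1, h2, h3⟩ := h _ rfl
    dsimp only at h1 h2 h3
    have e1 := esize_le_of_forall fun x hx => (h2 x hx).esize_le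
    set M := 3 * (I + k) + (L + k) * (3 * A + 3 * S + 4) with hM
    have hl : acc.length ≤ k + 1 := by split_ifs at h1 <;> omega
    have e2 := Nat.mul_le_mul_right (M + 3 + 1) hl
    have e3 : esize o ≤ M + 3 + (3 * A + 3 * S + 3) + 3 := by
      rcases o with _ | ⟨idf, sf, left⟩
      · rw [esize_none]; omega
      · obtain ⟨h4, h5⟩ := h3 _ rfl
        have h4 := h4.esize_le
        have h5 := h5.esize_le
        simp only [esize_some, esize_pair] at h4 h5 ⊢
        omega
    rw [esize_some, esize_pair]
    nlinarith

end Bounds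

namespace Primitives

variable (P : Primitives) {α β γ : Type} [Enc α] [Enc β] [Enc γ]

@[fun_prop]
theorem polyTime_H1 {u f : α → Bits} (hu : PolyTime u) (hf : PolyTime f) :
    PolyTime fun x => P.H1 (u x).length (f x) :=
  PolyTime.comp P.H1_poly (hu.prodMk hf)

@[fun_prop]
theorem polyTime_H2 {u f : α → Bits} (hu : PolyTime u) (hf : PolyTime f) :
    PolyTime fun x => P.H2 (u x).length (f x) :=
  PolyTime.comp P.H2_poly (hu.prodMk hf)

@[fun_prop]
theorem _root_.HashFamily.polyTime_hash {X : Type} [Enc X] (H : HashFamily X) {u s : α → Bits}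
    {f : α → X} (hu : PolyTime u) (hs : PolyTime s) (hf : PolyTime f) :
    PolyTime fun x => H.hash (u x).length (s x) (f x) :=
  PolyTime.comp H.hash_poly (hu.prodMk (hs.prodMk hf))

@[fun_prop]
theorem _root_.MultisetHash.polyTime_hash (M : MultisetHash) {u s : α → Bits}
    {f : α → List Bits} (hu : PolyTime u) (hs : PolyTime s) (hf : PolyTime f) :
    PolyTime fun x => M.hash (u x).length (s x) (f x : Multiset Bits) :=
  PolyTime.comp M.hash_poly (hu.prodMk (hs.prodMk hf))

@[fun_prop]
theorem _root_.KeyedFun.polyTime_eval (F : KeyedFun) {k f : α → Bits} (hk : PolyTime k)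
    (hf : PolyTime f) : PolyTime fun x => F.eval (k x) (f x) :=
  PolyTime.comp F.eval_poly (hk.prodMk hf)

@[fun_prop]
theorem _root_.RSAAccumulator.polyTime_rep (K : RSAAccumulator) {u s f : α → Bits} (hu : PolyTime u)
    (hs : PolyTime s) (hf : PolyTime f) : PolyTime fun x => K.rep (u x).length (s x) (f x) :=
  PolyTime.comp K.rep_poly (hu.prodMk (hs.prodMk hf))

@[fun_prop]
theorem _root_.RSAAccumulator.polyTime_setup (K : RSAAccumulator) {u s : α → Bits} (hu : PolyTime u)
    (hs : PolyTime s) : PolyTime fun x => K.setup (u x).length (s x) :=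
  PolyTime.comp K.setup_poly (hu.prodMk hs)

@[fun_prop]
theorem polyTime_altBucket {u d m : α → Bits} (hu : PolyTime u) (hd : PolyTime d) (hm : PolyTime m) :
    PolyTime fun x => altBucket (P.H1 (u x).length) (d x) (m x) := by
  unfold altBucket
  fun_prop

@[fun_prop]
theorem _root_.PolyTime.load {sf : α → SubFilter} {m : α → Bits} (hsf : PolyTime sf)
    (hm : PolyTime m) : PolyTime fun x => load (sf x) (m x) := by
  unfold _root_.load
  fun_prop

@[fun_prop]
theorem _root_.PolyTime.halfSF {c : α → Bool} {sf : α → SubFilter} (hc : PolyTime c)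
    (hsf : PolyTime sf) : PolyTime fun x => halfSF (c x) (sf x) := by
  refine PolyTime.congr (f := fun x => (sf x).filterMap fun e => e.2.uncons.elim none
    fun q => if q.1 = c x then some (e.1, q.2) else none) ?_ fun x => ?_
  · refine PolyTime.filterMap hsf (PolyTime.option_elim (by fun_prop) (by fun_prop)
      (PolyTime.ite (by fun_prop) (by fun_prop) (by fun_prop)))
  · unfold _root_.halfSF
    congr 1
    funext e
    rcases e with ⟨m, _ | _⟩ <;> rfl

-- `n` is not part of the input: there is a separate program for every number of kicks. This
-- suffices since `maxKicks` is a constant of the scheme.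
@[fun_prop]
theorem polyTime_kick (n : ℕ) {u idf m s : α → Bits} {sf : α → SubFilter} (hu : PolyTime u)
    (hidf : PolyTime idf) (hsf : PolyTime sf) (hm : PolyTime m) (hs : PolyTime s) :
    PolyTime fun x => kick (P.H1 (u x).length) P.bucketSize (idf x) n (sf x) (m x) (s x) := by
  have key : PolyTime fun x : Bits × Bits × SubFilter × Bits × Bits =>
      kick (P.H1 x.1.length) P.bucketSize x.2.1 n x.2.2.1 x.2.2.2.1 x.2.2.2.2 := by
    clear hu hidf hsf hm hs
    induction n with
    | zero =>
      simp only [kick]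
      fun_prop
    | succ n ih =>
      refine PolyTime.congr (f := fun x : Bits × Bits × SubFilter × Bits × Bits =>
        if load x.2.2.1 x.2.2.2.1 < P.bucketSize then (x.2.2.1 ++ [(x.2.2.2.1, x.2.2.2.2)], none)
        else (x.2.2.1.find? fun e => e.1 == x.2.2.2.1).elim (x.2.2.1, some (x.2.2.2.1, x.2.2.2.2))
          fun e => kick (P.H1 x.1.length) P.bucketSize x.2.1 n
            (x.2.2.1.erase e ++ [(x.2.2.2.1, x.2.2.2.2)])
            (altBucket (P.H1 x.1.length) (x.2.1 ++ e.2) x.2.2.2.1) e.2) ?_ fun x => ?_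
      · refine PolyTime.ite (by fun_prop) (by fun_prop) (PolyTime.option_elim (by fun_prop)
          (by fun_prop) ?_)
        exact ih.comp (f := fun x : (Bits × Bits × SubFilter × Bits × Bits) × Bits × Bits =>
          (x.1.1, x.1.2.1, x.1.2.2.1.erase x.2 ++ [(x.1.2.2.2.1, x.1.2.2.2.2)],
            altBucket (P.H1 x.1.1.length) (x.1.2.1 ++ x.2.2) x.1.2.2.2.1, x.2.2)) (by fun_prop)
      · rw [kick]
        split_ifs
        · rfl
        · cases x.2.2.1.find? fun e => e.1 == x.2.2.2.1 <;> rfl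
  exact key.comp (f := fun x => (u x, idf x, sf x, m x, s x)) (by fun_prop)

@[fun_prop]
theorem polyTime_insertSF {u idf m s : α → Bits} {sf : α → SubFilter} (hu : PolyTime u)
    (hidf : PolyTime idf) (hsf : PolyTime sf) (hs : PolyTime s) (hm : PolyTime m) :
    PolyTime fun x => insertSF (P.H1 (u x).length) P.bucketSize P.maxKicks (idf x) (sf x) (s x) (m x) := by
  unfold insertSF
  exact PolyTime.ite (by fun_prop) (by fun_prop) (PolyTime.ite (by fun_prop) (by fun_prop) (by fun_prop))

@[fun_prop]
theorem polyTime_memberSF {u idf m s : α → Bits} {sf : α → SubFilter} (hu : PolyTime u)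
    (hidf : PolyTime idf) (hsf : PolyTime sf) (hs : PolyTime s) (hm : PolyTime m) :
    PolyTime fun x => memberSF (P.H1 (u x).length) (idf x) (sf x) (s x) (m x) := by
  unfold memberSF
  fun_prop

@[fun_prop]
theorem polyTime_deleteSF {u idf m s : α → Bits} {sf : α → SubFilter} (hu : PolyTime u)
    (hidf : PolyTime idf) (hsf : PolyTime sf) (hs : PolyTime s) (hm : PolyTime m) :
    PolyTime fun x => deleteSF (P.H1 (u x).length) (idf x) (sf x) (s x) (m x) := by
  unfold deleteSF
  fun_prop

/-- Some string of this length, a value of `H1`, is computed in polynomial time. -/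
theorem polyBdd_alpha {u : α → Bits} (hu : PolyTime u) : PolyBdd fun x => P.alpha (u x).length :=
  (P.polyTime_H1 hu (.const [])).polyBdd.mono fun x => by
    have := length_le_esize (P.H1 (u x).length [])
    rw [P.H1_length] at this
    omega

theorem polyBdd_xi {u : α → Bits} (hu : PolyTime u) : PolyBdd fun x => P.xi (u x).length :=
  (P.polyTime_H2 hu (.const [])).polyBdd.mono fun x => by
    have := length_le_esize (P.H2 (u x).length [])
    rw [P.H2_length] at this
    omega

theorem polyTime_splitStep {u : α → Bits} {c : α → Bits × SubFilter × Bits × Bits} (hu : PolyTime u)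
    (hc : PolyTime c) :
    PolyTime fun x => splitStep (P.H1 (u x).length) P.bucketSize P.maxKicks (c x) := by
  unfold splitStep
  fun_prop

theorem polyTime_splitIter {u : α → Bits} {st : α → SplitState} (hu : PolyTime u)
    (hst : PolyTime st) :
    PolyTime fun x => splitIter (P.H1 (u x).length) P.bucketSize P.maxKicks (st x) := by
  have := P.polyTime_splitStep (u := fun p : (α × List (Bits × SubFilter) ×
    Option (Bits × SubFilter × Bits × Bits)) × Bits × SubFilter × Bits × Bits => u p.1.1)
    (c := fun p => p.2) (by fun_prop) (by fun_prop)
  unfold splitIter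
  fun_prop

theorem length_le_max_of_mem {sf : SubFilter} {e : Bits × Bits} (he : e ∈ sf) :
    e.1.length ≤ esize sf ∧ e.2.length ≤ esize sf := by
  have h1 := esize_lt_of_mem he
  rw [show e = (e.1, e.2) from rfl, esize_pair] at h1
  have := length_le_esize e.1
  have := length_le_esize e.2
  omega

-- The number of steps enters as the length of a list, which is at most its size. The sub-filter is
-- arbitrary, so its own size and that of the left-over fingerprint serve as bounds for the lengths
-- of the slots.
@[fun_prop]
theorem polyTime_splitSF {l : α → List β} {u idf : α → Bits} {sf : α → SubFilter}
    {left : α → Bits × Bits}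
    (hu : PolyTime u) (hl : PolyTime l) (hidf : PolyTime idf) (hsf : PolyTime sf)
    (hleft : PolyTime left) :
    PolyTime fun x => splitSF (P.H1 (u x).length) P.bucketSize P.maxKicks (l x).length (idf x) (sf x)
      (left x) := by
  have ha := P.polyBdd_alpha hu
  have h := PolyTime.foldl (init := fun x => (some ([], some (idf x, sf x, left x)) : SplitState))
    (l := l) (step := fun x st _ => splitIter (P.H1 (u x).length) P.bucketSize P.maxKicks st)
    (by fun_prop) hl (P.polyTime_splitIter (by fun_prop) (by fun_prop))
    (B := fun x => (esize (l x) + 4) * (3 * (esize (idf x) + esize (l x)) +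
      (esize (sf x) + esize (l x)) * (3 * (P.alpha (u x).length + esize (sf x) + esize (left x)) +
        3 * (esize (sf x) + esize (left x)) + 4) +
      3 * (P.alpha (u x).length + esize (sf x) + esize (left x)) +
      3 * (esize (sf x) + esize (left x)) + 16)) (by fun_prop) ?_
  · refine PolyTime.congr (PolyTime.option_bind h (f := fun _ p =>
      if p.2.isNone = true then some p.1 else none) (by fun_prop)) fun x => ?_
    rw [splitSF_eq_foldl]
    simp
  · intro x m hm
    have hleft1 := length_le_esize (left x).1
    have hleft2 := length_le_esize (left x).2
    have hidf := length_le_esize (idf x)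
    have hsf := length_le_esize (sf x)
    have hll := length_le_esize (l x)
    have hml := hm.length_le
    have e : esize (left x) = esize (left x).1 + esize (left x).2 + 1 := rfl
    have h0 := SplitBdd.init (A := P.alpha (u x).length + esize (sf x) + esize (left x))
      (S := esize (sf x) + esize (left x)) (I := esize (idf x)) (L := esize (sf x))
      (c := (idf x, sf x, left x)) ⟨by dsimp only; omega, by dsimp only; omega, fun e he => by
        have : e.1.length ≤ esize (sf x) ∧ e.2.length ≤ esize (sf x) := length_le_max_of_mem he
        constructor <;> omega⟩ ⟨by dsimp only; omega, by dsimp only; omega⟩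
    have h1 := (SplitBdd.foldl (bs := P.bucketSize) (mk := P.maxKicks)
      (H1 := P.H1 (u x).length) (fun y => by rw [P.H1_length]; omega) m h0).esize_le
    refine h1.trans ?_
    rw [zero_add]
    gcongr <;> omega

end Primitives

/-! ## The update protocol in polynomial time -/

namespace Primitives

/-- Structures are encoded as tuples of their fields, so that their projections and constructors
cost nothing new. -/
instance : Enc Enclave := ⟨fun E => Enc.enc (E.cnt, E.index)⟩

instance : Enc Server := ⟨fun S => Enc.enc (S.tset, S.itset, S.xset)⟩

theorem esize_enclave (E : Enclave) : esize E = esize (E.cnt, E.index) := rfl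

theorem esize_server (S : Server) : esize S = esize (S.tset, S.itset, S.xset) := rfl

variable (P : Primitives) {α β γ : Type} [Enc α] [Enc β] [Enc γ]

theorem polyTime_enclave_tuple {E : α → Enclave} (h : PolyTime E) :
    PolyTime fun x => ((E x).cnt, (E x).index) :=
  h.of_enc_eq fun _ => rfl

theorem polyTime_server_tuple {S : α → Server} (h : PolyTime S) :
    PolyTime fun x => ((S x).tset, (S x).itset, (S x).xset) :=
  h.of_enc_eq fun _ => rfl

@[fun_prop]
theorem polyTime_cnt {E : α → Enclave} (h : PolyTime E) : PolyTime fun x => (E x).cnt :=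
  (polyTime_enclave_tuple h).fst

@[fun_prop]
theorem polyTime_index {E : α → Enclave} (h : PolyTime E) : PolyTime fun x => (E x).index :=
  (polyTime_enclave_tuple h).snd

@[fun_prop]
theorem polyTime_tset {S : α → Server} (h : PolyTime S) : PolyTime fun x => (S x).tset :=
  (polyTime_server_tuple h).fst

@[fun_prop]
theorem polyTime_itset {S : α → Server} (h : PolyTime S) : PolyTime fun x => (S x).itset :=
  (polyTime_server_tuple h).snd.fst

@[fun_prop]
theorem polyTime_xset {S : α → Server} (h : PolyTime S) : PolyTime fun x => (S x).xset :=
  (polyTime_server_tuple h).snd.snd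

@[fun_prop]
theorem polyTime_enclave_mk {c : α → List (Bits × ℕ)} {i : α → List (Bits × Bits)} (hc : PolyTime c)
    (hi : PolyTime i) : PolyTime fun x => Enclave.mk (c x) (i x) :=
  (hc.prodMk hi).of_enc_eq fun _ => rfl

@[fun_prop]
theorem polyTime_server_mk {a b : α → List (Bits × Bits)} {c : α → List (Bits × SubFilter)}
    (ha : PolyTime a) (hb : PolyTime b) (hc : PolyTime c) :
    PolyTime fun x => Server.mk (a x) (b x) (c x) :=
  (ha.prodMk (hb.prodMk hc)).of_enc_eq fun _ => rfl

@[fun_prop]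
theorem polyTime_idLen {u : α → Bits} (hu : PolyTime u) : PolyTime fun x => P.idLen (u x).length :=
  P.idLen_poly.length hu

@[fun_prop]
theorem polyTime_wtLen {u : α → Bits} (hu : PolyTime u) : PolyTime fun x => P.wtLen (u x).length :=
  P.wtLen_poly.length hu

@[fun_prop]
theorem polyTime_ctLen {u : α → Bits} (hu : PolyTime u) : PolyTime fun x => P.ctLen (u x).length :=
  P.ctLen_poly.length hu

@[fun_prop]
theorem polyTime_ctBits {u : α → Bits} {c : α → ℕ} (hu : PolyTime u) (hc : PolyTime c) :
    PolyTime fun x => P.ctBits (u x).length (c x) := by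
  refine (PolyTime.testBits (P.ctLen_poly.unary_length hu) hc).congr fun x => ?_
  rw [unary, List.length_replicate]
  rfl

@[fun_prop]
theorem polyTime_stag {u w : α → Bits} {K : α → Keys} {c : α → ℕ} (hu : PolyTime u) (hK : PolyTime K)
    (hw : PolyTime w) (hc : PolyTime c) : PolyTime fun x => P.stag (u x).length (K x) (w x) (c x) := by
  unfold stag
  fun_prop

@[fun_prop]
theorem polyTime_mask {w y : α → Bits} {K : α → Keys} (hK : PolyTime K)
    (hw : PolyTime w) (hy : PolyTime y) : PolyTime fun x => P.mask (K x) (w x) (y x) := by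
  unfold mask
  fun_prop

@[fun_prop]
theorem polyTime_parseIdE {u y : α → Bits} (hu : PolyTime u) (hy : PolyTime y) :
    PolyTime fun x => P.parseIdE (u x).length (y x) := by
  unfold parseIdE
  fun_prop

@[fun_prop]
theorem polyTime_parseStagE {u y : α → Bits} (hu : PolyTime u) (hy : PolyTime y) :
    PolyTime fun x => P.parseStagE (u x).length (y x) := by
  unfold parseStagE
  fun_prop

@[fun_prop]
theorem polyTime_leafOf {i : α → List (Bits × Bits)} {d : α → Bits} (hi : PolyTime i)
    (hd : PolyTime d) : PolyTime fun x => leafOf (i x) (d x) := by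
  unfold leafOf
  fun_prop

/-- The sub-filters that replace the sub-filter `idf` when the fingerprint `idf ++ s` is inserted. -/
def insertFilters (lam : ℕ) (idf : Bits) (sf : SubFilter) (s m : Bits) :
    Option (List (Bits × SubFilter)) :=
  (insertSF (P.H1 lam) P.bucketSize P.maxKicks idf sf s m).2.elim
    (some [(idf, (insertSF (P.H1 lam) P.bucketSize P.maxKicks idf sf s m).1)]) fun left =>
    splitSF (P.H1 lam) P.bucketSize P.maxKicks s.length idf
      (insertSF (P.H1 lam) P.bucketSize P.maxKicks idf sf s m).1 left

@[fun_prop]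
theorem polyTime_insertFilters {u idf m s : α → Bits} {sf : α → SubFilter} (hu : PolyTime u)
    (hidf : PolyTime idf) (hsf : PolyTime sf) (hs : PolyTime s) (hm : PolyTime m) :
    PolyTime fun x => P.insertFilters (u x).length (idf x) (sf x) (s x) (m x) := by
  unfold insertFilters
  fun_prop

/-- The case of `coreUpdate` that inserts an edge. -/
def coreInsert (lam : ℕ) (s3 : Bits) (K : Keys) (E : Enclave) (S : Server) (t : Token)
    (idf : Bits) (sf : SubFilter) : Option (Enclave × Server) :=
  (P.insertFilters lam idf sf ((P.H2 lam (t.1 ++ t.2.1)).drop idf.length)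
    (P.H1 lam (t.1 ++ t.2.1))).map fun new =>
    (⟨put E.cnt t.1 ((E.cnt.lookup t.1).getD 0 + 1),
        del E.index idf ++ new.map fun x => (x.1, P.H3.hash lam s3 x.2)⟩,
      ⟨put S.tset (P.stag lam K t.1 ((E.cnt.lookup t.1).getD 0 + 1))
          (P.mask K t.1 (t.2.1 ++ t.2.2.1 ++ P.ctBits lam ((E.cnt.lookup t.1).getD 0 + 1))),
        put S.itset (P.F3.eval K.2.2 (t.1 ++ t.2.1))
          (P.mask K t.1 (P.ctBits lam ((E.cnt.lookup t.1).getD 0 + 1) ++ t.2.1)),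
        del S.xset idf ++ new⟩)

/-- The case of `coreUpdate` that deletes an edge. -/
def coreDelete (lam : ℕ) (s3 : Bits) (K : Keys) (E : Enclave) (S : Server) (t : Token)
    (idf : Bits) (sf : SubFilter) : Option (Enclave × Server) :=
  (E.cnt.lookup t.1).bind fun c => (S.tset.lookup (P.stag lam K t.1 c)).bind fun idE =>
  (P.parseIdE lam (P.mask K t.1 idE)).bind fun y =>
  if y.2.2 = P.ctBits lam c then
    (S.itset.lookup (P.F3.eval K.2.2 (t.1 ++ t.2.1))).bind fun stagE =>
    (P.parseStagE lam (P.mask K t.1 stagE)).bind fun z =>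
    if z.2 = t.2.1 then
      some (⟨put E.cnt t.1 (c - 1), del E.index idf ++ [(idf, P.H3.hash lam s3
            (deleteSF (P.H1 lam) idf sf ((P.H2 lam (t.1 ++ t.2.1)).drop idf.length)
              (P.H1 lam (t.1 ++ t.2.1))))]⟩,
        ⟨put S.tset (P.F1.eval K.1 (t.1 ++ z.1)) (P.mask K t.1 (y.1 ++ y.2.1 ++ z.1)),
          del (put S.itset (P.F3.eval K.2.2 (t.1 ++ y.1)) (P.mask K t.1 (z.1 ++ y.1)))
            (P.F3.eval K.2.2 (t.1 ++ t.2.1)),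
          del S.xset idf ++ [(idf, deleteSF (P.H1 lam) idf sf
            ((P.H2 lam (t.1 ++ t.2.1)).drop idf.length) (P.H1 lam (t.1 ++ t.2.1)))]⟩)
    else none
  else none

theorem guard_bind {p : Prop} [Decidable p] {δ : Type} (f : Unit → Option δ) :
    (guard p : Option Unit).bind f = if p then f () else none := by
  split_ifs with h <;> simp [guard, h]

/-- The `do` block as nested binds of named functions, a form suited both to the time bounds and to
case distinctions. -/
theorem coreUpdate_eq (lam : ℕ) (s3 : Bits) (K : Keys) (E : Enclave) (S : Server) (t : Token) :
    P.coreUpdate lam s3 K E S t =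
      (leafOf E.index (P.H2 lam (t.1 ++ t.2.1))).bind fun l =>
      (S.xset.lookup l.1).bind fun sf => if P.H3.hash lam s3 sf = l.2 then
        (if t.2.2.2 = true then P.coreInsert lam s3 K E S t l.1 sf
          else P.coreDelete lam s3 K E S t l.1 sf) else none := by
  obtain ⟨w, id, wt, op⟩ := t
  unfold coreUpdate
  simp only [Option.bind_eq_bind, guard_bind]
  congr 1
  funext ⟨idf, h⟩
  congr 1
  funext sf
  dsimp only
  congr 1
  split_ifs
  · simp only [coreInsert, insertFilters]
    rcases insertSF (P.H1 lam) P.bucketSize P.maxKicks idf sf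
      (List.drop (List.length idf) (P.H2 lam (w ++ id))) (P.H1 lam (w ++ id)) with ⟨sf', _ | left⟩
    · rfl
    · simp only [Option.elim_some]
      rw [Option.map_eq_bind]
      rfl
  · rfl

@[fun_prop]
theorem polyTime_coreUpdate {u s3 : α → Bits} {K : α → Keys} {E : α → Enclave} {S : α → Server}
    {t : α → Token} (hu : PolyTime u) (hs3 : PolyTime s3) (hK : PolyTime K) (hE : PolyTime E)
    (hS : PolyTime S) (ht : PolyTime t) :
    PolyTime fun x => P.coreUpdate (u x).length (s3 x) (K x) (E x) (S x) (t x) := by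
  have key : PolyTime fun y : (Bits × Bits × Keys) × (Enclave × Server × Token) × Bits × SubFilter =>
      if y.2.1.2.2.2.2.2 = true then
        P.coreInsert y.1.1.length y.1.2.1 y.1.2.2 y.2.1.1 y.2.1.2.1 y.2.1.2.2 y.2.2.1 y.2.2.2
      else P.coreDelete y.1.1.length y.1.2.1 y.1.2.2 y.2.1.1 y.2.1.2.1 y.2.1.2.2 y.2.2.1 y.2.2.2 := by
    refine PolyTime.bool_ite (by fun_prop) ?_ ?_
    · unfold coreInsert
      fun_prop
    · unfold coreDelete
      fun_prop
  refine PolyTime.congr ?_ fun x => (P.coreUpdate_eq _ _ _ _ _ _).symm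
  refine PolyTime.option_bind (by fun_prop) (PolyTime.option_bind (by fun_prop) (PolyTime.ite
    (by fun_prop) ?_ (by fun_prop)))
  exact key.comp (f := fun y : (α × Bits × Bits) × SubFilter => ((u y.1.1, s3 y.1.1, K y.1.1),
    (E y.1.1, S y.1.1, t y.1.1), y.1.2.1, y.2)) (by fun_prop)

end Primitives

/-! ## Finite maps -/

section Maps

variable {κ β γ : Type} [BEq κ] [LawfulBEq κ]

theorem lookup_cons_eq [DecidableEq κ] (e : κ × β) (m : List (κ × β)) (k : κ) :
    (e :: m).lookup k = if k = e.1 then some e.2 else m.lookup k := by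
  rw [List.lookup]
  split_ifs with h
  · simp [h]
  · simp [beq_eq_false_iff_ne.2 h]

theorem lookup_isSome_iff_mem {m : List (κ × β)} {k : κ} :
    (m.lookup k).isSome ↔ k ∈ m.map Prod.fst := by
  classical
  induction m with
  | nil => simp
  | cons e m ih =>
    rw [lookup_cons_eq, List.map_cons, List.mem_cons]
    split_ifs with h
    · simp [h]
    · rw [ih]
      simp [h]

theorem lookup_eq_none_iff_not_mem {m : List (κ × β)} {k : κ} :
    m.lookup k = none ↔ k ∉ m.map Prod.fst := by
  rw [← lookup_isSome_iff_mem, ← Option.not_isSome_iff_eq_none]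

theorem mem_of_lookup_eq_some {m : List (κ × β)} {k : κ} {v : β} (h : m.lookup k = some v) :
    (k, v) ∈ m := by
  classical
  induction m with
  | nil => cases h
  | cons e m ih =>
    rw [lookup_cons_eq] at h
    split_ifs at h with hk
    · subst hk
      cases h
      exact List.mem_cons_self
    · exact List.mem_cons_of_mem _ (ih h)

end Maps

section Maps

variable {κ β γ : Type} [DecidableEq κ]

theorem put_eq (m : List (κ × β)) (k : κ) (v : β) :
    put m k v = if k ∈ m.map Prod.fst then m.map fun e => if e.1 = k then (k, v) else e
      else m ++ [(k, v)] := by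
  unfold put
  exact if_congr lookup_isSome_iff_mem rfl rfl

theorem mem_put {m : List (κ × β)} {k : κ} {v : β} {e : κ × β} (h : e ∈ put m k v) :
    e ∈ m ∨ e = (k, v) := by
  unfold put at h
  split_ifs at h
  · obtain ⟨e', he', rfl⟩ := List.mem_map.1 h
    split_ifs
    · exact Or.inr rfl
    · exact Or.inl he'
  · simpa using h

theorem length_put_le (m : List (κ × β)) (k : κ) (v : β) : (put m k v).length ≤ m.length + 1 := by
  unfold put
  split_ifs <;> simp

theorem del_map (m : List (κ × β)) (k : κ) (f : β → γ) :
    del (m.map fun x => (x.1, f x.2)) k = (del m k).map fun x => (x.1, f x.2) := by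
  unfold del
  rw [List.filter_map]
  rfl

/-- As the keys are distinct, `del` removes exactly one entry. With the content of a sub-filter for
`f`, this separates one sub-filter from the rest of the filter. -/
theorem sum_map_del {M : Type} [AddCommMonoid M] {m : List (κ × β)} (hm : (m.map Prod.fst).Nodup)
    {k : κ} {v : β} (h : (k, v) ∈ m) (f : κ × β → M) :
    (m.map f).sum = f (k, v) + ((del m k).map f).sum := by
  induction m with
  | nil => cases h
  | cons e m ih =>
    rw [List.map_cons, List.nodup_cons] at hm
    rcases List.mem_cons.1 h with rfl | hkv
    · have : del ((k, v) :: m) k = m := by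
        unfold del
        rw [List.filter_cons_of_neg (by simp), List.filter_eq_self]
        intro e he
        simp only [ne_eq, decide_not, Bool.not_eq_eq_eq_not, Bool.not_true, decide_eq_false_iff_not]
        intro hek
        have hmem := List.mem_map_of_mem (f := Prod.fst) he
        rw [hek] at hmem
        exact hm.1 hmem
      rw [this]
      simp
    · have hne : e.1 ≠ k := by
        intro hek
        have hmem := List.mem_map_of_mem (f := Prod.fst) hkv
        rw [← hek] at hmem
        exact hm.1 hmem
      have : del (e :: m) k = e :: del m k := by
        unfold del
        rw [List.filter_cons_of_pos (by simpa using hne)]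
      rw [this, List.map_cons, List.sum_cons, ih hm.2 hkv, List.map_cons, List.sum_cons, add_left_comm]

/-- An old key keeps its place and a new one goes to the end. The division of the keywords into
groups by position rests on this. -/
theorem map_fst_put (m : List (κ × β)) (k : κ) (v : β) :
    (put m k v).map Prod.fst =
      if k ∈ m.map Prod.fst then m.map Prod.fst else m.map Prod.fst ++ [k] := by
  rw [put_eq]
  by_cases h : k ∈ m.map Prod.fst
  · rw [if_pos h, if_pos h, List.map_map]
    refine List.map_congr_left fun e _ => ?_
    by_cases he : e.1 = k <;> simp [he]
  · rw [if_neg h, if_neg h]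
    simp

theorem lookup_put [BEq κ] [LawfulBEq κ] (m : List (κ × β)) (k j : κ) (v : β) :
    (put m k v).lookup j = if j = k then some v else m.lookup j := by
  rw [put_eq]
  have hother : j ≠ k → ∀ m : List (κ × β),
      (m.map fun e => if e.1 = k then (k, v) else e).lookup j = m.lookup j := by
    intro hj m
    induction m with
    | nil => rfl
    | cons e m ih =>
      rw [List.map_cons, lookup_cons_eq, lookup_cons_eq, ih]
      by_cases he : e.1 = k
      · rw [if_pos he, if_neg hj, if_neg (fun h => hj (h.trans he))]
      · rw [if_neg he]
  by_cases h : k ∈ m.map Prod.fst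
  · rw [if_pos h]
    by_cases hj : j = k
    · subst hj
      rw [if_pos rfl]
      induction m with
      | nil => simp at h
      | cons e m ih =>
        rw [List.map_cons, lookup_cons_eq]
        by_cases he : e.1 = j
        · rw [if_pos he, if_pos rfl]
        · rw [if_neg he, if_neg (Ne.symm he)]
          rw [List.map_cons, List.mem_cons] at h
          exact ih (h.resolve_left (Ne.symm he))
    · rw [if_neg hj, hother hj]
  · rw [if_neg h, List.lookup_append]
    by_cases hj : j = k
    · subst hj
      rw [lookup_eq_none_iff_not_mem.2 h, if_pos rfl, lookup_cons_eq, if_pos rfl]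
      rfl
    · rw [if_neg hj, lookup_cons_eq, if_neg hj, List.lookup_nil, Option.or_none]

end Maps

/-! ## The content of a cuckoo filter -/

/-- Neither string is a prefix of the other. -/
def Incomparable (a b : Bits) : Prop := ¬ a <+: b ∧ ¬ b <+: a

theorem Incomparable.symm {a b : Bits} (h : Incomparable a b) : Incomparable b a := ⟨h.2, h.1⟩

/-- If `k` were a prefix of `b`, then `k` and `a` would be prefixes of the same string and hence
comparable. -/
theorem Incomparable.of_prefix {k a b : Bits} (h : Incomparable k a) (hab : a <+: b) :
    Incomparable k b := by
  refine ⟨fun hk => ?_, fun hk => h.2 (hab.trans hk)⟩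
  rcases List.prefix_or_prefix_of_prefix hk hab with h' | h'
  · exact h.1 h'
  · exact h.2 h'

theorem Incomparable.not_common {a b d : Bits} (h : Incomparable a b) (ha : a <+: d) (hb : b <+: d) :
    False :=
  (List.prefix_or_prefix_of_prefix ha hb).elim h.1 h.2

theorem incomparable_append_not (idf : Bits) (c : Bool) :
    Incomparable (idf ++ [!c]) (idf ++ [c]) := by
  constructor <;> intro h <;> rw [List.prefix_append_right_inj] at h <;> simp at h

/-! ### Conservation of the content under kicks, insertions, splits and deletions. -/

section Classes

variable {H1 : Bits → Bits} {A bs mk : ℕ}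

/-- What a cuckoo filter knows about a fingerprint in a bucket: the fingerprint and its pair of
candidate buckets. -/
def slotClass (H1 : Bits → Bits) (d m : Bits) : Bits × Sym2 Bits := (d, s(m, altBucket H1 d m))

theorem xorB_xorB (a b : Bits) (h : b.length = a.length) : xorB a (xorB a b) = b := by
  unfold xorB
  induction a generalizing b with
  | nil => rw [List.length_eq_zero_iff.1 h]; rfl
  | cons x a ih =>
    cases b with
    | nil => cases h
    | cons y b =>
      rw [List.zipWith_cons_cons, List.zipWith_cons_cons, ih b (by simpa using h)]
      simp

theorem altBucket_length (hH : ∀ x, (H1 x).length = A) (d : Bits) {m : Bits} (hm : m.length = A) :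
    (altBucket H1 d m).length = A := by
  rw [altBucket, xorB_length, hH, hm, min_self]

theorem altBucket_altBucket (hH : ∀ x, (H1 x).length = A) (d : Bits) {m : Bits} (hm : m.length = A) :
    altBucket H1 d (altBucket H1 d m) = m :=
  xorB_xorB _ _ (hm.trans (hH d).symm)

/-- Xor with a fixed string is an involution, so moving a fingerprint to its other bucket only swaps
the two candidates. Equal lengths are needed because `xorB` truncates. -/
theorem slotClass_altBucket (hH : ∀ x, (H1 x).length = A) (d : Bits) {m : Bits} (hm : m.length = A) :
    slotClass H1 d (altBucket H1 d m) = slotClass H1 d m := by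
  rw [slotClass, altBucket_altBucket hH d hm, Sym2.eq_swap]
  rfl

theorem slotClass_eq_iff (hH : ∀ x, (H1 x).length = A) {d e m n : Bits} (hn : n.length = A) :
    slotClass H1 d m = slotClass H1 e n ↔ d = e ∧ (m = n ∨ m = altBucket H1 e n) := by
  unfold slotClass
  rw [Prod.mk.injEq]
  refine and_congr_right ?_
  rintro rfl
  rw [Sym2.eq_iff]
  constructor
  · rintro (⟨h, -⟩ | ⟨h, -⟩)
    · exact Or.inl h
    · exact Or.inr h
  · rintro (rfl | rfl)
    · exact Or.inl ⟨rfl, rfl⟩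
    · exact Or.inr ⟨rfl, altBucket_altBucket hH _ hn⟩

/-- The content of a sub-filter. -/
def filterClasses (H1 : Bits → Bits) (x : Bits × SubFilter) : Multiset (Bits × Sym2 Bits) :=
  ((x.2.map fun e => slotClass H1 (x.1 ++ e.2) e.1 : List _) : Multiset _)

theorem filterClasses_append (idf : Bits) (sf sf' : SubFilter) :
    filterClasses H1 (idf, sf ++ sf') = filterClasses H1 (idf, sf) + filterClasses H1 (idf, sf') := by
  simp [filterClasses]

theorem filterClasses_singleton (idf m s : Bits) :
    filterClasses H1 (idf, [(m, s)]) = {slotClass H1 (idf ++ s) m} := rfl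

theorem filterClasses_erase (idf : Bits) {sf : SubFilter} {e : Bits × Bits} (he : e ∈ sf) :
    slotClass H1 (idf ++ e.2) e.1 ::ₘ filterClasses H1 (idf, sf.erase e) =
      filterClasses H1 (idf, sf) := by
  have := (List.perm_cons_erase he).map fun e => slotClass H1 (idf ++ e.2) e.1
  simp only [filterClasses, Multiset.cons_coe]
  exact (Multiset.coe_eq_coe.2 this).symm

theorem mem_filterClasses {idf : Bits} {sf : SubFilter} {z : Bits × Sym2 Bits} :
    z ∈ filterClasses H1 (idf, sf) ↔ ∃ e ∈ sf, slotClass H1 (idf ++ e.2) e.1 = z := by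
  simp [filterClasses]

/-- At an eviction the new fingerprint enters the filter, and the evicted one takes its role as the
fingerprint to be placed. Its relocation does not change its class, so nothing is lost or created.
-/
theorem kick_classes (hH : ∀ x, (H1 x).length = A) (idf : Bits) (n : ℕ) (sf : SubFilter) (m s : Bits)
    (hm : m.length = A) :
    filterClasses H1 (idf, (kick H1 bs idf n sf m s).1) +
        (kick H1 bs idf n sf m s).2.elim 0 (fun e => {slotClass H1 (idf ++ e.2) e.1}) =
      slotClass H1 (idf ++ s) m ::ₘ filterClasses H1 (idf, sf) ∧
    ∀ e, (kick H1 bs idf n sf m s).2 = some e → e.1.length = A := by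
  induction n generalizing sf m s with
  | zero =>
    refine ⟨?_, fun e he => ?_⟩
    · simp only [kick, Option.elim_some]
      rw [add_comm, Multiset.singleton_add]
    · rw [← Option.some.inj he]
      exact hm
  | succ n ih =>
    rw [kick]
    split_ifs with hl
    · refine ⟨?_, by simp⟩
      simp only [Option.elim_none]
      rw [filterClasses_append, filterClasses_singleton, add_zero, add_comm, Multiset.singleton_add]
    · split
      · refine ⟨?_, fun e he => ?_⟩
        · simp only [Option.elim_some]
          rw [add_comm, Multiset.singleton_add]
        · rw [← Option.some.inj he]
          exact hm
      · rename_i e he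
        have hmem := List.mem_of_find?_eq_some he
        have hem : e.1 = m := by simpa using List.find?_some he
        obtain ⟨h1, h2⟩ := ih (sf.erase e ++ [(m, s)]) (altBucket H1 (idf ++ e.2) m) e.2
          (altBucket_length hH _ hm)
        refine ⟨h1.trans ?_, h2⟩
        rw [slotClass_altBucket hH _ hm, filterClasses_append, ← hem, ← Multiset.cons_add,
          filterClasses_erase idf hmem, filterClasses_singleton, add_comm, Multiset.singleton_add]

theorem insertSF_classes (hH : ∀ x, (H1 x).length = A) (idf : Bits) (sf : SubFilter) (s m : Bits)
    (hm : m.length = A) :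
    filterClasses H1 (idf, (insertSF H1 bs mk idf sf s m).1) +
        (insertSF H1 bs mk idf sf s m).2.elim 0 (fun e => {slotClass H1 (idf ++ e.2) e.1}) =
      slotClass H1 (idf ++ s) m ::ₘ filterClasses H1 (idf, sf) ∧
    ∀ e, (insertSF H1 bs mk idf sf s m).2 = some e → e.1.length = A := by
  unfold insertSF
  dsimp only
  split_ifs
  · refine ⟨?_, by simp⟩
    simp only [Option.elim_none]
    rw [filterClasses_append, filterClasses_singleton, add_zero, add_comm, Multiset.singleton_add]
  · refine ⟨?_, by simp⟩
    simp only [Option.elim_none]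
    rw [filterClasses_append, filterClasses_singleton, add_zero, add_comm, Multiset.singleton_add,
      slotClass_altBucket hH _ hm]
  · exact kick_classes hH idf mk sf m s hm

/-- The bit removed from a slot is appended to the identifier, so full fingerprints are unchanged. A
slot without a remaining bit would be dropped by both halves, which `hsf` excludes. -/
theorem halfSF_classes (idf : Bits) (c : Bool) {sf : SubFilter} (hsf : ∀ e ∈ sf, e.2 ≠ []) :
    filterClasses H1 (idf ++ [!c], halfSF (!c) sf) + filterClasses H1 (idf ++ [c], halfSF c sf) =
      filterClasses H1 (idf, sf) := by
  induction sf with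
  | nil => rfl
  | cons e sf ih =>
    have ih := ih fun e he => hsf e (List.mem_cons_of_mem _ he)
    obtain ⟨m, s⟩ := e
    cases s with
    | nil => exact absurd rfl (hsf (m, []) List.mem_cons_self)
    | cons b s =>
      by_cases hb : b = c
      · have e1 : halfSF c ((m, b :: s) :: sf) = (m, s) :: halfSF c sf := by simp [halfSF, hb]
        have e2 : halfSF (!c) ((m, b :: s) :: sf) = halfSF (!c) sf := by simp [halfSF, hb]
        rw [e1, e2]
        simp only [filterClasses, List.map_cons, ← Multiset.cons_coe] at ih ⊢
        rw [Multiset.add_cons, ih, hb]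
        simp
      · have hb' : b = !c := by cases b <;> cases c <;> simp_all
        have e1 : halfSF c ((m, b :: s) :: sf) = halfSF c sf := by simp [halfSF, hb]
        have e2 : halfSF (!c) ((m, b :: s) :: sf) = (m, s) :: halfSF (!c) sf := by
          simp [halfSF, hb']
        rw [e1, e2]
        simp only [filterClasses, List.map_cons, ← Multiset.cons_coe] at ih ⊢
        rw [Multiset.cons_add, ih, hb']
        simp

theorem fingerprint_length_of_classes {X : ℕ} {idf : Bits} {sf : SubFilter} :
    (∀ z ∈ filterClasses H1 (idf, sf), z.1.length = X) ↔ ∀ e ∈ sf, (idf ++ e.2).length = X := by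
  constructor
  · intro h e he
    exact h _ (mem_filterClasses.2 ⟨e, he, rfl⟩)
  · intro h z hz
    obtain ⟨e, he, rfl⟩ := mem_filterClasses.1 hz
    exact h e he

/-- All full fingerprints have the same length `X`. So if the left-over fingerprint still has a bit,
then every slot has one, and halving loses nothing. The half that is finished and everything
obtained from the other half lie below different children of `idf`, hence the incomparability. -/
theorem splitSF_classes (hH : ∀ x, (H1 x).length = A) {X n : ℕ} {idf : Bits} {sf : SubFilter}
    {left : Bits × Bits} {r : List (Bits × SubFilter)} (hm : left.1.length = A)
    (hs : (idf ++ left.2).length = X) (hsf : ∀ z ∈ filterClasses H1 (idf, sf), z.1.length = X)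
    (hr : splitSF H1 bs mk n idf sf left = some r) :
    (r.map (filterClasses H1)).sum =
        slotClass H1 (idf ++ left.2) left.1 ::ₘ filterClasses H1 (idf, sf) ∧
      r.Pairwise (fun a b => Incomparable a.1 b.1) ∧ ∀ x ∈ r, idf <+: x.1 := by
  induction n generalizing idf sf left r with
  | zero => cases hr
  | succ n ih =>
    obtain ⟨m, s⟩ := left
    cases s with
    | nil => cases hr
    | cons c s =>
      have hne : ∀ e ∈ sf, e.2 ≠ [] := by
        intro e he h0
        have h1 := fingerprint_length_of_classes.1 hsf e he
        rw [h0] at h1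
        simp at h1 hs
        omega
      have hhalf := halfSF_classes (H1 := H1) idf c hne
      have hins := insertSF_classes (bs := bs) (mk := mk) hH (idf ++ [c]) (halfSF c sf) s m hm
      have hidf : idf ++ [c] ++ s = idf ++ c :: s := by simp
      rw [splitSF] at hr
      revert hr hins
      rcases insertSF H1 bs mk (idf ++ [c]) (halfSF c sf) s m with ⟨sf', _ | left⟩ <;> intro hr hins
      · cases hr
        obtain ⟨h1, -⟩ := hins
        simp only [Option.elim_none, add_zero] at h1
        refine ⟨?_, ?_, ?_⟩
        · simp only [List.map_cons, List.map_nil, List.sum_cons, List.sum_nil, add_zero]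
          rw [h1, Multiset.add_cons, hhalf, hidf]
        · simpa using incomparable_append_not idf c
        · simp
      · obtain ⟨h1, h2⟩ := hins
        simp only [Option.elim_some] at h1
        obtain ⟨r', hr', rfl⟩ := Option.map_eq_some_iff.1 hr
        have hall : ∀ z ∈ slotClass H1 (idf ++ c :: s) m ::ₘ filterClasses H1 (idf ++ [c], halfSF c sf),
            z.1.length = X := by
          intro z hz
          rcases Multiset.mem_cons.1 hz with rfl | hz
          · exact hs
          · exact hsf z (by rw [← hhalf]; exact Multiset.mem_add.2 (Or.inr hz))
        rw [hidf] at h1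
        rw [← h1] at hall
        obtain ⟨g1, g2, g3⟩ := ih (h2 _ rfl) (hall (slotClass H1 (idf ++ [c] ++ left.2) left.1) (by simp))
          (fun z hz => hall z (Multiset.mem_add.2 (Or.inl hz))) hr'
        refine ⟨?_, ?_, ?_⟩
        · rw [List.map_cons, List.sum_cons, g1]
          rw [add_comm, Multiset.singleton_add] at h1
          rw [h1, Multiset.add_cons, hhalf]
        · refine List.pairwise_cons.2 ⟨fun x hx => ?_, g2⟩
          exact (incomparable_append_not idf c).of_prefix (g3 x hx)
        · intro x hx
          rcases List.mem_cons.1 hx with rfl | hx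
          · exact List.prefix_append _ _
          · exact (List.prefix_append _ _).trans (g3 x hx)

/-- The two buckets that are searched are the two members of the unordered pair in the class. -/
theorem memberSF_iff (hH : ∀ x, (H1 x).length = A) {idf d m : Bits} {sf : SubFilter}
    (hd : idf <+: d) (hm : m.length = A) :
    memberSF H1 idf sf (d.drop idf.length) m = true ↔
      slotClass H1 d m ∈ filterClasses H1 (idf, sf) := by
  obtain ⟨s, rfl⟩ := hd
  rw [List.drop_left, memberSF, mem_filterClasses, Bool.or_eq_true, List.contains_iff_mem,
    List.contains_iff_mem]
  constructor
  · rintro (h | h)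
    · exact ⟨_, h, rfl⟩
    · exact ⟨_, h, slotClass_altBucket hH _ hm⟩
  · rintro ⟨⟨m', s'⟩, h1, h2⟩
    rw [slotClass_eq_iff hH hm] at h2
    obtain ⟨h3, h4⟩ := h2
    obtain rfl := List.append_cancel_left h3
    rcases h4 with rfl | h4
    · exact Or.inl h1
    · dsimp only at h4
      exact Or.inr (h4 ▸ h1)

/-- Some slot has this class; if it is not in bucket `m`, it is in the other one. The erased slot
may stem from a different element of the same class, which makes no difference to the multiset. -/
theorem deleteSF_classes (hH : ∀ x, (H1 x).length = A) {idf d m : Bits} {sf : SubFilter}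
    (hd : idf <+: d) (hm : m.length = A) (h : slotClass H1 d m ∈ filterClasses H1 (idf, sf)) :
    slotClass H1 d m ::ₘ filterClasses H1 (idf, deleteSF H1 idf sf (d.drop idf.length) m) =
      filterClasses H1 (idf, sf) := by
  have h' := (memberSF_iff hH hd hm).2 h
  obtain ⟨s, rfl⟩ := hd
  rw [List.drop_left, memberSF, Bool.or_eq_true, List.contains_iff_mem, List.contains_iff_mem] at h'
  rw [List.drop_left, deleteSF]
  by_cases h1 : (m, s) ∈ sf
  · rw [if_pos (List.contains_iff_mem.2 h1)]
    exact filterClasses_erase idf h1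
  · rw [if_neg (fun h => h1 (List.contains_iff_mem.1 h))]
    rw [← slotClass_altBucket hH _ hm]
    exact filterClasses_erase idf (h'.resolve_left h1)

end Classes

/-! ### The invariant of honest updates. -/

namespace Primitives

variable (P : Primitives)

/-- What the cuckoo filter knows about an edge. -/
def edgeClass (lam : ℕ) (e : Bits × Bits × Bits) : Bits × Sym2 Bits :=
  slotClass (P.H1 lam) (P.H2 lam (e.1 ++ e.2.1)) (P.H1 lam (e.1 ++ e.2.1))

theorem sameSlot_iff {lam : ℕ} {x y : Bits} :
    P.SameSlot lam x y ↔ slotClass (P.H1 lam) (P.H2 lam x) (P.H1 lam x) =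
      slotClass (P.H1 lam) (P.H2 lam y) (P.H1 lam y) := by
  rw [slotClass_eq_iff (P.H1_length lam) (P.H1_length lam _)]
  rfl

/-- The enclave and the server represent the graph `G`. -/
structure Represents (lam : ℕ) (s3 : Bits) (G : Graph) (E : Enclave) (S : Server) : Prop where
  -- The tables `tset` and `itset` are left free: a loaded posting list is judged by its multiset
  -- hash only.
  index_eq : E.index = S.xset.map fun x => (x.1, P.H3.hash lam s3 x.2)
  incomparable : S.xset.Pairwise fun a b => Incomparable a.1 b.1
  classes : (S.xset.map (filterClasses (P.H1 lam))).sum = ((G.map (P.edgeClass lam) : List _) : Multiset _)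
  -- This makes the empty answer to a keyword without a counter right.
  cnt_isSome : ∀ e ∈ G, (E.cnt.lookup e.1).isSome

variable {P} {lam : ℕ} {s3 : Bits} {G : Graph} {E : Enclave} {S : Server}

theorem represents_init : P.Represents lam s3 [] (P.initEnclave lam s3) initServer where
  index_eq := rfl
  incomparable := by simp [initServer]
  classes := by simp [initServer, filterClasses]
  cnt_isSome := by simp

theorem nodup_keys_of_incomparable {xs : List (Bits × SubFilter)}
    (h : xs.Pairwise fun a b => Incomparable a.1 b.1) : (xs.map Prod.fst).Nodup := by
  rw [List.Nodup, List.pairwise_map]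
  refine h.imp fun {a b} hab heq => hab.1 ?_
  rw [heq]

theorem lookup_eq_some_of_mem {xs : List (Bits × SubFilter)} (hxs : (xs.map Prod.fst).Nodup)
    {x : Bits × SubFilter} (hx : x ∈ xs) : xs.lookup x.1 = some x.2 := by
  induction xs with
  | nil => cases hx
  | cons y xs ih =>
    rw [List.map_cons, List.nodup_cons] at hxs
    rw [List.lookup]
    rcases List.mem_cons.1 hx with rfl | hx
    · simp
    · have : ¬ x.1 = y.1 := fun h => hxs.1 (h ▸ List.mem_map_of_mem hx)
      simp only [beq_eq_false_iff_ne.2 this]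
      exact ih hxs.2 hx

namespace Represents

theorem nodup_keys (h : P.Represents lam s3 G E S) : (S.xset.map Prod.fst).Nodup :=
  nodup_keys_of_incomparable h.incomparable

theorem mem_classes_length (h : P.Represents lam s3 G E S) {x : Bits × SubFilter} (hx : x ∈ S.xset)
    {z : Bits × Sym2 Bits} (hz : z ∈ filterClasses (P.H1 lam) x) : z.1.length = P.xi lam := by
  have : z ∈ (S.xset.map (filterClasses (P.H1 lam))).sum := by
    rw [sum_map_del h.nodup_keys hx]
    exact Multiset.mem_add.2 (Or.inl hz)
  rw [h.classes, Multiset.mem_coe] at this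
  obtain ⟨e, -, rfl⟩ := List.mem_map.1 this
  exact P.H2_length lam _

theorem leafOf_eq_some (h : P.Represents lam s3 G E S) {d : Bits} {l : Bits × Bits}
    (hl : leafOf E.index d = some l) :
    l.1 <+: d ∧ ∃ sf, (l.1, sf) ∈ S.xset ∧ S.xset.lookup l.1 = some sf ∧
      l.2 = P.H3.hash lam s3 sf := by
  have h1 := List.find?_some hl
  have h2 := List.mem_of_find?_eq_some hl
  rw [h.index_eq] at h2
  obtain ⟨⟨idf, sf⟩, hx, rfl⟩ := List.mem_map.1 h2
  exact ⟨List.isPrefixOf_iff_prefix.1 h1, sf, hx, lookup_eq_some_of_mem h.nodup_keys hx, rfl⟩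

/-- A fingerprint is in the filter if and only if it is in the sub-filter responsible for it. -/
theorem mem_classes_iff (h : P.Represents lam s3 G E S) {x : Bits × SubFilter} (hx : x ∈ S.xset)
    {z : Bits × Sym2 Bits} (hz : x.1 <+: z.1) :
    z ∈ filterClasses (P.H1 lam) x ↔ ∃ e ∈ G, P.edgeClass lam e = z := by
  have h1 : (∃ e ∈ G, P.edgeClass lam e = z) ↔ z ∈ (S.xset.map (filterClasses (P.H1 lam))).sum := by
    rw [h.classes, Multiset.mem_coe, List.mem_map]
  rw [h1, sum_map_del h.nodup_keys hx, Multiset.mem_add]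
  refine ⟨Or.inl, fun h2 => h2.resolve_right fun h3 => ?_⟩
  have : ∀ xs : List (Bits × SubFilter), z ∈ (xs.map (filterClasses (P.H1 lam))).sum →
      ∃ y ∈ xs, z ∈ filterClasses (P.H1 lam) y := by
    intro xs
    induction xs with
    | nil => intro h; simp at h
    | cons y xs ih =>
      intro h
      rw [List.map_cons, List.sum_cons, Multiset.mem_add] at h
      rcases h with h | h
      · exact ⟨y, List.mem_cons_self, h⟩
      · obtain ⟨y', hy', h'⟩ := ih h
        exact ⟨y', List.mem_cons_of_mem _ hy', h'⟩
  obtain ⟨y, hy, hzy⟩ := this _ h3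
  -- The identifier of a second sub-filter `y` containing `z` would be a prefix of the same
  -- fingerprint as that of `x`, contrary to incomparability.
  rw [del, List.mem_filter] at hy
  obtain ⟨hy, hne⟩ := hy
  obtain ⟨e, -, rfl⟩ := mem_filterClasses.1 hzy
  have hne' : y ≠ x := by
    rintro rfl
    simp at hne
  have hinc : Incomparable y.1 x.1 := by
    have hsymm : Std.Symm fun a b : Bits × SubFilter => Incomparable a.1 b.1 :=
      ⟨fun _ _ h => h.symm⟩
    exact h.incomparable.forall hy hx hne'
  exact hinc.not_common (List.prefix_append _ _) hz

theorem memberSF_iff (h : P.Represents lam s3 G E S) {idf : Bits} {sf : SubFilter}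
    (hx : (idf, sf) ∈ S.xset) {y : Bits} (hy : idf <+: P.H2 lam y) :
    memberSF (P.H1 lam) idf sf ((P.H2 lam y).drop idf.length) (P.H1 lam y) = true ↔
      ∃ e ∈ G, P.SameSlot lam y (e.1 ++ e.2.1) := by
  rw [_root_.memberSF_iff (P.H1_length lam) hy (P.H1_length lam y), h.mem_classes_iff hx hy]
  simp only [sameSlot_iff]
  exact exists_congr fun e => and_congr_right fun _ => eq_comm

theorem replace_incomparable (h : P.Represents lam s3 G E S) {idf : Bits} {sf : SubFilter}
    (hx : (idf, sf) ∈ S.xset) {new : List (Bits × SubFilter)}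
    (h1 : new.Pairwise fun a b => Incomparable a.1 b.1) (h2 : ∀ x ∈ new, idf <+: x.1) :
    (del S.xset idf ++ new).Pairwise fun a b => Incomparable a.1 b.1 := by
  refine List.pairwise_append.2 ⟨h.incomparable.sublist List.filter_sublist, h1, fun a ha b hb => ?_⟩
  rw [del, List.mem_filter] at ha
  have hne : a ≠ (idf, sf) := by
    rintro rfl
    simp at ha
  have hsymm : Std.Symm fun a b : Bits × SubFilter => Incomparable a.1 b.1 :=
    ⟨fun _ _ h => h.symm⟩
  exact (h.incomparable.forall ha.1 hx hne).of_prefix (h2 b hb)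

/-- Only the responsible sub-filter changes, and its content gains or loses the class of the edge
concerned. `sum_map_del` isolates it from the rest of the filter. -/
theorem coreUpdate (h : P.Represents lam s3 G E S) {K : Keys} {t : Token} {G' : Graph}
    {E' : Enclave} {S' : Server} (hG : P.graphStep lam G t = some G')
    (hC : P.coreUpdate lam s3 K E S t = some (E', S')) : P.Represents lam s3 G' E' S' := by
  obtain ⟨w, id, wt, op⟩ := t
  rw [coreUpdate_eq] at hC
  obtain ⟨l, hl, hC⟩ := Option.bind_eq_some_iff.1 hC
  obtain ⟨sf, hsf, hC⟩ := Option.bind_eq_some_iff.1 hC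
  obtain ⟨hpre, sf', hmem, hlook, -⟩ := h.leafOf_eq_some hl
  rw [hsf] at hlook
  cases hlook
  have hd : l.1 ++ (P.H2 lam (w ++ id)).drop l.1.length = P.H2 lam (w ++ id) := by
    obtain ⟨s, hs⟩ := hpre
    rw [← hs, List.drop_left]
  have hA := P.H1_length lam
  split_ifs at hC with h1 h2
  · dsimp only at h2
    subst h2
    obtain ⟨new, hnew, hC⟩ := Option.map_eq_some_iff.1 hC
    cases hC
    have hG' : G' = G ++ [(w, id, wt)] := by
      simp only [graphStep, if_true] at hG
      split_ifs at hG
      exact (Option.some.inj hG).symm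
    have hnew' : (new.map (filterClasses (P.H1 lam))).sum =
        P.edgeClass lam (w, id, wt) ::ₘ filterClasses (P.H1 lam) (l.1, sf) ∧
        new.Pairwise (fun a b => Incomparable a.1 b.1) ∧ ∀ x ∈ new, l.1 <+: x.1 := by
      have hins := insertSF_classes (bs := P.bucketSize) (mk := P.maxKicks) hA l.1 sf
        ((P.H2 lam (w ++ id)).drop l.1.length) (P.H1 lam (w ++ id)) (hA _)
      rw [hd] at hins
      unfold insertFilters at hnew
      revert hins hnew
      rcases insertSF (P.H1 lam) P.bucketSize P.maxKicks l.1 sf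
        ((P.H2 lam (w ++ id)).drop l.1.length) (P.H1 lam (w ++ id)) with ⟨sf', _ | left⟩ <;>
        rintro hnew ⟨e1, e2⟩
      · cases hnew
        simp only [Option.elim_none, add_zero] at e1
        refine ⟨?_, by simp, by simp⟩
        rw [List.map_singleton, List.sum_singleton, e1]
        rfl
      · simp only [Option.elim_some] at e1 hnew
        have hall : ∀ z ∈ P.edgeClass lam (w, id, wt) ::ₘ filterClasses (P.H1 lam) (l.1, sf),
            z.1.length = P.xi lam := by
          intro z hz
          rcases Multiset.mem_cons.1 hz with rfl | hz
          · exact P.H2_length lam _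
          · exact h.mem_classes_length hmem hz
        have e1' : filterClasses (P.H1 lam) (l.1, sf') + {slotClass (P.H1 lam) (l.1 ++ left.2) left.1} =
          P.edgeClass lam (w, id, wt) ::ₘ filterClasses (P.H1 lam) (l.1, sf) := e1
        rw [← e1'] at hall
        obtain ⟨g1, g2, g3⟩ := splitSF_classes hA (e2 _ rfl)
          (hall (slotClass (P.H1 lam) (l.1 ++ left.2) left.1) (by simp))
          (fun z hz => hall z (Multiset.mem_add.2 (Or.inl hz))) hnew
        refine ⟨?_, g2, g3⟩
        rw [g1, ← e1', add_comm, Multiset.singleton_add]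
    obtain ⟨g1, g2, g3⟩ := hnew'
    refine ⟨?_, h.replace_incomparable hmem g2 g3, ?_, ?_⟩
    · dsimp only
      rw [h.index_eq, del_map, List.map_append]
    · dsimp only
      rw [List.map_append, List.sum_append, g1, Multiset.add_cons, add_comm,
        ← sum_map_del h.nodup_keys hmem, h.classes, hG', List.map_append, ← Multiset.coe_add, add_comm]
      rfl
    · intro e he
      dsimp only
      rw [lookup_put]
      split_ifs with hw
      · rfl
      · rw [hG', List.mem_append, List.mem_singleton] at he
        rcases he with he | rfl
        · exact h.cnt_isSome e he
        · exact absurd rfl hw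
  · have h2 : op = false := by simpa using h2
    subst h2
    obtain ⟨c, hc, hC⟩ := Option.bind_eq_some_iff.1 hC
    obtain ⟨idE, -, hC⟩ := Option.bind_eq_some_iff.1 hC
    obtain ⟨y, -, hC⟩ := Option.bind_eq_some_iff.1 hC
    split_ifs at hC
    obtain ⟨stagE, -, hC⟩ := Option.bind_eq_some_iff.1 hC
    obtain ⟨z, -, hC⟩ := Option.bind_eq_some_iff.1 hC
    split_ifs at hC
    cases hC
    obtain ⟨hin, hG'⟩ : (w, id, wt) ∈ G ∧ G' = G.erase (w, id, wt) := by
      simp only [graphStep, Bool.false_eq_true, if_false] at hG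
      split_ifs at hG with _ hin
      exact ⟨List.contains_iff_mem.1 hin, (Option.some.inj hG).symm⟩
    -- `graphStep` deletes only existing edges, so by the invariant the responsible sub-filter has a
    -- slot of this class.
    have hcls : slotClass (P.H1 lam) (P.H2 lam (w ++ id)) (P.H1 lam (w ++ id)) ∈
        filterClasses (P.H1 lam) (l.1, sf) := by
      rw [h.mem_classes_iff hmem hpre]
      exact ⟨_, hin, rfl⟩
    have hdel := deleteSF_classes hA hpre (hA _) hcls
    refine ⟨?_, h.replace_incomparable hmem (by simp) (by simp), ?_, ?_⟩
    · dsimp only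
      rw [h.index_eq, del_map, List.map_append]
      rfl
    · dsimp only
      have e1 := sum_map_del h.nodup_keys hmem (filterClasses (P.H1 lam))
      rw [h.classes, ← hdel] at e1
      have e2 := Multiset.coe_eq_coe.2 ((List.perm_cons_erase hin).map (P.edgeClass lam))
      rw [e1, List.map_cons, ← Multiset.cons_coe, Multiset.cons_add] at e2
      have e3 := (Multiset.cons_inj_right _).1 e2
      rw [hG', List.map_append, List.sum_append, ← e3, add_comm, List.map_singleton, List.sum_singleton]
    · intro e he
      dsimp only
      rw [lookup_put]
      split_ifs
      · rfl
      · rw [hG'] at he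
        exact h.cnt_isSome e (List.mem_of_mem_erase he)

end Represents

end Primitives

/-! ## The filtering phase of a search -/

namespace Primitives

variable (P : Primitives)

/-- Sub-filters that were loaded in the search. -/
abbrev Cache := List (Bits × SubFilter)

/-- Load the sub-filter at the leaf `l`. -/
def loadFilter (lam : ℕ) (s3 : Bits) (srv : List Bits → SubFilter) (cache : Cache) (l : Bits × Bits) :
    Option (SubFilter × Cache) :=
  (cache.lookup l.1).elim
    (if P.H3.hash lam s3 (srv (cache.map Prod.fst ++ [l.1])) = l.2 then
      some (srv (cache.map Prod.fst ++ [l.1]), cache ++ [(l.1, srv (cache.map Prod.fst ++ [l.1]))])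
      else none) fun sf => some (sf, cache)

/-- Check one `id` against one keyword. -/
def filterKeyword (lam : ℕ) (s3 : Bits) (index : List (Bits × Bits)) (srv : List Bits → SubFilter)
    (id w : Bits) (cache : Cache) : Option (Bool × Cache) :=
  (leafOf index (P.H2 lam (w ++ id))).bind fun l =>
    (P.loadFilter lam s3 srv cache l).map fun r =>
      (memberSF (P.H1 lam) l.1 r.1 ((P.H2 lam (w ++ id)).drop l.1.length) (P.H1 lam (w ++ id)), r.2)

theorem filterOne_cons (lam : ℕ) (s3 : Bits) (index : List (Bits × Bits))
    (srv : List Bits → SubFilter) (id w : Bits) (ws : List Bits) (cache : Cache) :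
    P.filterOne lam s3 index srv id (w :: ws) cache =
      (P.filterKeyword lam s3 index srv id w cache).bind fun r =>
        if r.1 = true then P.filterOne lam s3 index srv id ws r.2 else some (false, r.2) := by
  rw [filterOne, filterKeyword]
  simp only [Option.bind_eq_bind, Option.bind_assoc]
  congr 1
  funext ⟨idf, h⟩
  rw [Option.bind_map, loadFilter]
  dsimp only
  cases cache.lookup idf with
  | some sf => rfl
  | none =>
    rw [Option.elim_none]
    dsimp only
    split_ifs <;> rfl

/-- One step of the check of one `id`, the outcome for the previous keywords being given. -/
def filterIter (lam : ℕ) (s3 : Bits) (index : List (Bits × Bits)) (srv : List Bits → SubFilter)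
    (id : Bits) (st : Option (Bool × Cache)) (w : Bits) : Option (Bool × Cache) :=
  st.bind fun r => if r.1 = true then P.filterKeyword lam s3 index srv id w r.2 else some r

/-- Early exits become absorbing states: after a rejection (`none`) or a negative test (`false`) the
remaining keywords change nothing. -/
theorem filterOne_eq_foldl (lam : ℕ) (s3 : Bits) (index : List (Bits × Bits))
    (srv : List Bits → SubFilter) (id : Bits) (ws : List Bits) (cache : Cache) :
    P.filterOne lam s3 index srv id ws cache =
      ws.foldl (P.filterIter lam s3 index srv id) (some (true, cache)) := by
  have hnone : ∀ ws : List Bits, ws.foldl (P.filterIter lam s3 index srv id) none = none := by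
    intro ws
    induction ws with
    | nil => rfl
    | cons w ws ih => exact ih
  have hfalse : ∀ (ws : List Bits) (c : Cache),
      ws.foldl (P.filterIter lam s3 index srv id) (some (false, c)) = some (false, c) := by
    intro ws c
    induction ws with
    | nil => rfl
    | cons w ws ih => exact ih
  induction ws generalizing cache with
  | nil => rfl
  | cons w ws ih =>
    rw [filterOne_cons, List.foldl_cons]
    simp only [filterIter, Option.bind_some, if_true]
    rcases P.filterKeyword lam s3 index srv id w cache with _ | ⟨_ | _, c⟩
    · exact (hnone ws).symm
    · exact (hfalse ws c).symm
    · exact ih c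

/-- The cache after a posting list was filtered. -/
def finalCache (lam : ℕ) (s3 : Bits) (index : List (Bits × Bits)) (srv : List Bits → SubFilter)
    (ws : List Bits) (pl : List (Bits × Bits)) (cache : Option Cache) : Option Cache :=
  pl.foldl (fun st x => st.bind fun c =>
    (P.filterOne lam s3 index srv x.1 ws c).map Prod.snd) cache

/-! ### Correctness of the filtering if all loaded sub-filters are genuine. -/

section Sound

variable {P} {lam : ℕ} {s3 : Bits} {G : Graph} {E : Enclave} {S : Server}
  {srv : List Bits → SubFilter}

/-- Every cached sub-filter has the same hash as the one of the server `S`. -/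
def CacheVerified (P : Primitives) (lam : ℕ) (s3 : Bits) (S : Server) (c : Cache) : Prop :=
  ∀ e ∈ c, ∃ sf, (e.1, sf) ∈ S.xset ∧ P.H3.hash lam s3 e.2 = P.H3.hash lam s3 sf

/-- The test is right if the sub-filter used is genuine. As the cache only grows, genuineness may be
assumed of the cache at the very end, which is the object that a reduction inspects. -/
theorem filterKeyword_spec (h : P.Represents lam s3 G E S) {id w : Bits} {c : Cache}
    {r : Bool × Cache} (hr : P.filterKeyword lam s3 E.index srv id w c = some r)
    (hc : P.CacheVerified lam s3 S c) :
    P.CacheVerified lam s3 S r.2 ∧ c ⊆ r.2 ∧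
      (r.2 ⊆ S.xset → (r.1 = true ↔ ∃ e ∈ G, P.SameSlot lam (w ++ id) (e.1 ++ e.2.1))) := by
  obtain ⟨l, hl, hr⟩ := Option.bind_eq_some_iff.1 hr
  obtain ⟨⟨sf, c'⟩, hload, rfl⟩ := Option.map_eq_some_iff.1 hr
  obtain ⟨hpre, sf', hmem, -, hhash⟩ := h.leafOf_eq_some hl
  have key : P.CacheVerified lam s3 S c' ∧ c ⊆ c' ∧ (l.1, sf) ∈ c' := by
    unfold loadFilter at hload
    cases hlook : c.lookup l.1 with
    | some sf₁ =>
      rw [hlook] at hload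
      cases hload
      exact ⟨hc, fun _ h => h, mem_of_lookup_eq_some hlook⟩
    | none =>
      rw [hlook] at hload
      simp only [Option.elim_none] at hload
      split_ifs at hload with hh
      cases hload
      refine ⟨fun e he => ?_, List.subset_append_left _ _, by simp⟩
      rcases List.mem_append.1 he with he | he
      · exact hc e he
      · rw [List.mem_singleton.1 he]
        exact ⟨sf', hmem, hh.trans hhash⟩
  obtain ⟨h1, h2, h3⟩ := key
  exact ⟨h1, h2, fun hsub => h.memberSF_iff (hsub h3) hpre⟩

theorem filterOne_spec (h : P.Represents lam s3 G E S) {id : Bits} {ws : List Bits} {c : Cache}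
    {r : Bool × Cache} (hr : P.filterOne lam s3 E.index srv id ws c = some r)
    (hc : P.CacheVerified lam s3 S c) :
    P.CacheVerified lam s3 S r.2 ∧ c ⊆ r.2 ∧
      (r.2 ⊆ S.xset →
        (r.1 = true ↔ ∀ w ∈ ws, ∃ e ∈ G, P.SameSlot lam (w ++ id) (e.1 ++ e.2.1))) := by
  induction ws generalizing c with
  | nil =>
    cases hr
    exact ⟨hc, fun _ h => h, fun _ => by simp⟩
  | cons w ws ih =>
    rw [filterOne_cons] at hr
    obtain ⟨r', hr', hr⟩ := Option.bind_eq_some_iff.1 hr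
    obtain ⟨h1, h2, h3⟩ := filterKeyword_spec h hr' hc
    split_ifs at hr with hb
    · obtain ⟨h4, h5, h6⟩ := ih hr h1
      refine ⟨h4, List.Subset.trans h2 h5, fun hsub => ?_⟩
      rw [h6 hsub, List.forall_mem_cons, ← h3 (List.Subset.trans h5 hsub)]
      simp [hb]
    · cases hr
      refine ⟨h1, h2, fun hsub => ?_⟩
      rw [List.forall_mem_cons, ← h3 hsub]
      simp [hb]

/-- An error in `R` forces an entry of the final cache that is not in `S.xset`. `finalCache`
reproduces this cache independently of the result, for use in the reductions. -/
theorem filterAll_spec (h : P.Represents lam s3 G E S) {ws : List Bits} {pl : List (Bits × Bits)}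
    {c : Cache} {R : List Bits} (hR : P.filterAll lam s3 E.index srv ws pl c = some R)
    (hc : P.CacheVerified lam s3 S c) :
    ∃ c', P.finalCache lam s3 E.index srv ws pl (some c) = some c' ∧
      P.CacheVerified lam s3 S c' ∧ c ⊆ c' ∧ (c' ⊆ S.xset → ∀ id, id ∈ R ↔ id ∈ pl.map Prod.fst ∧
        ∀ w ∈ ws, ∃ e ∈ G, P.SameSlot lam (w ++ id) (e.1 ++ e.2.1)) := by
  induction pl generalizing c R with
  | nil =>
    cases hR
    exact ⟨c, rfl, hc, fun _ h => h, by simp⟩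
  | cons x pl ih =>
    rw [filterAll] at hR
    simp only [Option.bind_eq_bind] at hR
    obtain ⟨⟨ok, c₁⟩, h1, hR⟩ := Option.bind_eq_some_iff.1 hR
    obtain ⟨rest, h2, hR⟩ := Option.bind_eq_some_iff.1 hR
    obtain ⟨g1, g2, g3⟩ := filterOne_spec h h1 hc
    obtain ⟨c', e1, e2, e3, e4⟩ := ih h2 g1
    refine ⟨c', ?_, e2, List.Subset.trans g2 e3, fun hsub id => ?_⟩
    · rw [finalCache, List.foldl_cons, Option.bind_some, h1]
      exact e1
    · have g3 := g3 (List.Subset.trans e3 hsub)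
      have e4 := e4 hsub id
      rw [← Option.some.inj hR, List.map_cons, List.mem_cons]
      dsimp only at g3
      by_cases hok : ok = true
      · rw [if_pos hok, List.mem_cons, e4]
        constructor
        · rintro (rfl | h)
          · exact ⟨Or.inl rfl, g3.1 hok⟩
          · exact ⟨Or.inr h.1, h.2⟩
        · rintro ⟨rfl | h, h'⟩
          · exact Or.inl rfl
          · exact Or.inr ⟨h, h'⟩
      · rw [if_neg hok, e4]
        constructor
        · exact fun h => ⟨Or.inr h.1, h.2⟩
        · rintro ⟨rfl | h, h'⟩
          · exact absurd (g3.2 h') hok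
          · exact ⟨h, h'⟩

end Sound

/-! ### Time bounds -/

/-- Bounds for a cache: number of entries, size of identifiers and of sub-filters. -/
def CacheBdd (I M n : ℕ) (c : Cache) : Prop :=
  c.length ≤ n ∧ ∀ e ∈ c, esize e.1 ≤ I ∧ esize e.2 ≤ M

theorem CacheBdd.esize_le {I M n : ℕ} {c : Cache} (h : CacheBdd I M n c) :
    esize c ≤ n * (I + M + 2) + 1 := by
  have h1 : esize c ≤ c.length * (I + M + 2) + 1 := esize_le_of_forall fun e he => by
    have := h.2 e he
    rw [show e = (e.1, e.2) from rfl, esize_pair]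
    omega
  exact h1.trans (by gcongr; exact h.1)

theorem CacheBdd.esize_keys_le {I M n : ℕ} {c : Cache} (h : CacheBdd I M n c) {i : Bits}
    (hi : esize i ≤ I) : esize (c.map Prod.fst ++ [i]) ≤ (n + 1) * (I + 1) + 1 := by
  have h1 : esize (c.map Prod.fst ++ [i]) ≤ (c.map Prod.fst ++ [i]).length * (I + 1) + 1 :=
    esize_le_of_forall fun a ha => by
      rcases List.mem_append.1 ha with ha | ha
      · obtain ⟨e, he, rfl⟩ := List.mem_map.1 ha
        exact (h.2 e he).1
      · rw [List.mem_singleton.1 ha]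
        exact hi
  refine h1.trans ?_
  gcongr
  simpa using h.1

section Bdd

variable {P} {lam : ℕ} {s3 : Bits} {index : List (Bits × Bits)} {srv : List Bits → SubFilter}
  {I M N : ℕ}

/-- A request consists of identifiers only, so its size depends on the number of earlier requests
and not on the answers to them. Hence one bound `M` holds for all answers. -/
theorem CacheBdd.filterKeyword (hidx : ∀ e ∈ index, esize e.1 ≤ I)
    (hsrv : ∀ l, esize l ≤ (N + 1) * (I + 1) + 1 → esize (srv l) ≤ M) {id w : Bits} {c : Cache}
    {n : ℕ} {r : Bool × Cache} (hc : CacheBdd I M n c) (hn : n ≤ N)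
    (hr : P.filterKeyword lam s3 index srv id w c = some r) : CacheBdd I M (n + 1) r.2 := by
  obtain ⟨l, hl, hr⟩ := Option.bind_eq_some_iff.1 hr
  obtain ⟨⟨sf, c'⟩, hload, rfl⟩ := Option.map_eq_some_iff.1 hr
  have hlI := hidx l (List.mem_of_find?_eq_some hl)
  unfold loadFilter at hload
  cases hlook : c.lookup l.1 with
  | some sf₁ =>
    rw [hlook] at hload
    cases hload
    exact ⟨hc.1.trans (Nat.le_succ _), hc.2⟩
  | none =>
    rw [hlook] at hload
    simp only [Option.elim_none] at hload
    split_ifs at hload with hh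
    cases hload
    refine ⟨by simpa using hc.1, fun e he => ?_⟩
    rcases List.mem_append.1 he with he | he
    · exact hc.2 e he
    · rw [List.mem_singleton.1 he]
      exact ⟨hlI, hsrv _ ((hc.esize_keys_le hlI).trans (by gcongr))⟩

theorem CacheBdd.foldl_filterIter (hidx : ∀ e ∈ index, esize e.1 ≤ I)
    (hsrv : ∀ l, esize l ≤ (N + 1) * (I + 1) + 1 → esize (srv l) ≤ M) {id : Bits} {ws : List Bits}
    {n : ℕ} {st : Option (Bool × Cache)} (hst : ∀ r, st = some r → CacheBdd I M n r.2)
    (hn : n + ws.length ≤ N) {r : Bool × Cache}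
    (hr : ws.foldl (P.filterIter lam s3 index srv id) st = some r) :
    CacheBdd I M (n + ws.length) r.2 := by
  induction ws generalizing n st with
  | nil => exact hst r hr
  | cons w ws ih =>
    rw [List.foldl_cons] at hr
    rw [List.length_cons] at hn
    have := ih (n := n + 1) (fun r₁ hr₁ => by
      obtain ⟨r₀, h0, h1⟩ := Option.bind_eq_some_iff.1 hr₁
      split_ifs at h1 with hb
      · exact (hst r₀ h0).filterKeyword hidx hsrv (by omega) h1
      · cases h1
        exact ⟨(hst r₁ h0).1.trans (Nat.le_succ _), (hst r₁ h0).2⟩) (by omega) hr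
    rwa [add_assoc, add_comm 1] at this

theorem CacheBdd.finalCache (hidx : ∀ e ∈ index, esize e.1 ≤ I)
    (hsrv : ∀ l, esize l ≤ (N + 1) * (I + 1) + 1 → esize (srv l) ≤ M) {ws : List Bits}
    {pl : List (Bits × Bits)} {n : ℕ} {st : Option Cache} (hst : ∀ c, st = some c → CacheBdd I M n c)
    (hn : n + pl.length * ws.length ≤ N) {c : Cache}
    (hr : P.finalCache lam s3 index srv ws pl st = some c) :
    CacheBdd I M (n + pl.length * ws.length) c := by
  induction pl generalizing n st with
  | nil => simpa using hst c hr
  | cons x pl ih =>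
    rw [Primitives.finalCache, List.foldl_cons] at hr
    rw [List.length_cons, add_mul, one_mul] at hn
    have := ih (n := n + ws.length) (fun c' hc' => by
      obtain ⟨c₀, h0, h1⟩ := Option.bind_eq_some_iff.1 hc'
      obtain ⟨r, h2, rfl⟩ := Option.map_eq_some_iff.1 h1
      rw [filterOne_eq_foldl] at h2
      refine CacheBdd.foldl_filterIter hidx hsrv (st := some (true, c₀)) ?_ (by omega) h2
      intro r' hr'
      cases hr'
      exact hst c₀ h0) (by omega) hr
    rw [List.length_cons, add_mul, one_mul]
    rwa [add_assoc, add_comm ws.length] at this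

end Bdd

section PolyTime

variable {α : Type} [Enc α] {u s3 id w : α → Bits} {index : α → List (Bits × Bits)}
  {srv : α → List Bits → SubFilter} {c : α → Cache} {ws : α → List Bits}

theorem polyTime_filterKeyword (hu : PolyTime u) (hs3 : PolyTime s3) (hindex : PolyTime index)
    (hsrv : PolyTime fun p : α × List Bits => srv p.1 p.2) (hid : PolyTime id) (hw : PolyTime w)
    (hc : PolyTime c) :
    PolyTime fun x => P.filterKeyword (u x).length (s3 x) (index x) (srv x) (id x) (w x) (c x) := by
  have hs : PolyTime fun p : α × Bits × Bits => srv p.1 ((c p.1).map Prod.fst ++ [p.2.1]) :=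
    hsrv.comp (f := fun p : α × Bits × Bits => (p.1, (c p.1).map Prod.fst ++ [p.2.1])) (by fun_prop)
  have hload : PolyTime fun p : α × Bits × Bits =>
      P.loadFilter (u p.1).length (s3 p.1) (srv p.1) (c p.1) p.2 := by
    unfold loadFilter
    exact PolyTime.option_elim (by fun_prop) (PolyTime.ite (by fun_prop) (by fun_prop) (by fun_prop))
      (by fun_prop)
  unfold filterKeyword
  fun_prop

theorem polyTime_filterOne (hu : PolyTime u) (hs3 : PolyTime s3) (hindex : PolyTime index)
    (hsrv : PolyTime fun p : α × List Bits => srv p.1 p.2) (hid : PolyTime id) (hws : PolyTime ws)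
    (hc : PolyTime c) :
    PolyTime fun x => P.filterOne (u x).length (s3 x) (index x) (srv x) (id x) (ws x) (c x) := by
  obtain ⟨q, hq⟩ := hsrv.size_bdd
  have hstep : PolyTime fun p : α × Option (Bool × Cache) × Bits =>
      P.filterIter (u p.1).length (s3 p.1) (index p.1) (srv p.1) (id p.1) p.2.1 p.2.2 := by
    have h := P.polyTime_filterKeyword
      (u := fun p : (α × Option (Bool × Cache) × Bits) × Bool × Cache => u p.1.1)
      (s3 := fun p => s3 p.1.1) (index := fun p => index p.1.1) (srv := fun p => srv p.1.1)
      (id := fun p => id p.1.1) (w := fun p => p.1.2.2) (c := fun p => p.2.2)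
      (by fun_prop) (by fun_prop) (by fun_prop)
      (hsrv.comp (f := fun p : ((α × Option (Bool × Cache) × Bits) × Bool × Cache) × List Bits =>
        (p.1.1.1, p.2)) (by fun_prop)) (by fun_prop) (by fun_prop) (by fun_prop)
    unfold filterIter
    exact PolyTime.option_bind (by fun_prop) (PolyTime.bool_ite (by fun_prop) h (by fun_prop))
  -- `N` bounds the number of cached entries, `I` the identifiers, and `M` the sub-filters: those in
  -- the cache at the start and the answers to requests of at most `N + 1` identifiers.
  let N : α → ℕ := fun x => esize (c x) + esize (ws x)
  let I : α → ℕ := fun x => esize (c x) + esize (index x)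
  let M : α → ℕ := fun x => esize (c x) + q.eval (esize x + ((N x + 1) * (I x + 1) + 1) + 1)
  have hN : PolyBdd N := by fun_prop
  have hI : PolyBdd I := by fun_prop
  have hM : PolyBdd M := by fun_prop
  refine (PolyTime.foldl (init := fun x => some (true, c x)) (l := ws)
    (step := fun x => P.filterIter (u x).length (s3 x) (index x) (srv x) (id x))
    (by fun_prop) hws hstep (B := fun x => N x * (I x + M x + 2) + 10) (by fun_prop) ?_).congr
    fun x => (P.filterOne_eq_foldl _ _ _ _ _ _ _).symm
  intro x m hm
  have hml := hm.length_le
  have hwl := length_le_esize (ws x)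
  have hcl := length_le_esize (c x)
  cases hr : m.foldl (P.filterIter (u x).length (s3 x) (index x) (srv x) (id x))
    (some (true, c x)) with
  | none => rw [esize_none]; omega
  | some r =>
    have hb : CacheBdd (I x) (M x) (esize (c x) + m.length) r.2 := by
      refine CacheBdd.foldl_filterIter (N := N x) ?_ ?_ ?_ (by simp only [N]; omega) hr
      · intro e he
        have h1 := esize_lt_of_mem he
        rw [show e = (e.1, e.2) from rfl, esize_pair] at h1
        simp only [I]
        omega
      · intro l hl
        refine (hq (x, l)).trans (le_trans (q.eval_mono_nat ?_) (Nat.le_add_left _ _))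
        rw [esize_pair]
        omega
      · intro r' hr'
        cases hr'
        refine ⟨by dsimp only; omega, fun e he => ?_⟩
        have h1 : esize e < esize (c x) := esize_lt_of_mem he
        rw [show e = (e.1, e.2) from rfl, esize_pair] at h1
        simp only [I, M]
        constructor <;> omega
    have h1 := hb.esize_le
    have h2 := esize_bool r.1
    rw [esize_some, show r = (r.1, r.2) from rfl, esize_pair]
    have h3 : (esize (c x) + m.length) * (I x + M x + 2) ≤ N x * (I x + M x + 2) := by
      gcongr
      simp only [N]
      omega
    omega

theorem polyTime_finalCache {pl : α → List (Bits × Bits)} (hu : PolyTime u) (hs3 : PolyTime s3)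
    (hindex : PolyTime index) (hsrv : PolyTime fun p : α × List Bits => srv p.1 p.2)
    (hws : PolyTime ws) (hpl : PolyTime pl) :
    PolyTime fun x => P.finalCache (u x).length (s3 x) (index x) (srv x) (ws x) (pl x) (some []) := by
  obtain ⟨q, hq⟩ := hsrv.size_bdd
  have hstep : PolyTime fun p : α × Option Cache × Bits × Bits =>
      p.2.1.bind fun c => (P.filterOne (u p.1).length (s3 p.1) (index p.1) (srv p.1) p.2.2.1
        (ws p.1) c).map Prod.snd := by
    have h := P.polyTime_filterOne
      (u := fun p : (α × Option Cache × Bits × Bits) × Cache => u p.1.1)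
      (s3 := fun p => s3 p.1.1) (index := fun p => index p.1.1) (srv := fun p => srv p.1.1)
      (id := fun p => p.1.2.2.1) (ws := fun p => ws p.1.1) (c := fun p => p.2)
      (by fun_prop) (by fun_prop) (by fun_prop)
      (hsrv.comp (f := fun p : ((α × Option Cache × Bits × Bits) × Cache) × List Bits =>
        (p.1.1.1, p.2)) (by fun_prop)) (by fun_prop) (by fun_prop) (by fun_prop)
    exact PolyTime.option_bind (by fun_prop) (PolyTime.option_map h (f := fun _ => Prod.snd)
      (by fun_prop))
  -- At most one sub-filter is loaded for every pair of an entry of the posting list and a keyword.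
  let N : α → ℕ := fun x => esize (pl x) * esize (ws x)
  let I : α → ℕ := fun x => esize (index x)
  let M : α → ℕ := fun x => q.eval (esize x + ((N x + 1) * (I x + 1) + 1) + 1)
  have hN : PolyBdd N := by fun_prop
  have hI : PolyBdd I := by fun_prop
  have hM : PolyBdd M := by fun_prop
  refine (PolyTime.foldl (init := fun x => some []) (l := pl)
    (step := fun x st y => st.bind fun c => (P.filterOne (u x).length (s3 x) (index x) (srv x) y.1
        (ws x) c).map Prod.snd)
    (by fun_prop) hpl hstep (B := fun x => N x * (I x + M x + 2) + 10) (by fun_prop) ?_)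
  intro x m hm
  have hml := hm.length_le
  have hwl := length_le_esize (ws x)
  have hpll := length_le_esize (pl x)
  have hle : m.length * (ws x).length ≤ N x := by
    simp only [N]
    gcongr <;> omega
  cases hr : m.foldl (fun st y => st.bind fun c => (P.filterOne (u x).length (s3 x) (index x)
    (srv x) y.1 (ws x) c).map Prod.snd) (some []) with
  | none => rw [esize_none]; omega
  | some c =>
    have hb : CacheBdd (I x) (M x) (0 + m.length * (ws x).length) c := by
      refine CacheBdd.finalCache (P := P) (N := N x) (st := some []) ?_ ?_ ?_ (by omega) hr
      · intro e he
        have h1 := esize_lt_of_mem he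
        rw [show e = (e.1, e.2) from rfl, esize_pair] at h1
        simp only [I]
        omega
      · intro l hl
        refine (hq (x, l)).trans (q.eval_mono_nat ?_)
        rw [esize_pair]
        omega
      · intro c' hc'
        cases hc'
        exact ⟨by simp, by simp⟩
    have h1 := hb.esize_le
    rw [esize_some]
    have h3 : (0 + m.length * (ws x).length) * (I x + M x + 2) ≤ N x * (I x + M x + 2) := by
      gcongr
      omega
    omega

end PolyTime

/-! ### Collisions of `H3` from a cache that is not genuine. -/

/-- Two sub-filters, one of which is in the cache and the other at the server, that differ although
they belong to the same identifier. -/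
def cacheCollision (xset : List (Bits × SubFilter)) (c : Cache) : SubFilter × SubFilter :=
  (c.filterMap fun e => (xset.lookup e.1).bind fun sf =>
    if sf = e.2 then none else some (sf, e.2)).head?.getD ([], [])

theorem polyTime_cacheCollision {α : Type} [Enc α] {x : α → List (Bits × SubFilter)} {c : α → Cache}
    (hx : PolyTime x) (hc : PolyTime c) : PolyTime fun y => cacheCollision (x y) (c y) := by
  unfold cacheCollision
  fun_prop

/-- A verified entry that is not genuine has the hash of the genuine sub-filter with the same
identifier. Since identifiers are distinct, the lookup returns precisely that sub-filter. -/
theorem cacheCollision_spec {P : Primitives} {lam : ℕ} {s3 : Bits} {G : Graph} {E : Enclave}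
    {S : Server} (h : P.Represents lam s3 G E S) {c : Cache} (hc : P.CacheVerified lam s3 S c)
    (hsub : ¬ c ⊆ S.xset) :
    (cacheCollision S.xset c).1 ≠ (cacheCollision S.xset c).2 ∧
      P.H3.hash lam s3 (cacheCollision S.xset c).1 = P.H3.hash lam s3 (cacheCollision S.xset c).2 := by
  have hall : ∀ p ∈ c.filterMap fun e => (S.xset.lookup e.1).bind fun sf =>
      if sf = e.2 then none else some (sf, e.2),
      p.1 ≠ p.2 ∧ P.H3.hash lam s3 p.1 = P.H3.hash lam s3 p.2 := by
    intro p hp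
    obtain ⟨e, he, hp⟩ := List.mem_filterMap.1 hp
    obtain ⟨sf, hsf, hp⟩ := Option.bind_eq_some_iff.1 hp
    split_ifs at hp with hne
    cases hp
    obtain ⟨sf', hmem, hh⟩ := hc e he
    have := lookup_eq_some_of_mem h.nodup_keys hmem
    rw [hsf] at this
    cases this
    exact ⟨hne, hh.symm⟩
  have hne : (c.filterMap fun e => (S.xset.lookup e.1).bind fun sf =>
      if sf = e.2 then none else some (sf, e.2)) ≠ [] := by
    intro h0
    refine hsub fun e he => ?_
    by_contra hcon
    obtain ⟨sf', hmem, hh⟩ := hc e he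
    have h1 := lookup_eq_some_of_mem h.nodup_keys hmem
    have h2 : (sf', e.2) ∈ c.filterMap fun e => (S.xset.lookup e.1).bind fun sf =>
        if sf = e.2 then none else some (sf, e.2) := by
      refine List.mem_filterMap.2 ⟨e, he, ?_⟩
      rw [h1, Option.bind_some, if_neg]
      rintro rfl
      exact hcon hmem
    rw [h0] at h2
    cases h2
  unfold cacheCollision
  rw [List.head?_eq_some_head hne]
  exact hall _ (List.head_mem hne)

end Primitives

/-! ## Simulation of the honest updates in polynomial time -/

namespace Primitives

variable (P : Primitives) {α δ : Type} [Enc α] [Enc δ]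

@[fun_prop]
theorem polyTime_graphStep {u : α → Bits} {G : α → Graph} {t : α → Token} (hu : PolyTime u)
    (hG : PolyTime G) (ht : PolyTime t) : PolyTime fun x => P.graphStep (u x).length (G x) (t x) := by
  unfold graphStep
  exact PolyTime.ite (by fun_prop) (PolyTime.bool_ite (by fun_prop) (PolyTime.bool_ite (by fun_prop)
    (by fun_prop) (by fun_prop)) (PolyTime.bool_ite (by fun_prop) (by fun_prop) (by fun_prop)))
    (by fun_prop)

theorem graphStep_eq_some {lam : ℕ} {G G' : Graph} {t : Token} (h : P.graphStep lam G t = some G') :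
    t.2.1.length = P.idLen lam ∧ t.2.2.1.length = P.wtLen lam ∧
    (t.2.2.2 = true ∧ G' = G ++ [(t.1, t.2.1, t.2.2.1)] ∨
      t.2.2.2 = false ∧ (t.1, t.2.1, t.2.2.1) ∈ G ∧ G' = G.erase (t.1, t.2.1, t.2.2.1)) := by
  obtain ⟨w, id, wt, op⟩ := t
  unfold graphStep at h
  dsimp only at h ⊢
  split_ifs at h with h1 h2 h3 h3
  · exact ⟨h1.1, h1.2, Or.inl ⟨h2, (Option.some.inj h).symm⟩⟩
  · exact ⟨h1.1, h1.2, Or.inr ⟨by simpa using h2, List.contains_iff_mem.1 h3,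
      (Option.some.inj h).symm⟩⟩

/-! ### Posting lists and their multiset hashes. -/

/-- The posting list of a keyword. -/
def postingList (G : Graph) (w : Bits) : List Bits :=
  (G.filter fun e => e.1 == w).map fun e => e.2.1 ++ e.2.2

/-- The multiset hash of the posting list of a keyword. -/
def postingHash (lam : ℕ) (sM : Bits) (G : Graph) (w : Bits) : Bits :=
  P.MH.hash lam sM (postingList G w : Multiset Bits)

@[fun_prop]
theorem polyTime_postingList {G : α → Graph} {w : α → Bits} (hG : PolyTime G) (hw : PolyTime w) :
    PolyTime fun x => postingList (G x) (w x) := by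
  unfold postingList
  fun_prop

@[fun_prop]
theorem polyTime_postingHash {u sM w : α → Bits} {G : α → Graph} (hu : PolyTime u)
    (hs : PolyTime sM) (hG : PolyTime G) (hw : PolyTime w) :
    PolyTime fun x => P.postingHash (u x).length (sM x) (G x) (w x) := by
  unfold postingHash
  fun_prop

/-- An insertion is `hash_cons` and a deletion is `hash_erase`. The latter requires the element to
be present, which `graphStep` ensures. -/
theorem hashStep_postingHash {lam : ℕ} {sM : Bits} {G G' : Graph} {t : Token}
    (h : P.graphStep lam G t = some G') :
    P.hashStep lam sM (P.postingHash lam sM G t.1) t = P.postingHash lam sM G' t.1 := by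
  obtain ⟨-, -, ⟨h1, h2⟩ | ⟨h1, h2, h3⟩⟩ := P.graphStep_eq_some h
  · simp only [hashStep, h1, if_true, postingHash]
    rw [← P.MH.hash_cons, h2]
    congr 1
    rw [Multiset.cons_coe, Multiset.coe_eq_coe, postingList, postingList, List.filter_append,
      List.map_append]
    simp only [List.filter_cons, List.filter_nil, beq_self_eq_true, if_true, List.map_cons,
      List.map_nil]
    exact (List.perm_append_singleton _ _).symm
  · simp only [hashStep, h1, Bool.false_eq_true, if_false, postingHash]
    have hperm : (postingList G t.1).Perm ((t.2.1 ++ t.2.2.1) :: postingList G' t.1) := by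
      have := ((List.perm_cons_erase h2).filter fun e => e.1 == t.1).map fun e => e.2.1 ++ e.2.2
      simpa [postingList, h3] using this
    rw [← P.MH.hash_erase]
    · rw [Multiset.coe_eq_coe.2 hperm, Multiset.coe_erase]
      congr 1
      simp
    · rw [Multiset.coe_eq_coe.2 hperm]
      simp

theorem postingHash_of_ne {lam : ℕ} {sM : Bits} {G G' : Graph} {t : Token}
    (h : P.graphStep lam G t = some G') {w : Bits} (hw : w ≠ t.1) :
    P.postingHash lam sM G' w = P.postingHash lam sM G w := by
  have : (postingList G' w).Perm (postingList G w) := by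
    obtain ⟨-, -, ⟨h1, h2⟩ | ⟨h1, h2, h3⟩⟩ := P.graphStep_eq_some h
    · simp [postingList, h2, hw.symm]
    · have := ((List.perm_cons_erase h2).filter fun e => e.1 == w).map fun e => e.2.1 ++ e.2.2
      simpa [postingList, h3, hw.symm] using this.symm
  rw [postingHash, postingHash, Multiset.coe_eq_coe.2 this]

/-! ### The simulation and bounds for its state. -/

/-- Graph, enclave and server, with further data that depend on the scheme. -/
abbrev SimState (δ : Type) := Graph × Enclave × Server × δ

/-- One step of the simulation; `upd` updates the data that depend on the scheme. -/
def simStep (lam : ℕ) (s3 : Bits) (K : Keys) (upd : Graph → Graph → Enclave → Token → δ → δ)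
    (st : Option (SimState δ)) (t : Token) : Option (SimState δ) :=
  st.bind fun s => (P.graphStep lam s.1 t).bind fun G' =>
    (P.coreUpdate lam s3 K s.2.1 s.2.2.1 t).map fun r =>
      (G', r.1, r.2, upd s.1 G' s.2.1 t s.2.2.2)

/-- The simulation. -/
def simulate (lam : ℕ) (s3 : Bits) (K : Keys) (upd : Graph → Graph → Enclave → Token → δ → δ)
    (d : δ) (ts : List Token) : Option (SimState δ) :=
  ts.foldl (P.simStep lam s3 K upd) (some ([], P.initEnclave lam s3, initServer, d))

/-- Bounds for graph, enclave and server after `k` updates. -/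
structure CoreBdd (T κ H A X k : ℕ) (G : Graph) (E : Enclave) (S : Server) : Prop where
  graph_length : G.length ≤ k
  graph_size : ∀ e ∈ G, esize e ≤ T
  cnt_length : E.cnt.length ≤ k
  cnt_size : ∀ e ∈ E.cnt, esize e.1 ≤ T ∧ e.2 ≤ k
  -- An update puts at most `X + 1` sub-filters in place of one, since a split consumes at most `X`
  -- bits. The number of slots of a sub-filter also grows by at most `X + 1`, counting one for the
  -- insertion and one for every split.
  index_length : E.index.length ≤ 1 + k * (X + 1)
  index_size : ∀ e ∈ E.index, e.1.length ≤ X ∧ e.2.length ≤ H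
  tset_length : S.tset.length ≤ k
  tset_size : ∀ e ∈ S.tset, e.1.length ≤ κ ∧ e.2.length ≤ κ
  itset_length : S.itset.length ≤ k
  itset_size : ∀ e ∈ S.itset, e.1.length ≤ κ ∧ e.2.length ≤ κ
  xset_length : S.xset.length ≤ 1 + k * (X + 1)
  xset_size : ∀ e ∈ S.xset, FilterBdd A X X (k * (X + 1)) e

theorem esize_bitsPair_le {a b : ℕ} {e : Bits × Bits} (h : e.1.length ≤ a ∧ e.2.length ≤ b) :
    esize e ≤ 3 * a + 3 * b + 3 := by
  have h1 := esize_bits e.1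
  have h2 := esize_bits e.2
  rw [show e = (e.1, e.2) from rfl, esize_pair]
  omega

theorem CoreBdd.esize_le {T κ H A X k : ℕ} {G : Graph} {E : Enclave} {S : Server}
    (h : CoreBdd T κ H A X k G E S) : esize (G, E, S) ≤ k * (T + 1) + k * (T + k + 4) +
      (1 + k * (X + 1)) * (3 * X + 3 * H + 4) + 2 * (k * (6 * κ + 4)) +
      (1 + k * (X + 1)) * (3 * X + (k * (X + 1)) * (3 * A + 3 * X + 4) + 4) + 11 := by
  have h1 : esize G ≤ G.length * (T + 1) + 1 := esize_le_of_forall h.graph_size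
  have h2 : esize E.cnt ≤ E.cnt.length * (T + k + 4) + 1 := esize_le_of_forall fun e he => by
    obtain ⟨g1, g2⟩ := h.cnt_size e he
    have g3 : Nat.size e.2 ≤ e.2 := Nat.size_le.2 Nat.lt_two_pow_self
    rw [show e = (e.1, e.2) from rfl, esize_pair, esize_nat]
    omega
  have h3 : esize E.index ≤ E.index.length * (3 * X + 3 * H + 4) + 1 :=
    esize_le_of_forall fun e he => esize_bitsPair_le (h.index_size e he)
  have h4 : esize S.tset ≤ S.tset.length * (6 * κ + 4) + 1 := esize_le_of_forall fun e he => by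
    have := esize_bitsPair_le (h.tset_size e he)
    omega
  have h5 : esize S.itset ≤ S.itset.length * (6 * κ + 4) + 1 := esize_le_of_forall fun e he => by
    have := esize_bitsPair_le (h.itset_size e he)
    omega
  have h6 : esize S.xset ≤ S.xset.length * (3 * X + (k * (X + 1)) * (3 * A + 3 * X + 4) + 4) + 1 :=
    esize_le_of_forall fun e he => (h.xset_size e he).esize_le
  have g1 := Nat.mul_le_mul_right (T + 1) h.graph_length
  have g2 := Nat.mul_le_mul_right (T + k + 4) h.cnt_length
  have g3 := Nat.mul_le_mul_right (3 * X + 3 * H + 4) h.index_length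
  have g4 := Nat.mul_le_mul_right (6 * κ + 4) h.tset_length
  have g5 := Nat.mul_le_mul_right (6 * κ + 4) h.itset_length
  have g6 := Nat.mul_le_mul_right (3 * X + (k * (X + 1)) * (3 * A + 3 * X + 4) + 4) h.xset_length
  rw [esize_pair, esize_pair, esize_enclave, esize_server, esize_pair, esize_pair, esize_pair]
  omega

/-- The fingerprint has `P.xi lam - idf.length` bits left to be consumed by splits, so identifiers
never become longer than fingerprints. -/
theorem insertFilters_bdd {lam L : ℕ} {idf : Bits} {sf : SubFilter} {d m : Bits}
    {new : List (Bits × SubFilter)} (hx : FilterBdd (P.alpha lam) (P.xi lam) (P.xi lam) L (idf, sf))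
    (hd : d.length = P.xi lam) (hm : m.length = P.alpha lam)
    (h : P.insertFilters lam idf sf (d.drop idf.length) m = some new) :
    new.length ≤ P.xi lam + 1 ∧
      ∀ x ∈ new, FilterBdd (P.alpha lam) (P.xi lam) (P.xi lam) (L + (P.xi lam + 1)) x := by
  obtain ⟨h1, h2, h3⟩ := hx
  dsimp only at h1 h2 h3
  have hdl : (d.drop idf.length).length = P.xi lam - idf.length := by rw [List.length_drop, hd]
  have hA : ∀ x, (P.H1 lam x).length ≤ P.alpha lam := fun x => (P.H1_length lam x).le
  have hins := insertSF_bdd (bs := P.bucketSize) (mk := P.maxKicks) hA idf sf (d.drop idf.length) m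
    h3 ⟨hm.le, by dsimp only; omega⟩
  unfold insertFilters at h
  revert hins h
  rcases insertSF (P.H1 lam) P.bucketSize P.maxKicks idf sf (d.drop idf.length) m with
    ⟨sf', _ | left⟩ <;> rintro h ⟨e1, e2, e3⟩
  · cases h
    refine ⟨by simp, fun x hx => ?_⟩
    rw [List.mem_singleton.1 hx]
    exact ⟨h1, by dsimp only at e2 ⊢; omega, e1⟩
  · obtain ⟨g1, g2⟩ := splitSF_bdd (bs := P.bucketSize) (mk := P.maxKicks) (I := idf.length)
      (L := L + 1) hA (⟨le_rfl, by dsimp only at e2 ⊢; omega, e1⟩) (e3 _ rfl) h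
    refine ⟨by omega, fun x hx => (g2 x hx).mono (by omega) (by omega)⟩

theorem mem_of_mem_del {κ β : Type} [DecidableEq κ] {m : List (κ × β)} {k : κ} {e : κ × β}
    (h : e ∈ del m k) : e ∈ m := List.mem_of_mem_filter h

theorem length_del_le {κ β : Type} [DecidableEq κ] (m : List (κ × β)) (k : κ) :
    (del m k).length ≤ m.length := List.length_filter_le _ _

theorem put_bitsPair_bdd {m : List (Bits × Bits)} {k v : Bits} {κ n : ℕ}
    (hl : m.length ≤ n) (hm : ∀ e ∈ m, e.1.length ≤ κ ∧ e.2.length ≤ κ) (hk : k.length ≤ κ)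
    (hv : v.length ≤ κ) : (put m k v).length ≤ n + 1 ∧
      ∀ e ∈ put m k v, e.1.length ≤ κ ∧ e.2.length ≤ κ := by
  refine ⟨(length_put_le _ _ _).trans (by omega), fun e he => ?_⟩
  rcases mem_put he with he | rfl
  · exact hm e he
  · exact ⟨hk, hv⟩

theorem keys_length_le (K : Keys) :
    K.1.length ≤ esize K ∧ K.2.1.length ≤ esize K ∧ K.2.2.length ≤ esize K := by
  have h1 := length_le_esize K.1
  have h2 := length_le_esize K.2.1
  have h3 := length_le_esize K.2.2
  rw [show K = (K.1, K.2.1, K.2.2) from rfl, esize_pair, esize_pair]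
  dsimp only
  omega

/-- The xor is truncated to the pad, which is as long as the key; so encrypted entries are short
whatever is encrypted. -/
theorem mask_length_le (K : Keys) (w x : Bits) : (P.mask K w x).length ≤ esize K := by
  rw [mask, xorB_length, P.F2.eval_length]
  exact (min_le_right _ _).trans (keys_length_le K).2.1

-- Each length grows by an amount fixed in advance and independent of the state; so polynomially
-- many updates leave the state polynomial.
variable {P} in
theorem CoreBdd.step {T lam k : ℕ} {s3 : Bits} {K : Keys} {G G' : Graph} {E E' : Enclave}
    {S S' : Server} {t : Token}
    (h : CoreBdd T (esize K) (P.H3.outLen lam) (P.alpha lam) (P.xi lam) k G E S) (ht : esize t ≤ T)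
    (hG : P.graphStep lam G t = some G') (hC : P.coreUpdate lam s3 K E S t = some (E', S')) :
    CoreBdd T (esize K) (P.H3.outLen lam) (P.alpha lam) (P.xi lam) (k + 1) G' E' S' := by
  have hgraph : G'.length ≤ k + 1 ∧ ∀ e ∈ G', esize e ≤ T := by
    obtain ⟨-, -, ⟨h1, h2⟩ | ⟨h1, h2, h3⟩⟩ := P.graphStep_eq_some hG
    · rw [h2]
      refine ⟨by simpa using h.graph_length, fun e he => ?_⟩
      rcases List.mem_append.1 he with he | he
      · exact h.graph_size e he
      · rw [List.mem_singleton.1 he]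
        rw [show t = (t.1, t.2.1, t.2.2.1, t.2.2.2) from rfl] at ht
        simp only [esize_pair] at ht ⊢
        omega
    · rw [h3]
      exact ⟨(List.length_erase_le).trans (h.graph_length.trans (Nat.le_succ _)), fun e he =>
        h.graph_size e (List.mem_of_mem_erase he)⟩
  have htw : esize t.1 ≤ T := by
    rw [show t = (t.1, t.2) from rfl, esize_pair] at ht
    omega
  have hcnt : ∀ c ≤ k + 1, (put E.cnt t.1 c).length ≤ k + 1 ∧
      ∀ e ∈ put E.cnt t.1 c, esize e.1 ≤ T ∧ e.2 ≤ k + 1 := by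
    intro c hc
    refine ⟨(length_put_le _ _ _).trans (Nat.succ_le_succ h.cnt_length), fun e he => ?_⟩
    rcases mem_put he with he | rfl
    · exact ⟨(h.cnt_size e he).1, (h.cnt_size e he).2.trans (Nat.le_succ _)⟩
    · exact ⟨htw, hc⟩
  have hlook : ∀ c, E.cnt.lookup t.1 = some c → c ≤ k := fun c hc =>
    (h.cnt_size _ (mem_of_lookup_eq_some hc)).2
  obtain ⟨K1, K2, K3⟩ := keys_length_le K
  rw [coreUpdate_eq] at hC
  obtain ⟨l, hl, hC⟩ := Option.bind_eq_some_iff.1 hC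
  obtain ⟨sf, hsf, hC⟩ := Option.bind_eq_some_iff.1 hC
  have hmem := mem_of_lookup_eq_some hsf
  have hx := h.xset_size _ hmem
  have hL : (k + 1) * (P.xi lam + 1) = k * (P.xi lam + 1) + (P.xi lam + 1) := by ring
  have hreplace : ∀ new : List (Bits × SubFilter), new.length ≤ P.xi lam + 1 →
      (∀ x ∈ new, FilterBdd (P.alpha lam) (P.xi lam) (P.xi lam) (k * (P.xi lam + 1) + (P.xi lam + 1)) x) →
      (del E.index l.1 ++ new.map fun x => (x.1, P.H3.hash lam s3 x.2)).length ≤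
        1 + (k + 1) * (P.xi lam + 1) ∧
      (∀ e ∈ del E.index l.1 ++ new.map fun x => (x.1, P.H3.hash lam s3 x.2),
        e.1.length ≤ P.xi lam ∧ e.2.length ≤ P.H3.outLen lam) ∧
      (del S.xset l.1 ++ new).length ≤ 1 + (k + 1) * (P.xi lam + 1) ∧
      ∀ e ∈ del S.xset l.1 ++ new,
        FilterBdd (P.alpha lam) (P.xi lam) (P.xi lam) ((k + 1) * (P.xi lam + 1)) e := by
    intro new h1 h2
    have e1 := length_del_le E.index l.1
    have e2 := length_del_le S.xset l.1
    have e3 := h.index_length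
    have e4 := h.xset_length
    rw [hL]
    refine ⟨?_, fun e he => ?_, ?_, fun e he => ?_⟩
    · rw [List.length_append, List.length_map]
      omega
    · rcases List.mem_append.1 he with he | he
      · exact h.index_size e (mem_of_mem_del he)
      · obtain ⟨x, hx, rfl⟩ := List.mem_map.1 he
        exact ⟨(h2 x hx).1, (P.H3.hash_length _ _ _).le⟩
    · rw [List.length_append]
      omega
    · rcases List.mem_append.1 he with he | he
      · exact (h.xset_size e (mem_of_mem_del he)).mono le_rfl (by omega)
      · exact h2 e he
  split_ifs at hC with h1 h2
  · obtain ⟨new, hnew, hC⟩ := Option.map_eq_some_iff.1 hC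
    cases hC
    obtain ⟨g1, g2⟩ := P.insertFilters_bdd hx (P.H2_length lam _) (P.H1_length lam _) hnew
    obtain ⟨e1, e2, e3, e4⟩ := hreplace new g1 g2
    have hc : (E.cnt.lookup t.1).getD 0 + 1 ≤ k + 1 := by
      cases hc : E.cnt.lookup t.1 with
      | none => simp
      | some c => simpa using hlook c hc
    obtain ⟨c1, c2⟩ := hcnt _ hc
    obtain ⟨t1, t2⟩ := put_bitsPair_bdd (k := P.stag lam K t.1 ((E.cnt.lookup t.1).getD 0 + 1))
      (v := P.mask K t.1 (t.2.1 ++ t.2.2.1 ++ P.ctBits lam ((E.cnt.lookup t.1).getD 0 + 1)))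
      h.tset_length h.tset_size (by rw [stag, P.F1.eval_length]; exact K1) (P.mask_length_le _ _ _)
    obtain ⟨t3, t4⟩ := put_bitsPair_bdd (k := P.F3.eval K.2.2 (t.1 ++ t.2.1))
      (v := P.mask K t.1 (P.ctBits lam ((E.cnt.lookup t.1).getD 0 + 1) ++ t.2.1))
      h.itset_length h.itset_size (by rw [P.F3.eval_length]; exact K3) (P.mask_length_le _ _ _)
    exact ⟨hgraph.1, hgraph.2, c1, c2, e1, e2, t1, t2, t3, t4, e3, e4⟩
  · obtain ⟨c, hc, hC⟩ := Option.bind_eq_some_iff.1 hC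
    obtain ⟨idE, -, hC⟩ := Option.bind_eq_some_iff.1 hC
    obtain ⟨y, -, hC⟩ := Option.bind_eq_some_iff.1 hC
    split_ifs at hC
    obtain ⟨stagE, -, hC⟩ := Option.bind_eq_some_iff.1 hC
    obtain ⟨z, -, hC⟩ := Option.bind_eq_some_iff.1 hC
    split_ifs at hC
    cases hC
    have hdel : ∀ s m, (deleteSF (P.H1 lam) l.1 sf s m).Sublist sf := by
      intro s m
      unfold deleteSF
      split_ifs <;> exact List.erase_sublist
    obtain ⟨e1, e2, e3, e4⟩ := hreplace [(l.1, deleteSF (P.H1 lam) l.1 sf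
      ((P.H2 lam (t.1 ++ t.2.1)).drop l.1.length) (P.H1 lam (t.1 ++ t.2.1)))] (by simp) (by
        intro x hx'
        rw [List.mem_singleton.1 hx']
        refine ⟨hx.1, ((hdel _ _).length_le.trans hx.2.1).trans (Nat.le_add_right _ _), fun e he => ?_⟩
        exact hx.2.2 e ((hdel _ _).subset he))
    obtain ⟨c1, c2⟩ := hcnt (c - 1) (by have := hlook c hc; omega)
    obtain ⟨t1, t2⟩ := put_bitsPair_bdd (k := P.F1.eval K.1 (t.1 ++ z.1))
      (v := P.mask K t.1 (y.1 ++ y.2.1 ++ z.1))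
      h.tset_length h.tset_size (by rw [P.F1.eval_length]; exact K1) (P.mask_length_le _ _ _)
    obtain ⟨t3, t4⟩ := put_bitsPair_bdd (k := P.F3.eval K.2.2 (t.1 ++ y.1))
      (v := P.mask K t.1 (z.1 ++ y.1))
      h.itset_length h.itset_size (by rw [P.F3.eval_length]; exact K3) (P.mask_length_le _ _ _)
    exact ⟨hgraph.1, hgraph.2, c1, c2, e1, e2, t1, t2, (length_del_le _ _).trans t3,
      fun e he => t4 e (mem_of_mem_del he), e3, e4⟩

theorem coreBdd_init (T κ lam : ℕ) (s3 : Bits) :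
    CoreBdd T κ (P.H3.outLen lam) (P.alpha lam) (P.xi lam) 0 [] (P.initEnclave lam s3) initServer where
  graph_length := le_rfl
  graph_size := by simp
  cnt_length := le_rfl
  cnt_size := by simp [initEnclave]
  index_length := by simp [initEnclave]
  index_size := by simp [initEnclave, P.H3.hash_length]
  tset_length := le_rfl
  tset_size := by simp [initServer]
  itset_length := le_rfl
  itset_size := by simp [initServer]
  xset_length := by simp [initServer]
  xset_size := by simp [initServer, FilterBdd]

theorem _root_.HashFamily.polyBdd_outLen {X : Type} [Enc X] (H : HashFamily X) (x₀ : X) {u : α → Bits}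
    (hu : PolyTime u) : PolyBdd fun x => H.outLen (u x).length :=
  (H.polyTime_hash hu (.const []) (.const x₀)).polyBdd.mono fun x => by
    have := length_le_esize (H.hash (u x).length [] x₀)
    rw [H.hash_length] at this
    omega

theorem _root_.MultisetHash.polyBdd_outLen (M : MultisetHash) {u : α → Bits}
    (hu : PolyTime u) : PolyBdd fun x => M.outLen (u x).length :=
  (M.polyTime_hash hu (.const []) (.const [])).polyBdd.mono fun x => by
    have := length_le_esize (M.hash (u x).length [] (([] : List Bits) : Multiset Bits))
    rw [M.hash_length] at this
    omega

/-- `I` is an invariant of the data peculiar to the scheme. It may use that there are at most `k`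
keywords after `k` updates. -/
theorem simulate_bdd {δ : Type} {lam T : ℕ} {s3 : Bits} {K : Keys}
    {upd : Graph → Graph → Enclave → Token → δ → δ} {d : δ} {ts : List Token} {I : ℕ → δ → Prop}
    (ht : ∀ t ∈ ts, esize t ≤ T) (hI0 : I 0 d)
    (hI : ∀ k G G' E t d, t ∈ ts → E.cnt.length ≤ k → I k d → I (k + 1) (upd G G' E t d))
    {s : SimState δ} (hs : P.simulate lam s3 K upd d ts = some s) :
    CoreBdd T (esize K) (P.H3.outLen lam) (P.alpha lam) (P.xi lam) ts.length s.1 s.2.1 s.2.2.1 ∧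
      I ts.length s.2.2.2 := by
  have key : ∀ (m : List Token) (k : ℕ) (st : Option (SimState δ)), m ⊆ ts →
      (∀ s, st = some s → CoreBdd T (esize K) (P.H3.outLen lam) (P.alpha lam) (P.xi lam) k
        s.1 s.2.1 s.2.2.1 ∧ I k s.2.2.2) →
      ∀ s, m.foldl (P.simStep lam s3 K upd) st = some s →
        CoreBdd T (esize K) (P.H3.outLen lam) (P.alpha lam) (P.xi lam) (k + m.length)
        s.1 s.2.1 s.2.2.1 ∧ I (k + m.length) s.2.2.2 := by
    intro m
    induction m with
    | nil => intro k st _ h s hs; exact h s hs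
    | cons t m ih =>
      intro k st hm h s hs
      have htm := hm List.mem_cons_self
      have := ih (k + 1) (P.simStep lam s3 K upd st t) (fun a ha => hm (List.mem_cons_of_mem _ ha)) (by
        intro s' hs'
        obtain ⟨s₀, h0, h1⟩ := Option.bind_eq_some_iff.1 hs'
        obtain ⟨G', h2, h3⟩ := Option.bind_eq_some_iff.1 h1
        obtain ⟨r, h4, rfl⟩ := Option.map_eq_some_iff.1 h3
        obtain ⟨g1, g2⟩ := h s₀ h0
        exact ⟨g1.step (ht t htm) h2 h4, hI _ _ _ _ _ _ htm g1.cnt_length g2⟩) s hs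
      rwa [List.length_cons, ← add_assoc, add_right_comm]
  have := key ts 0 _ (fun _ h => h) (by
    intro s hs
    cases hs
    exact ⟨P.coreBdd_init T (esize K) lam s3, hI0⟩) s hs
  rwa [zero_add] at this

theorem polyTime_simulate {u s3 : α → Bits} {K : α → Keys} {ts : α → List Token} {d : α → δ}
    {upd : α → Graph → Graph → Enclave → Token → δ → δ} (hu : PolyTime u) (hs3 : PolyTime s3)
    (hK : PolyTime K) (hts : PolyTime ts) (hd : PolyTime d)
    (hupd : PolyTime fun p : α × Graph × Graph × Enclave × Token × δ =>
      upd p.1 p.2.1 p.2.2.1 p.2.2.2.1 p.2.2.2.2.1 p.2.2.2.2.2)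
    (I : α → ℕ → δ → Prop) (hI0 : ∀ x, I x 0 (d x))
    (hI : ∀ x k G G' E t d, t ∈ ts x → E.cnt.length ≤ k → I x k d → I x (k + 1) (upd x G G' E t d))
    {B : α → ℕ} (hB : PolyBdd B) (hIB : ∀ x k d, k ≤ (ts x).length → I x k d → esize d ≤ B x) :
    PolyTime fun x => P.simulate (u x).length (s3 x) (K x) (upd x) (d x) (ts x) := by
  have hstep : PolyTime fun p : α × Option (SimState δ) × Token =>
      P.simStep (u p.1).length (s3 p.1) (K p.1) (upd p.1) p.2.1 p.2.2 := by
    have h := hupd.comp (f := fun p : (((α × Option (SimState δ) × Token) × SimState δ) × Graph) ×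
      Enclave × Server => (p.1.1.1.1, p.1.1.2.1, p.1.2, p.1.1.2.2.1, p.1.1.1.2.2, p.1.1.2.2.2.2))
      (by fun_prop)
    unfold simStep
    fun_prop
  have hinit : PolyTime fun x => P.initEnclave (u x).length (s3 x) := by
    unfold initEnclave
    fun_prop
  have hH := P.H3.polyBdd_outLen [] hu
  have hA := P.polyBdd_alpha hu
  have hX := P.polyBdd_xi hu
  have hT := hts.polyBdd
  have hκ := hK.polyBdd
  refine PolyTime.foldl (init := fun x => some ([], P.initEnclave (u x).length (s3 x), initServer, d x))
    (l := ts) (step := fun x => P.simStep (u x).length (s3 x) (K x) (upd x)) (by fun_prop) hts hstep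
    (B := fun x => esize (ts x) * (esize (ts x) + 1) + esize (ts x) * (esize (ts x) + esize (ts x) + 4) +
      (1 + esize (ts x) * (P.xi (u x).length + 1)) *
        (3 * P.xi (u x).length + 3 * P.H3.outLen (u x).length + 4) +
      2 * (esize (ts x) * (6 * esize (K x) + 4)) +
      (1 + esize (ts x) * (P.xi (u x).length + 1)) * (3 * P.xi (u x).length +
        (esize (ts x) * (P.xi (u x).length + 1)) *
          (3 * P.alpha (u x).length + 3 * P.xi (u x).length + 4) + 4) + 11 + B x + 3)
    (by fun_prop) ?_
  intro x m hm
  have hml := hm.length_le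
  have htl := length_le_esize (ts x)
  cases hr : m.foldl (P.simStep (u x).length (s3 x) (K x) (upd x))
    (some ([], P.initEnclave (u x).length (s3 x), initServer, d x)) with
  | none => rw [esize_none]; omega
  | some s =>
    obtain ⟨h1, h2⟩ := P.simulate_bdd (T := esize (ts x)) (I := I x) (ts := m)
      (fun t ht => (esize_lt_of_mem (hm.subset ht)).le)
      (hI0 x) (fun k G G' E t d ht => hI x k G G' E t d (hm.subset ht)) hr
    have e1 := h1.esize_le
    have e2 := hIB x _ _ hml h2
    have e3 : esize (some s) = esize (s.1, s.2.1, s.2.2.1) + esize s.2.2.2 + 3 := by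
      rw [esize_some, show s = (s.1, s.2.1, s.2.2.1, s.2.2.2) from rfl]
      simp only [esize_pair]
      omega
    rw [e3]
    have hmt : m.length ≤ esize (ts x) := by omega
    refine le_trans (Nat.add_le_add_right (Nat.add_le_add e1 e2) 3) ?_
    gcongr

end Primitives

/-! ## A wrong result of an accepted search yields a collision -/

namespace Primitives

variable (P : Primitives) {α : Type} [Enc α]

/-- Identifiers and weights of the edges have the right lengths. -/
def GraphLengths (lam : ℕ) (G : Graph) : Prop :=
  ∀ e ∈ G, e.2.1.length = P.idLen lam ∧ e.2.2.length = P.wtLen lam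

variable {P} in
theorem GraphLengths.graphStep {lam : ℕ} {G G' : Graph} {t : Token} (h : P.GraphLengths lam G)
    (hG : P.graphStep lam G t = some G') : P.GraphLengths lam G' := by
  obtain ⟨h1, h2, ⟨h3, rfl⟩ | ⟨h3, h4, rfl⟩⟩ := P.graphStep_eq_some hG
  · intro e he
    rcases List.mem_append.1 he with he | he
    · exact h e he
    · rw [List.mem_singleton.1 he]
      exact ⟨h1, h2⟩
  · exact fun e he => h e (List.mem_of_mem_erase he)

/-- The loaded posting list. -/
def loadedList (lam : ℕ) (K : Keys) (E : Enclave) (w : Bits) (es : List Bits) :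
    Option (List (Bits × Bits)) :=
  (E.cnt.lookup w).bind fun c => P.decryptPL lam K w c es

/-- The posting list in the graph and the loaded one. -/
def multisetPair (lam : ℕ) (K : Keys) (G : Graph) (E : Enclave) (w : Bits) (es : List Bits) :
    List Bits × List Bits :=
  (P.loadedList lam K E w es).elim ([], []) fun pl =>
    (postingList G w, pl.map fun x => x.1 ++ x.2)

/-- Two sub-filters, one from the server `S` and the other loaded in the search from `srv`. -/
def filterPair (lam : ℕ) (s3 : Bits) (K : Keys) (E : Enclave) (S : Server) (q : Query)
    (es : List Bits) (srv : List Bits → SubFilter) : SubFilter × SubFilter :=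
  ((P.loadedList lam K E q.1 es).bind fun pl =>
    P.finalCache lam s3 E.index srv q.2 pl (some [])).elim ([], []) fun c =>
    cacheCollision S.xset c

theorem decryptPL_lengths {lam : ℕ} {K : Keys} {w : Bits} {c : ℕ} {es : List Bits}
    {pl : List (Bits × Bits)} (h : P.decryptPL lam K w c es = some pl) :
    ∀ x ∈ pl, x.1.length = P.idLen lam ∧ x.2.length = P.wtLen lam := by
  unfold decryptPL at h
  split_ifs at h with hl
  rw [List.mapM_option_eq] at h
  split_ifs at h with ha
  cases h
  intro x hx
  obtain ⟨e, -, he⟩ := List.mem_filterMap.1 hx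
  obtain ⟨y, hy, rfl⟩ := Option.map_eq_some_iff.1 he
  unfold parseIdE at hy
  split_ifs at hy with hlen
  cases hy
  simp only [List.length_take, List.length_drop]
  omega

/-- The hashed strings are concatenations; they determine the identifiers because all of these have
the same length. -/
theorem mem_map_fst_iff {lam : ℕ} {G : Graph} (hG : P.GraphLengths lam G) {w : Bits}
    {pl : List (Bits × Bits)} (hpl : ∀ x ∈ pl, x.1.length = P.idLen lam ∧ x.2.length = P.wtLen lam)
    (h : (postingList G w).Perm (pl.map fun x => x.1 ++ x.2)) (id : Bits) :
    id ∈ pl.map Prod.fst ↔ ∃ wt, (w, id, wt) ∈ G := by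
  constructor
  · intro hid
    obtain ⟨x, hx, rfl⟩ := List.mem_map.1 hid
    have h1 := h.symm.subset (List.mem_map_of_mem (f := fun x => x.1 ++ x.2) hx)
    obtain ⟨e, he, heq⟩ := List.mem_map.1 h1
    rw [List.mem_filter] at he
    obtain ⟨h2, -⟩ := List.append_inj heq (((hG e he.1).1).trans (hpl x hx).1.symm)
    refine ⟨e.2.2, ?_⟩
    rw [← h2, ← eq_of_beq he.2]
    exact he.1
  · rintro ⟨wt, hwt⟩
    have h1 : id ++ wt ∈ postingList G w :=
      List.mem_map.2 ⟨_, List.mem_filter.2 ⟨hwt, by simp⟩, rfl⟩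
    obtain ⟨x, hx, heq⟩ := List.mem_map.1 (h.subset h1)
    obtain ⟨h2, -⟩ := List.append_inj heq ((hpl x hx).1.trans (hG _ hwt).1.symm)
    exact List.mem_map.2 ⟨x, hx, h2⟩

/-- If the loaded posting list has the right hash and the filtering phase accepts a wrong result,
then there is a collision. -/
theorem collision_of_wrong {lam : ℕ} {s3 sM : Bits} {K : Keys} {G : Graph} {E : Enclave} {S : Server}
    {q : Query} {es R : List Bits} {c : ℕ} {pl : List (Bits × Bits)} {srv : List Bits → SubFilter}
    (h : P.Represents lam s3 G E S) (hG : P.GraphLengths lam G)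
    (hc : E.cnt.lookup q.1 = some c) (hpl : P.decryptPL lam K q.1 c es = some pl)
    (hhash : P.hashPL lam sM pl = P.postingHash lam sM G q.1)
    (hR : P.filterAll lam s3 E.index srv q.2 pl [] = some R)
    (hwrong : (∃ r ∈ R, r ∉ P.filterResult lam G q) ∨ ∃ r ∈ P.filterResult lam G q, r ∉ R) :
    (((P.multisetPair lam K G E q.1 es).1 : Multiset Bits) ≠ (P.multisetPair lam K G E q.1 es).2 ∧
      P.MH.hash lam sM ((P.multisetPair lam K G E q.1 es).1 : Multiset Bits) =
        P.MH.hash lam sM ((P.multisetPair lam K G E q.1 es).2 : Multiset Bits)) ∨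
    ((P.filterPair lam s3 K E S q es srv).1 ≠ (P.filterPair lam s3 K E S q es srv).2 ∧
      P.H3.hash lam s3 (P.filterPair lam s3 K E S q es srv).1 =
        P.H3.hash lam s3 (P.filterPair lam s3 K E S q es srv).2) := by
  have hload : P.loadedList lam K E q.1 es = some pl := by
    rw [loadedList, hc, Option.bind_some, hpl]
  simp only [multisetPair, filterPair, hload, Option.elim_some, Option.bind_some]
  -- With the right posting list the error must come from the filter, so some cached sub-filter is
  -- not genuine. With a wrong one, the two lists already collide.
  by_cases hperm : (postingList G q.1).Perm (pl.map fun x => x.1 ++ x.2)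
  · right
    obtain ⟨c', h1, h2, -, h4⟩ := filterAll_spec h hR (by intro e he; cases he)
    rw [h1, Option.elim_some]
    refine cacheCollision_spec h h2 fun hsub => ?_
    have key : ∀ id, id ∈ R ↔ id ∈ P.filterResult lam G q := fun id => by
      rw [h4 hsub id, P.mem_map_fst_iff hG (P.decryptPL_lengths hpl) hperm]
      rfl
    rcases hwrong with ⟨r, h5, h6⟩ | ⟨r, h5, h6⟩
    · exact h6 ((key r).1 h5)
    · exact h6 ((key r).2 h5)
  · left
    exact ⟨fun he => hperm (Multiset.coe_eq_coe.1 he), hhash.symm⟩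

/-- Without a counter there is no edge of the keyword, and the empty result is correct. -/
theorem not_wrong_of_lookup_eq_none {lam : ℕ} {s3 : Bits} {G : Graph} {E : Enclave} {S : Server}
    {q : Query} (h : P.Represents lam s3 G E S) (hc : E.cnt.lookup q.1 = none) :
    ¬ ((∃ r ∈ ([] : List Bits), r ∉ P.filterResult lam G q) ∨
      ∃ r ∈ P.filterResult lam G q, r ∉ ([] : List Bits)) := by
  rintro (⟨r, h1, -⟩ | ⟨r, ⟨⟨wt, h1⟩, -⟩, -⟩)
  · cases h1
  · have := h.cnt_isSome _ h1
    dsimp only at this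
    rw [hc] at this
    cases this

/-- `stagList` for counters of at most `n`. -/
def boundedStagList (lam : ℕ) (K : Keys) (w : Bits) (n c : ℕ) : List Bits :=
  ((List.range n).map fun j => P.stag lam K w (j + 1)).take c

/-- A counter is a number in binary. To stay polynomial, the tags are enumerated up to `n`, for
which the simulation takes the number of updates, and then cut off at the counter. -/
theorem boundedStagList_eq {lam : ℕ} {K : Keys} {w : Bits} {n c : ℕ} (h : c ≤ n) :
    P.boundedStagList lam K w n c = P.stagList lam K w c := by
  rw [boundedStagList, stagList, ← List.map_take, List.take_range, min_eq_left h]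

section PolyTime

variable {u s3 w : α → Bits} {K : α → Keys} {E : α → Enclave} {S : α → Server} {G : α → Graph}
  {q : α → Query} {es : α → List Bits} {srv : α → List Bits → SubFilter}

@[fun_prop]
theorem polyTime_loadedList (hu : PolyTime u) (hK : PolyTime K) (hE : PolyTime E) (hw : PolyTime w)
    (hes : PolyTime es) :
    PolyTime fun x => P.loadedList (u x).length (K x) (E x) (w x) (es x) := by
  unfold loadedList decryptPL
  refine PolyTime.option_bind (by fun_prop) (PolyTime.ite (by fun_prop) ?_ (by fun_prop))
  exact PolyTime.mapM (by fun_prop) (PolyTime.option_map (by fun_prop) (f := fun _ (x : Bits × Bits × Bits) => (x.1, x.2.1))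
    (by fun_prop))

@[fun_prop]
theorem polyTime_multisetPair (hu : PolyTime u) (hK : PolyTime K) (hG : PolyTime G)
    (hE : PolyTime E) (hw : PolyTime w) (hes : PolyTime es) :
    PolyTime fun x => P.multisetPair (u x).length (K x) (G x) (E x) (w x) (es x) := by
  unfold multisetPair
  fun_prop

theorem polyTime_filterPair (hu : PolyTime u) (hs3 : PolyTime s3) (hK : PolyTime K)
    (hE : PolyTime E) (hS : PolyTime S) (hq : PolyTime q) (hes : PolyTime es)
    (hsrv : PolyTime fun p : α × List Bits => srv p.1 p.2) :
    PolyTime fun x =>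
      P.filterPair (u x).length (s3 x) (K x) (E x) (S x) (q x) (es x) (srv x) := by
  have h := P.polyTime_finalCache (u := fun p : α × List (Bits × Bits) => u p.1)
    (s3 := fun p => s3 p.1) (index := fun p => (E p.1).index) (srv := fun p => srv p.1)
    (ws := fun p => (q p.1).2) (pl := fun p => p.2) (by fun_prop) (by fun_prop) (by fun_prop)
    (hsrv.comp (f := fun p : (α × List (Bits × Bits)) × List Bits => (p.1.1, p.2)) (by fun_prop))
    (by fun_prop) (by fun_prop)
  exact PolyTime.option_elim (PolyTime.option_bind (by fun_prop) h) (by fun_prop)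
    (polyTime_cacheCollision (by fun_prop) (by fun_prop))

@[fun_prop]
theorem polyTime_boundedStagList {β : Type} [Enc β] {l : α → List β} {c : α → ℕ} (hu : PolyTime u)
    (hK : PolyTime K) (hw : PolyTime w) (hl : PolyTime l) (hc : PolyTime c) :
    PolyTime fun x => P.boundedStagList (u x).length (K x) (w x) (l x).length (c x) := by
  unfold boundedStagList
  fun_prop

end PolyTime

/-! ## VSecGraph -/

section VSecGraph

/-- Update of `M_h` in the simulation. -/
def vUpd (lam : ℕ) (sM : Bits) (_ G' : Graph) (_ : Enclave) (t : Token) (mh : List (Bits × Bits)) :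
    List (Bits × Bits) :=
  put mh t.1 (P.postingHash lam sM G' t.1)

-- By `hashStep_postingHash` the incremental hash is the hash of the posting list in the plaintext
-- graph, so the simulation may recompute it. This fixes its length, whereas `add` and `sub` need
-- not preserve lengths on arbitrary strings.
variable {P} in
theorem vUpdate_simulate {lam : ℕ} {pub : VPub} {K : Keys} {ts : List Token} {G₀ G : Graph}
    {st₀ st : VState} (hrep : P.Represents lam pub.2 G₀ st₀.enc st₀.srv)
    (hlen : P.GraphLengths lam G₀)
    (hmh : ∀ w, (st₀.mh.lookup w).getD (P.MH.hash lam pub.1 0) = P.postingHash lam pub.1 G₀ w)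
    (hG : ts.foldlM (P.graphStep lam) G₀ = some G)
    (hst : ts.foldlM (P.vUpdate lam pub K) st₀ = some st) :
    ts.foldl (P.simStep lam pub.2 K (P.vUpd lam pub.1)) (some (G₀, st₀.enc, st₀.srv, st₀.mh)) =
      some (G, st.enc, st.srv, st.mh) ∧
    P.Represents lam pub.2 G st.enc st.srv ∧ P.GraphLengths lam G ∧
    ∀ w, (st.mh.lookup w).getD (P.MH.hash lam pub.1 0) = P.postingHash lam pub.1 G w := by
  induction ts generalizing G₀ st₀ with
  | nil =>
    cases hG
    cases hst
    exact ⟨rfl, hrep, hlen, hmh⟩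
  | cons t ts ih =>
    rw [List.foldlM_cons] at hG hst
    obtain ⟨G₁, hG₁, hG⟩ := Option.bind_eq_some_iff.1 hG
    obtain ⟨st₁, hst₁, hst⟩ := Option.bind_eq_some_iff.1 hst
    obtain ⟨⟨E, S⟩, hcore, hst₁⟩ := Option.bind_eq_some_iff.1 hst₁
    cases hst₁
    have hstep := P.hashStep_postingHash (sM := pub.1) hG₁
    rw [← hmh] at hstep
    have := ih (st₀ := ⟨E, put st₀.mh t.1 (P.hashStep lam pub.1
      ((st₀.mh.lookup t.1).getD (P.MH.hash lam pub.1 0)) t), S⟩) (hrep.coreUpdate hG₁ hcore)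
      (hlen.graphStep hG₁) (by
        intro w
        dsimp only
        rw [lookup_put]
        split_ifs with hw
        · rw [hw, Option.getD_some, hstep]
        · rw [hmh, P.postingHash_of_ne hG₁ hw]) hG hst
    rw [List.foldl_cons]
    refine ⟨?_, this.2⟩
    rw [← this.1]
    congr 1
    simp only [simStep, Option.bind_some, hG₁, hcore, Option.map_some, vUpd, hstep]

/-! ### The collision finders against VSecGraph. -/

variable (A : Adversary VPub VView (List Bits))

/-- Coins of the adversary, seeds and keys, with the unary security parameter. -/
abbrev VInput := Bits × Bits × VPub × Keys

def vInp (x : VInput) : Bits × Bits × VPub := (x.1, x.2.1, x.2.2.1)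

def vSim (x : VInput) : Option (SimState (List (Bits × Bits))) :=
  P.simulate x.1.length x.2.2.1.2 x.2.2.2 (P.vUpd x.1.length x.2.2.1.1) [] (A.graph (vInp x))

def vSimView (s : SimState (List (Bits × Bits))) : VView :=
  ((s.2.1.cnt, s.2.1.index, s.2.2.2), (s.2.2.1.tset, s.2.2.1.itset, s.2.2.1.xset))

def vStags (x : VInput) (s : SimState (List (Bits × Bits))) : List Bits :=
  P.boundedStagList x.1.length x.2.2.2 (A.query (vInp x, vSimView s)).1 (A.graph (vInp x)).length
    ((s.2.1.cnt.lookup (A.query (vInp x, vSimView s)).1).getD 0)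

/-- Colliding multisets. -/
def vMultisets (x : VInput) : List Bits × List Bits :=
  (P.vSim A x).elim ([], []) fun s =>
    P.multisetPair x.1.length x.2.2.2 s.1 s.2.1 (A.query (vInp x, vSimView s)).1
      (A.posting ((vInp x, vSimView s), P.vStags A x s))

/-- Colliding sub-filters. -/
def vFilters (x : VInput) : SubFilter × SubFilter :=
  (P.vSim A x).elim ([], []) fun s =>
    P.filterPair x.1.length x.2.2.1.2 x.2.2.2 s.2.1 s.2.2.1 (A.query (vInp x, vSimView s))
      (A.posting ((vInp x, vSimView s), P.vStags A x s))
      fun ids => A.subFilter (((vInp x, vSimView s), P.vStags A x s), ids)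

/-- The final graph and the query. -/
def vGraphQuery (x : VInput) : Graph × Query :=
  (P.vSim A x).elim ([], [], []) fun s => (s.1, A.query (vInp x, vSimView s))

theorem polyTime_vInp : PolyTime vInp := by
  unfold vInp
  fun_prop

theorem polyTime_vSim : PolyTime (P.vSim A) := by
  have hg : PolyTime fun x : VInput => A.graph (vInp x) := A.graph_poly.comp polyTime_vInp
  have hout := P.MH.polyBdd_outLen (u := fun x : VInput => x.1) (by fun_prop)
  refine P.polyTime_simulate (u := fun x : VInput => x.1) (s3 := fun x => x.2.2.1.2)
    (K := fun x => x.2.2.2) (ts := fun x => A.graph (vInp x)) (d := fun _ => [])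
    (upd := fun x => P.vUpd x.1.length x.2.2.1.1)
    (by fun_prop) (by fun_prop) (by fun_prop) hg (by fun_prop) (by unfold vUpd; fun_prop)
    -- After `k` updates `M_h` has at most `k` entries, each a keyword of some update with a hash of
    -- fixed length.
    (fun x k mh => mh.length ≤ k ∧ ∀ e ∈ mh, esize e ≤
      esize (A.graph (vInp x)) + (3 * P.MH.outLen x.1.length + 1) + 1)
    (fun x => by simp) ?_
    (B := fun x => esize (A.graph (vInp x)) * (esize (A.graph (vInp x)) +
      (3 * P.MH.outLen x.1.length + 1) + 1 + 1) + 1) (by fun_prop) ?_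
  · rintro x k G G' E t mh ht - ⟨h1, h2⟩
    refine ⟨(length_put_le _ _ _).trans (Nat.succ_le_succ h1), fun e he => ?_⟩
    rcases mem_put he with he | rfl
    · exact h2 e he
    · have e1 := esize_lt_of_mem ht
      have e2 := esize_bits (P.postingHash x.1.length x.2.2.1.1 G' t.1)
      rw [postingHash, P.MH.hash_length] at e2
      rw [show t = (t.1, t.2) from rfl, esize_pair] at e1
      rw [esize_pair, postingHash]
      omega
  · rintro x k mh hk ⟨h1, h2⟩
    refine (esize_le_of_forall h2).trans ?_
    have := length_le_esize (A.graph (vInp x))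
    gcongr
    omega

theorem polyTime_vQuery {α : Type} [Enc α] {x : α → VInput} {s : α → SimState (List (Bits × Bits))}
    (hx : PolyTime x) (hs : PolyTime s) :
    PolyTime fun y => A.query (vInp (x y), vSimView (s y)) := by
  have h1 := polyTime_vInp.comp hx
  have h2 : PolyTime fun y => vSimView (s y) := by
    unfold vSimView
    fun_prop
  exact A.query_poly.comp (h1.prodMk h2)

theorem polyTime_vStags {α : Type} [Enc α] {x : α → VInput} {s : α → SimState (List (Bits × Bits))}
    (hx : PolyTime x) (hs : PolyTime s) :
    PolyTime fun y => P.vStags A (x y) (s y) := by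
  have h0 := polyTime_vQuery A hx hs
  have h1 := A.graph_poly.comp (polyTime_vInp.comp hx)
  unfold vStags
  fun_prop

theorem polyTime_vMultisets : PolyTime (P.vMultisets A) := by
  have h0 := P.polyTime_vSim A
  have hx : PolyTime fun p : VInput × SimState (List (Bits × Bits)) => p.1 := by fun_prop
  have hs : PolyTime fun p : VInput × SimState (List (Bits × Bits)) => p.2 := by fun_prop
  have h1 := polyTime_vQuery A hx hs
  have h2 := P.polyTime_vStags A hx hs
  have h3 : PolyTime fun p : VInput × SimState (List (Bits × Bits)) => (vInp p.1, vSimView p.2) := by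
    have := polyTime_vInp.comp hx
    unfold vSimView
    fun_prop
  have h4 := A.posting_poly.comp (h3.prodMk h2)
  refine PolyTime.option_elim h0 (by fun_prop) ?_
  fun_prop

theorem polyTime_vFilters : PolyTime (P.vFilters A) := by
  have h0 := P.polyTime_vSim A
  have hx : PolyTime fun p : VInput × SimState (List (Bits × Bits)) => p.1 := by fun_prop
  have hs : PolyTime fun p : VInput × SimState (List (Bits × Bits)) => p.2 := by fun_prop
  have h1 := polyTime_vQuery A hx hs
  have h2 := P.polyTime_vStags A hx hs
  have h3 : PolyTime fun p : VInput × SimState (List (Bits × Bits)) => (vInp p.1, vSimView p.2) := by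
    have := polyTime_vInp.comp hx
    unfold vSimView
    fun_prop
  have h4 := A.posting_poly.comp (h3.prodMk h2)
  refine PolyTime.option_elim h0 (by fun_prop) (P.polyTime_filterPair (by fun_prop) (by fun_prop)
    (by fun_prop) (by fun_prop) (by fun_prop) h1 h4 ?_)
  have h5 := (h3.prodMk h2).comp (f := fun p : (VInput × SimState (List (Bits × Bits))) × List Bits =>
    p.1) (by fun_prop)
  exact A.subFilter_poly.comp (h5.prodMk (by fun_prop))

theorem polyTime_vGraphQuery : PolyTime (P.vGraphQuery A) := by
  have h0 := P.polyTime_vSim A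
  have h1 := polyTime_vQuery A (x := fun p : VInput × SimState (List (Bits × Bits)) => p.1)
    (s := fun p => p.2) (by fun_prop) (by fun_prop)
  refine PolyTime.option_elim h0 (by fun_prop) ?_
  fun_prop

/-- The simulation reaches the state of the game, so the adversary's later algorithms receive the
same view in both. -/
theorem vGame_eq_some {lam : ℕ} {coins : Bits} {pub : VPub} {K : Keys} {G : Graph} {q : Query}
    {R : List Bits} (h : P.vGame A lam coins pub K = some (G, q, R)) :
    ∃ st : VState, P.vSim A (unary lam, coins, pub, K) = some (G, st.enc, st.srv, st.mh) ∧
      P.Represents lam pub.2 G st.enc st.srv ∧ P.GraphLengths lam G ∧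
      (∀ w, (st.mh.lookup w).getD (P.MH.hash lam pub.1 0) = P.postingHash lam pub.1 G w) ∧
      q = A.query ((unary lam, coins, pub), st.view) ∧
      P.vSearch lam pub K st q (fun sl => A.posting (((unary lam, coins, pub), st.view), sl))
        (fun sl ids => A.subFilter ((((unary lam, coins, pub), st.view), sl), ids)) = some R := by
  unfold vGame at h
  obtain ⟨G', hG, h⟩ := Option.bind_eq_some_iff.1 h
  obtain ⟨st, hst, h⟩ := Option.bind_eq_some_iff.1 h
  obtain ⟨R', hR, h⟩ := Option.bind_eq_some_iff.1 h
  cases h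
  obtain ⟨h1, h2, h3, h4⟩ := vUpdate_simulate represents_init (fun e he => by cases he)
    (fun w => rfl) hG hst
  refine ⟨st, ?_, h2, h3, h4, rfl, hR⟩
  simp only [vSim, simulate, vInp]
  rw [show (unary lam).length = lam by simp [unary]]
  exact h1

theorem vSim_cnt_le {x : VInput} {s : SimState (List (Bits × Bits))} (h : P.vSim A x = some s)
    {w : Bits} {c : ℕ} (hc : s.2.1.cnt.lookup w = some c) : c ≤ (A.graph (vInp x)).length :=
  ((P.simulate_bdd (T := esize (A.graph (vInp x))) (I := fun _ _ => True)
    (fun _ ht => (esize_lt_of_mem ht).le) trivial (fun _ _ _ _ _ _ _ _ _ => trivial) h).1.cnt_size _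
    (mem_of_lookup_eq_some hc)).2

theorem vGame_collision {lam : ℕ} {coins : Bits} {pub : VPub} {K : Keys}
    (h : Wrong (P.filterResult lam) (P.vGame A lam coins pub K)) :
    (((P.vMultisets A (unary lam, coins, pub, K)).1 : Multiset Bits) ≠
        (P.vMultisets A (unary lam, coins, pub, K)).2 ∧
      P.MH.hash lam pub.1 ((P.vMultisets A (unary lam, coins, pub, K)).1 : Multiset Bits) =
        P.MH.hash lam pub.1 ((P.vMultisets A (unary lam, coins, pub, K)).2 : Multiset Bits)) ∨
    ((P.vFilters A (unary lam, coins, pub, K)).1 ≠ (P.vFilters A (unary lam, coins, pub, K)).2 ∧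
      P.H3.hash lam pub.2 (P.vFilters A (unary lam, coins, pub, K)).1 =
        P.H3.hash lam pub.2 (P.vFilters A (unary lam, coins, pub, K)).2) := by
  obtain ⟨G, q, R, hgame, hwrong⟩ := h
  obtain ⟨st, hsim, hrep, hlen, hmh, hq, hR⟩ := P.vGame_eq_some A hgame
  unfold vSearch at hR
  cases hc : st.enc.cnt.lookup q.1 with
  | none =>
    rw [hc] at hR
    cases hR
    exact absurd hwrong (P.not_wrong_of_lookup_eq_none hrep hc)
  | some c =>
    rw [hc] at hR
    simp only [Option.bind_eq_bind, guard_bind] at hR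
    obtain ⟨pl, hpl, hR⟩ := Option.bind_eq_some_iff.1 hR
    obtain ⟨hh, hlook, hR⟩ := Option.bind_eq_some_iff.1 hR
    split_ifs at hR with hhash
    have hhash' : P.hashPL lam pub.1 pl = P.postingHash lam pub.1 G q.1 := by
      rw [hhash, ← hmh, hlook, Option.getD_some]
    have hu : (unary lam).length = lam := by simp [unary]
    -- The request must be the same as in the game: the counter is at most the number of updates, so
    -- the bounded enumeration is complete.
    have hst : P.vStags A (unary lam, coins, pub, K) (G, st.enc, st.srv, st.mh) =
        P.stagList lam K q.1 c := by
      have hcle := P.vSim_cnt_le A hsim hc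
      subst hq
      unfold vStags
      rw [← P.boundedStagList_eq hcle, hu]
      dsimp only
      rw [show A.query (vInp (unary lam, coins, pub, K), vSimView (G, st.enc, st.srv, st.mh)) =
        A.query ((unary lam, coins, pub), st.view) from rfl, hc]
      rfl
    have := P.collision_of_wrong hrep hlen hc hpl hhash' hR hwrong
    unfold vMultisets vFilters
    rw [hsim, Option.elim_some, Option.elim_some, hst]
    dsimp only
    rw [hu]
    subst hq
    exact this

end VSecGraph

end Primitives

/-! ## Arithmetic of the RSA accumulator -/

/-- The conditions on `(p, q, g)` that hold except with negligible probability. -/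
def RSAAccumulator.Safe (K : RSAAccumulator) (lam : ℕ) (k : ℕ × ℕ × ℕ) : Prop :=
  k.1.Prime ∧ k.2.1.Prime ∧ k.1 ≠ k.2.1 ∧ ((k.1 - 1) / 2).Prime ∧ ((k.2.1 - 1) / 2).Prime ∧
    k.2.2.Coprime (k.1 * k.2.1) ∧
    ∀ s x, K.rep lam s x ≠ 2 ∧ K.rep lam s x < (k.1 - 1) / 2 ∧ K.rep lam s x < (k.2.1 - 1) / 2

/-- `p - 1` is twice a prime, and `x` is a prime different from both factors. -/
theorem coprime_pred_of_safe_prime {p x : ℕ} (hp : p.Prime) (hp' : ((p - 1) / 2).Prime)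
    (hx : x.Prime) (h2 : x ≠ 2) (hlt : x < (p - 1) / 2) : x.Coprime (p - 1) := by
  have hodd : p - 1 = 2 * ((p - 1) / 2) := by
    rcases hp.eq_two_or_odd with rfl | h
    -- `p = 2` is excluded because `(2 - 1) / 2 = 0` is not prime.
    · norm_num at hp'
    · omega
  rw [hodd]
  exact Nat.Coprime.mul_right ((Nat.coprime_primes hx Nat.prime_two).2 h2)
    ((Nat.coprime_primes hx hp').2 hlt.ne)

theorem RSAAccumulator.Safe.coprime {K : RSAAccumulator} {lam : ℕ} {k : ℕ × ℕ × ℕ}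
    (h : K.Safe lam k) (s x : Bits) : (K.rep lam s x).Coprime ((k.1 - 1) * (k.2.1 - 1)) := by
  obtain ⟨hp, hq, -, hp', hq', -, hrep⟩ := h
  obtain ⟨h2, h3, h4⟩ := hrep s x
  exact Nat.Coprime.mul_right (coprime_pred_of_safe_prime hp hp' (K.rep_prime _ _ _) h2 h3)
    (coprime_pred_of_safe_prime hq hq' (K.rep_prime _ _ _) h2 h4)

/-- Euler's theorem: the larger exponent exceeds the smaller by a multiple of `φ(n)`. -/
theorem pow_modEq_pow_of_modEq_totient {a n i j : ℕ} (ha : a.Coprime n)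
    (h : i ≡ j [MOD n.totient]) : a ^ i ≡ a ^ j [MOD n] := by
  wlog hij : i ≤ j generalizing i j
  · exact (this h.symm (le_of_not_ge hij)).symm
  obtain ⟨m, hm⟩ := (Nat.modEq_iff_dvd' hij).1 h
  have h1 : a ^ j = a ^ i * (a ^ n.totient) ^ m := by
    rw [← pow_mul, ← hm, ← pow_add, Nat.add_sub_cancel' hij]
  rw [h1]
  have h2 := ((Nat.ModEq.pow_totient ha).pow m).mul_left (a ^ i)
  rw [one_pow, mul_one] at h2
  exact h2.symm

theorem accInsert_pow (n g x y : ℕ) : accInsert n x (g ^ y % n) = g ^ (y * x) % n := by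
  rw [accInsert, ← Nat.pow_mod, pow_mul]

/-- The exponent of `accDelete` inverts `x` modulo `φ(p q)`, and `g` is a unit; so the factor `x`
cancels in the exponent of `g`. -/
theorem accDelete_pow {p q g x y : ℕ} (hp : p.Prime) (hq : q.Prime) (hpq : p ≠ q)
    (hg : g.Coprime (p * q)) (hx : x.Coprime ((p - 1) * (q - 1))) :
    accDelete p q x (g ^ (y * x) % (p * q)) = g ^ y % (p * q) := by
  have hp1 := hp.one_lt
  have hq1 := hq.one_lt
  have : NeZero ((p - 1) * (q - 1)) := ⟨by
    rw [Nat.mul_ne_zero_iff]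
    omega⟩
  rw [accDelete, ← Nat.pow_mod, ← pow_mul, mul_assoc, pow_mul]
  have htot : (p * q).totient = (p - 1) * (q - 1) := by
    rw [Nat.totient_mul ((Nat.coprime_primes hp hq).2 hpq), Nat.totient_prime hp,
      Nat.totient_prime hq]
  have key : x * ((x : ZMod ((p - 1) * (q - 1)))⁻¹).val ≡ 1 [MOD (p * q).totient] := by
    rw [htot, ← ZMod.natCast_eq_natCast_iff, Nat.cast_mul, ZMod.natCast_zmod_val,
      ZMod.coe_mul_inv_eq_one _ hx, Nat.cast_one]
  have h := pow_modEq_pow_of_modEq_totient (hg.pow_left y) key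
  rwa [pow_one] at h

@[fun_prop]
theorem PolyTime.list_prod {α : Type} [Enc α] {l : α → List ℕ} (hl : PolyTime l) :
    PolyTime fun x => (l x).prod := by
  refine (PolyTime.foldl_of_add (init := fun _ => 1) (step := fun _ s b => s * b) (by fun_prop) hl
    (by fun_prop) (B := fun x => esize (l x)) (by fun_prop) ?_).congr fun x => ?_
  · intro x s b hb
    have h1 := Nat.size_mul_le s b
    have h2 := esize_lt_of_mem hb
    rw [esize_nat] at h2 ⊢
    rw [esize_nat]
    omega
  · rw [List.prod_eq_foldl]

/-! ## Groups of keywords -/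

namespace Primitives

variable (P : Primitives) {α : Type} [Enc α]

/-- The keywords of the group `j`. -/
def groupKeys (keys : List Bits) (j : ℕ) : List Bits :=
  keys.filter fun w => keys.idxOf w / P.groupSize == j

/-- The string that is accumulated for a keyword. -/
def accString (lam : ℕ) (sM s4 : Bits) (G : Graph) (w : Bits) : Bits :=
  P.H4.hash lam s4 w ++ P.postingHash lam sM G w

/-- The product of the primes of the group `j`. -/
def groupProduct (lam : ℕ) (seeds : Bits × Bits × Bits × Bits) (G : Graph) (keys : List Bits) (j : ℕ) :
    ℕ :=
  ((P.groupKeys keys j).map fun w =>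
    P.Acc.rep lam seeds.2.2.2 (P.accString lam seeds.1 seeds.2.2.1 G w)).prod

theorem mem_groupKeys {keys : List Bits} {j : ℕ} {w : Bits} :
    w ∈ P.groupKeys keys j ↔ w ∈ keys ∧ keys.idxOf w / P.groupSize = j := by
  simp [groupKeys]

/-- Old keywords keep their positions. The new one gets the position `keys.length`, which is what
`idxOf` returns before its insertion too, so the group computed beforehand remains valid. -/
theorem groupKeys_append {keys : List Bits} {w : Bits} (hw : w ∉ keys) (j : ℕ) :
    P.groupKeys (keys ++ [w]) j =
      P.groupKeys keys j ++ if keys.idxOf w / P.groupSize = j then [w] else [] := by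
  unfold groupKeys
  rw [List.filter_append]
  congr 1
  · refine List.filter_congr fun v hv => ?_
    rw [List.idxOf_append_of_mem hv]
  · simp [List.filter_cons, List.idxOf_append_of_notMem hw, List.idxOf_eq_length hw]

theorem accString_of_ne {lam : ℕ} {sM s4 : Bits} {G G' : Graph} {t : Token}
    (h : P.graphStep lam G t = some G') {w : Bits} (hw : w ≠ t.1) :
    P.accString lam sM s4 G' w = P.accString lam sM s4 G w := by
  rw [accString, accString, P.postingHash_of_ne h hw]

theorem groupProduct_of_not_mem {lam : ℕ} {seeds : Bits × Bits × Bits × Bits} {G G' : Graph}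
    {t : Token} (h : P.graphStep lam G t = some G') {keys : List Bits} {j : ℕ}
    (hw : t.1 ∉ P.groupKeys keys j) :
    P.groupProduct lam seeds G' keys j = P.groupProduct lam seeds G keys j := by
  unfold groupProduct
  congr 1
  refine List.map_congr_left fun w hw' => ?_
  rw [P.accString_of_ne h]
  rintro rfl
  exact hw hw'

theorem groupProduct_append {lam : ℕ} {seeds : Bits × Bits × Bits × Bits} {G G' : Graph}
    {t : Token} (h : P.graphStep lam G t = some G') {keys : List Bits} (hw : t.1 ∉ keys) (j : ℕ) :
    P.groupProduct lam seeds G' (keys ++ [t.1]) j =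
      if keys.idxOf t.1 / P.groupSize = j then P.groupProduct lam seeds G keys j *
        P.Acc.rep lam seeds.2.2.2 (P.accString lam seeds.1 seeds.2.2.1 G' t.1)
      else P.groupProduct lam seeds G keys j := by
  rw [← P.groupProduct_of_not_mem h (fun hmem => hw (P.mem_groupKeys.1 hmem).1)]
  unfold groupProduct
  rw [P.groupKeys_append hw]
  split_ifs <;> simp

/-- `y` is the product over the other keywords of the group, whose posting lists the update does not
touch. As there are no repetitions, the keyword itself contributes exactly one factor. -/
theorem groupProduct_of_mem {lam : ℕ} {seeds : Bits × Bits × Bits × Bits} {G G' : Graph}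
    {t : Token} (h : P.graphStep lam G t = some G') {keys : List Bits} (hnd : keys.Nodup)
    (hw : t.1 ∈ keys) :
    ∃ y, P.groupProduct lam seeds G keys (keys.idxOf t.1 / P.groupSize) =
        y * P.Acc.rep lam seeds.2.2.2 (P.accString lam seeds.1 seeds.2.2.1 G t.1) ∧
      P.groupProduct lam seeds G' keys (keys.idxOf t.1 / P.groupSize) =
        y * P.Acc.rep lam seeds.2.2.2 (P.accString lam seeds.1 seeds.2.2.1 G' t.1) := by
  have hmem : t.1 ∈ P.groupKeys keys (keys.idxOf t.1 / P.groupSize) := P.mem_groupKeys.2 ⟨hw, rfl⟩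
  have hperm := List.perm_cons_erase hmem
  have hne : ∀ w ∈ (P.groupKeys keys (keys.idxOf t.1 / P.groupSize)).erase t.1, w ≠ t.1 :=
    fun w hw' => ((hnd.filter _).mem_erase_iff.1 hw').1
  refine ⟨(((P.groupKeys keys (keys.idxOf t.1 / P.groupSize)).erase t.1).map fun w =>
    P.Acc.rep lam seeds.2.2.2 (P.accString lam seeds.1 seeds.2.2.1 G w)).prod, ?_, ?_⟩
  · rw [groupProduct, (hperm.map _).prod_eq, List.map_cons, List.prod_cons, mul_comm]
  · rw [groupProduct, (hperm.map _).prod_eq, List.map_cons, List.prod_cons, mul_comm]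
    congr 2
    refine List.map_congr_left fun w hw' => ?_
    rw [P.accString_of_ne h (hne w hw')]

theorem groupProduct_nil (lam : ℕ) (seeds : Bits × Bits × Bits × Bits) (G : Graph) (j : ℕ) :
    P.groupProduct lam seeds G [] j = 1 := rfl

@[fun_prop]
theorem polyTime_groupKeys {keys : α → List Bits} {j : α → ℕ} (hk : PolyTime keys) (hj : PolyTime j) :
    PolyTime fun x => P.groupKeys (keys x) (j x) := by
  unfold groupKeys
  fun_prop

@[fun_prop]
theorem polyTime_accString {u sM s4 w : α → Bits} {G : α → Graph} (hu : PolyTime u)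
    (hM : PolyTime sM) (h4 : PolyTime s4) (hG : PolyTime G) (hw : PolyTime w) :
    PolyTime fun x => P.accString (u x).length (sM x) (s4 x) (G x) (w x) := by
  unfold accString
  fun_prop

@[fun_prop]
theorem polyTime_groupProduct {u : α → Bits} {seeds : α → Bits × Bits × Bits × Bits} {G : α → Graph}
    {keys : α → List Bits} {j : α → ℕ} (hu : PolyTime u) (hs : PolyTime seeds) (hG : PolyTime G)
    (hk : PolyTime keys) (hj : PolyTime j) :
    PolyTime fun x => P.groupProduct (u x).length (seeds x) (G x) (keys x) (j x) := by
  unfold groupProduct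
  fun_prop

/-- A bound for the size of the primes. -/
theorem exists_rep_bdd {u : α → Bits} {seeds : α → Bits × Bits × Bits × Bits} (hu : PolyTime u)
    (hs : PolyTime seeds) : ∃ B : α → ℕ, PolyBdd B ∧ ∀ x G w,
      (P.Acc.rep (u x).length (seeds x).2.2.2
        (P.accString (u x).length (seeds x).1 (seeds x).2.2.1 G w)).size ≤ B x := by
  obtain ⟨q, hq⟩ := P.Acc.rep_poly.size_bdd
  have h4 := P.H4.polyBdd_outLen [] hu
  have hM := P.MH.polyBdd_outLen hu
  refine ⟨fun x => q.eval (esize (u x) + esize (seeds x) +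
    (3 * (P.H4.outLen (u x).length + P.MH.outLen (u x).length) + 1) + 2), by fun_prop, fun x G w => ?_⟩
  have h1 := hq (u x, (seeds x).2.2.2,
    P.accString (u x).length (seeds x).1 (seeds x).2.2.1 G w)
  have h2 := esize_bits (P.accString (u x).length (seeds x).1 (seeds x).2.2.1 G w)
  rw [accString, List.length_append, P.H4.hash_length, postingHash, P.MH.hash_length] at h2
  rw [esize_nat] at h1
  refine (Nat.le_succ _).trans (h1.trans (q.eval_mono_nat ?_))
  rw [show seeds x = ((seeds x).1, (seeds x).2.1, (seeds x).2.2.1, (seeds x).2.2.2) from rfl]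
  simp only [esize_pair] at h2 ⊢
  rw [accString, postingHash]
  omega

theorem size_groupProduct_le {lam B : ℕ} {seeds : Bits × Bits × Bits × Bits} {G : Graph}
    (hB : ∀ w, (P.Acc.rep lam seeds.2.2.2 (P.accString lam seeds.1 seeds.2.2.1 G w)).size ≤ B)
    (keys : List Bits) (j : ℕ) : (P.groupProduct lam seeds G keys j).size ≤ keys.length * B + 1 := by
  have key : ∀ l : List Bits, ((l.map fun w =>
      P.Acc.rep lam seeds.2.2.2 (P.accString lam seeds.1 seeds.2.2.1 G w)).prod).size ≤
        l.length * B + 1 := by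
    intro l
    induction l with
    | nil => simp
    | cons w l ih =>
      rw [List.map_cons, List.prod_cons, List.length_cons, add_mul, one_mul]
      refine (Nat.size_mul_le _ _).trans ?_
      have := hB w
      omega
  refine (key _).trans ?_
  gcongr
  exact List.length_filter_le _ _

end Primitives

/-! ## Simulation of VSecGraph-A -/

namespace Primitives

variable (P : Primitives) {α : Type} [Enc α]

-- Both kinds of update `put` a counter. The value `0` is a dummy, since the keys do not depend on
-- it.
variable {P} in
theorem map_fst_cnt_of_coreUpdate {lam : ℕ} {s3 : Bits} {K : Keys} {E E' : Enclave} {S S' : Server}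
    {t : Token} (h : P.coreUpdate lam s3 K E S t = some (E', S')) :
    E'.cnt.map Prod.fst = (put E.cnt t.1 0).map Prod.fst := by
  rw [coreUpdate_eq] at h
  obtain ⟨l, hl, h⟩ := Option.bind_eq_some_iff.1 h
  obtain ⟨sf, hsf, h⟩ := Option.bind_eq_some_iff.1 h
  split_ifs at h with h1 h2
  · obtain ⟨new, hnew, h⟩ := Option.map_eq_some_iff.1 h
    cases h
    rw [map_fst_put, map_fst_put]
  · obtain ⟨c, hc, h⟩ := Option.bind_eq_some_iff.1 h
    obtain ⟨idE, -, h⟩ := Option.bind_eq_some_iff.1 h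
    obtain ⟨y, -, h⟩ := Option.bind_eq_some_iff.1 h
    split_ifs at h
    obtain ⟨stagE, -, h⟩ := Option.bind_eq_some_iff.1 h
    obtain ⟨z, -, h⟩ := Option.bind_eq_some_iff.1 h
    split_ifs at h
    cases h
    rw [map_fst_put, map_fst_put]

/-- Accumulation values, `M_h` and products. -/
abbrev AData := List (ℕ × ℕ) × List (Bits × Bits) × List (ℕ × ℕ)

/-- Update of these data in the simulation, without the factors of `n`. -/
def aUpd (lam : ℕ) (pub : APub) (_ G' : Graph) (E : Enclave) (t : Token) (d : AData) : AData :=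
  (put d.1 (P.group E t.1) (powMod pub.2.2
      (P.groupProduct lam pub.1 G' ((put E.cnt t.1 0).map Prod.fst) (P.group E t.1)) pub.2.1),
    put d.2.1 (P.H4.hash lam pub.1.2.2.1 t.1) (P.postingHash lam pub.1.1 G' t.1),
    put d.2.2 (P.group E t.1)
      (P.groupProduct lam pub.1 G' ((put E.cnt t.1 0).map Prod.fst) (P.group E t.1)))

/-- The state represents the graph `G`. -/
structure ARepresents (lam : ℕ) (pub : APub) (G : Graph) (st : AState) : Prop where
  core : P.Represents lam pub.1.2.1 G st.enc st.srv
  lengths : P.GraphLengths lam G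
  nodup : (st.enc.cnt.map Prod.fst).Nodup
  mh : ∀ w ∈ st.enc.cnt.map Prod.fst,
    st.mh.lookup (P.H4.hash lam pub.1.2.2.1 w) = some (P.postingHash lam pub.1.1 G w)
  xp : ∀ j, (st.xp.lookup j).getD 1 = P.groupProduct lam pub.1 G (st.enc.cnt.map Prod.fst) j
  ac : ∀ j, acOf pub st j =
    pub.2.2 ^ P.groupProduct lam pub.1 G (st.enc.cnt.map Prod.fst) j % pub.2.1

variable {P}

theorem aRepresents_init (lam : ℕ) (pub : APub) :
    P.ARepresents lam pub [] ⟨P.initEnclave lam pub.1.2.1, [], initServer, [], []⟩ where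
  core := represents_init
  lengths := fun e he => by cases he
  nodup := List.nodup_nil
  mh := fun w hw => by cases hw
  xp := fun j => rfl
  ac := fun j => by
    rw [initEnclave, List.map_nil, groupProduct_nil, pow_one]
    rfl

theorem Represents.postingHash_eq {lam : ℕ} {s3 sM : Bits} {G : Graph} {E : Enclave} {S : Server}
    (h : P.Represents lam s3 G E S) {w : Bits} (hw : E.cnt.lookup w = none) :
    P.postingHash lam sM G w = P.MH.hash lam sM 0 := by
  have : postingList G w = [] := by
    rw [postingList, List.map_eq_nil_iff, List.filter_eq_nil_iff]
    intro e he heq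
    have := h.cnt_isSome e he
    rw [eq_of_beq heq, hw] at this
    cases this
  rw [postingHash, this]
  rfl

/-- `hinj` protects the hashes of the other keywords: under a shared value of `H4`, the update of
`M_h` would overwrite them. Other groups are unaffected, since keywords never change their groups.
-/
theorem ARepresents.mk_of_update {lam : ℕ} {pub : APub} {G G' : Graph} {st : AState} {t : Token}
    (h : P.ARepresents lam pub G st) {K : Keys} {E : Enclave} {S : Server}
    (hG : P.graphStep lam G t = some G')
    (hcore : P.coreUpdate lam pub.1.2.1 K st.enc st.srv t = some (E, S))
    (hinj : ∀ w ∈ E.cnt.map Prod.fst, P.H4.hash lam pub.1.2.2.1 w = P.H4.hash lam pub.1.2.2.1 t.1 →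
      w = t.1) :
    P.ARepresents lam pub G' ⟨E,
      put st.ac (P.group st.enc t.1) (pub.2.2 ^
        P.groupProduct lam pub.1 G' (E.cnt.map Prod.fst) (P.group st.enc t.1) % pub.2.1), S,
      put st.mh (P.H4.hash lam pub.1.2.2.1 t.1) (P.postingHash lam pub.1.1 G' t.1),
      put st.xp (P.group st.enc t.1)
        (P.groupProduct lam pub.1 G' (E.cnt.map Prod.fst) (P.group st.enc t.1))⟩ := by
  have hkeys := map_fst_cnt_of_coreUpdate hcore
  rw [map_fst_put] at hkeys
  have hother : ∀ j ≠ P.group st.enc t.1, P.groupProduct lam pub.1 G' (E.cnt.map Prod.fst) j =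
      P.groupProduct lam pub.1 G (st.enc.cnt.map Prod.fst) j := by
    intro j hj
    rw [hkeys]
    split_ifs with hmem
    · exact P.groupProduct_of_not_mem hG fun h' => hj (P.mem_groupKeys.1 h').2.symm
    · rw [P.groupProduct_append hG hmem, if_neg fun h' => hj h'.symm]
  refine ⟨h.core.coreUpdate hG hcore, h.lengths.graphStep hG, ?_, ?_, ?_, ?_⟩
  · rw [hkeys]
    split_ifs with hmem
    · exact h.nodup
    · rw [List.nodup_append]
      refine ⟨h.nodup, List.nodup_singleton _, ?_⟩
      rintro a ha b hb rfl
      exact hmem (List.mem_singleton.1 hb ▸ ha)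
  · intro w hw
    dsimp only at hw ⊢
    rw [lookup_put]
    split_ifs with heq
    · rw [hinj w hw heq]
    · have hne : w ≠ t.1 := fun h' => heq (h' ▸ rfl)
      rw [P.postingHash_of_ne hG hne]
      refine h.mh w ?_
      rw [hkeys] at hw
      split_ifs at hw with hmem
      · exact hw
      · exact (List.mem_append.1 hw).resolve_right fun h' => hne (List.mem_singleton.1 h')
  · intro j
    dsimp only
    rw [lookup_put]
    split_ifs with hj
    · rw [hj, Option.getD_some]
    · rw [h.xp, hother j hj]
  · intro j
    unfold acOf
    dsimp only
    rw [lookup_put]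
    split_ifs with hj
    · rw [hj, Option.getD_some]
    · rw [hother j hj]
      exact h.ac j

/-- The server's division by the old prime is exact, and the enclave's deletion and insertion turn
`g` to the old product into `g` to the new one. So the honest state agrees with the one that is
computed from the graph, `n` and `g`, without `p` and `q`. -/
theorem ARepresents.update {lam : ℕ} {seeds : Bits × Bits × Bits × Bits} {pqg : ℕ × ℕ × ℕ}
    {G G' : Graph} {st st' : AState} {t : Token} {K : Keys}
    (h : P.ARepresents lam (seeds, pqg.1 * pqg.2.1, pqg.2.2) G st) (hsafe : P.Acc.Safe lam pqg)
    (hG : P.graphStep lam G t = some G')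
    (hinj : ∀ w ∈ t.1 :: st.enc.cnt.map Prod.fst,
      P.H4.hash lam seeds.2.2.1 w = P.H4.hash lam seeds.2.2.1 t.1 → w = t.1)
    (hst : P.aUpdate lam (seeds, pqg.1 * pqg.2.1, pqg.2.2) (pqg.1, pqg.2.1) K st t = some st') :
    P.ARepresents lam (seeds, pqg.1 * pqg.2.1, pqg.2.2) G' st' ∧
      P.simStep lam seeds.2.1 K (P.aUpd lam (seeds, pqg.1 * pqg.2.1, pqg.2.2))
        (some (G, st.enc, st.srv, st.ac, st.mh, st.xp)) t =
      some (G', st'.enc, st'.srv, st'.ac, st'.mh, st'.xp) ∧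
      st'.enc.cnt.map Prod.fst ⊆ t.1 :: st.enc.cnt.map Prod.fst := by
  set pub : APub := (seeds, pqg.1 * pqg.2.1, pqg.2.2) with hpub
  obtain ⟨⟨E, S⟩, hcore, hst⟩ := Option.bind_eq_some_iff.1 hst
  have hkeys := map_fst_cnt_of_coreUpdate hcore
  have hsub : E.cnt.map Prod.fst ⊆ t.1 :: st.enc.cnt.map Prod.fst := by
    rw [hkeys, map_fst_put]
    intro w hw
    split_ifs at hw with hmem
    · exact List.mem_cons_of_mem _ hw
    · simpa [or_comm] using hw
  have hinj' := fun w hw => hinj w (hsub hw)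
  suffices hst' : st' = ⟨E,
      put st.ac (P.group st.enc t.1) (pub.2.2 ^
        P.groupProduct lam pub.1 G' (E.cnt.map Prod.fst) (P.group st.enc t.1) % pub.2.1), S,
      put st.mh (P.H4.hash lam pub.1.2.2.1 t.1) (P.postingHash lam pub.1.1 G' t.1),
      put st.xp (P.group st.enc t.1)
        (P.groupProduct lam pub.1 G' (E.cnt.map Prod.fst) (P.group st.enc t.1))⟩ by
    subst hst'
    refine ⟨h.mk_of_update hG hcore hinj', ?_, hsub⟩
    have hn : pqg.1 * pqg.2.1 ≠ 0 := (Nat.mul_pos hsafe.1.pos hsafe.2.1.pos).ne'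
    simp only [simStep, Option.bind_some, hG]
    rw [show seeds.2.1 = pub.1.2.1 from rfl, hcore, Option.map_some]
    dsimp only
    rw [aUpd, ← hkeys, powMod, if_neg hn]
  dsimp only at hst
  have hstep := P.hashStep_postingHash (sM := seeds.1) hG
  have hac : ∀ j, acOf pub st j = pqg.2.2 ^ P.groupProduct lam seeds G (st.enc.cnt.map Prod.fst) j %
    (pqg.1 * pqg.2.1) := h.ac
  have hxp : ∀ j, (st.xp.lookup j).getD 1 =
    P.groupProduct lam seeds G (st.enc.cnt.map Prod.fst) j := h.xp
  cases hc : st.enc.cnt.lookup t.1 with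
  | none =>
    have hmem := lookup_eq_none_iff_not_mem.1 hc
    rw [h.core.postingHash_eq hc] at hstep
    have hprod := P.groupProduct_append (lam := lam) (seeds := seeds) hG hmem
      (P.group st.enc t.1)
    rw [if_pos (show (st.enc.cnt.map Prod.fst).idxOf t.1 / P.groupSize = P.group st.enc t.1
      from rfl)] at hprod
    rw [hc] at hst
    dsimp only at hst
    rw [hstep, hac, hxp, accInsert_pow, ← accString] at hst
    have hk' : E.cnt.map Prod.fst = st.enc.cnt.map Prod.fst ++ [t.1] := by
      rw [hkeys, map_fst_put, if_neg hmem]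
    rw [hk']
    rw [show pub.1 = seeds from rfl, hprod]
    exact (Option.some.inj hst).symm
  | some c =>
    have hmem : t.1 ∈ st.enc.cnt.map Prod.fst := lookup_isSome_iff_mem.1 (by rw [hc]; rfl)
    rw [hc] at hst
    dsimp only at hst
    rw [h.mh _ hmem] at hst
    simp only [Option.bind_eq_bind, Option.bind_some, guard_bind] at hst
    split_ifs at hst
    obtain ⟨y, hy, hy'⟩ := P.groupProduct_of_mem (lam := lam) (seeds := seeds) hG h.nodup hmem
    have hk' : E.cnt.map Prod.fst = st.enc.cnt.map Prod.fst := by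
      rw [hkeys, map_fst_put, if_pos hmem]
    change P.groupProduct lam seeds G _ (P.group st.enc t.1) = _ at hy
    change P.groupProduct lam seeds G' _ (P.group st.enc t.1) = _ at hy'
    have hpos : 0 < P.Acc.rep lam seeds.2.2.2 (P.accString lam seeds.1 seeds.2.2.1 G t.1) :=
      (P.Acc.rep_prime _ _ _).pos
    rw [hstep, hac, hxp, ← accString, ← accString, hy, Nat.mul_div_cancel _ hpos,
      accDelete_pow hsafe.1 hsafe.2.1 hsafe.2.2.1 hsafe.2.2.2.2.2.1 (hsafe.coprime _ _),
      accInsert_pow, ← hy'] at hst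
    rw [hk']
    exact (Option.some.inj hst).symm

/-- `W` is to contain all keywords of the whole update sequence, so that injectivity of `H4` is
assumed once for all steps. -/
theorem aUpdate_simulate {lam : ℕ} {seeds : Bits × Bits × Bits × Bits} {pqg : ℕ × ℕ × ℕ}
    {K : Keys} (hsafe : P.Acc.Safe lam pqg) {W : Set Bits}
    (hinj : Set.InjOn (P.H4.hash lam seeds.2.2.1) W) {ts : List Token} {G₀ G : Graph}
    {st₀ st : AState} (hts : ∀ t ∈ ts, t.1 ∈ W) (hW : ∀ w ∈ st₀.enc.cnt.map Prod.fst, w ∈ W)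
    (h : P.ARepresents lam (seeds, pqg.1 * pqg.2.1, pqg.2.2) G₀ st₀)
    (hG : ts.foldlM (P.graphStep lam) G₀ = some G)
    (hst : ts.foldlM (P.aUpdate lam (seeds, pqg.1 * pqg.2.1, pqg.2.2) (pqg.1, pqg.2.1) K) st₀ =
      some st) :
    ts.foldl (P.simStep lam seeds.2.1 K (P.aUpd lam (seeds, pqg.1 * pqg.2.1, pqg.2.2)))
        (some (G₀, st₀.enc, st₀.srv, st₀.ac, st₀.mh, st₀.xp)) =
      some (G, st.enc, st.srv, st.ac, st.mh, st.xp) ∧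
    P.ARepresents lam (seeds, pqg.1 * pqg.2.1, pqg.2.2) G st ∧
    ∀ w ∈ st.enc.cnt.map Prod.fst, w ∈ W := by
  induction ts generalizing G₀ st₀ with
  | nil =>
    cases hG
    cases hst
    exact ⟨rfl, h, hW⟩
  | cons t ts ih =>
    rw [List.foldlM_cons] at hG hst
    obtain ⟨G₁, hG₁, hG⟩ := Option.bind_eq_some_iff.1 hG
    obtain ⟨st₁, hst₁, hst⟩ := Option.bind_eq_some_iff.1 hst
    have ht := hts t List.mem_cons_self
    have hW' : ∀ w ∈ t.1 :: st₀.enc.cnt.map Prod.fst, w ∈ W := by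
      intro w hw
      rcases List.mem_cons.1 hw with rfl | hw
      · exact ht
      · exact hW w hw
    obtain ⟨h1, h2, h3⟩ := h.update hsafe hG₁ (fun w hw he => hinj (hW' w hw) ht he) hst₁
    rw [List.foldl_cons, h2]
    exact ih (fun t' ht' => hts t' (List.mem_cons_of_mem _ ht')) (fun w hw => hW' w (h3 hw)) h1 hG hst

end Primitives

/-! ## Search for collisions in a list -/

section

variable {α : Type} [Enc α]

/-- Two distinct elements of the list with the same value of `f`, if there are such. -/
def collisionPair (f : Bits → Bits) (l : List Bits) : Bits × Bits :=
  ((l.flatMap fun a => l.map fun b => (a, b)).find? fun p =>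
    decide (p.1 ≠ p.2 ∧ f p.1 = f p.2)).getD ([], [])

theorem collisionPair_spec {f : Bits → Bits} {l : List Bits} {a b : Bits} (ha : a ∈ l) (hb : b ∈ l)
    (hne : a ≠ b) (h : f a = f b) : (collisionPair f l).1 ≠ (collisionPair f l).2 ∧
      f (collisionPair f l).1 = f (collisionPair f l).2 := by
  unfold collisionPair
  cases hp : (l.flatMap fun a => l.map fun b => (a, b)).find? fun p =>
      decide (p.1 ≠ p.2 ∧ f p.1 = f p.2) with
  | none =>
    have h1 := List.find?_eq_none.1 hp (a, b)
      (List.mem_flatMap.2 ⟨a, ha, List.mem_map.2 ⟨b, hb, rfl⟩⟩)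
    exact absurd (decide_eq_true ⟨hne, h⟩) h1
  | some p =>
    have h1 := List.find?_some hp
    exact of_decide_eq_true h1

theorem polyTime_collisionPair {f : α → Bits → Bits} {l : α → List Bits}
    (hf : PolyTime fun p : α × Bits => f p.1 p.2) (hl : PolyTime l) :
    PolyTime fun x => collisionPair (f x) (l x) := by
  have h1 : PolyTime fun p : α × Bits × Bits => f p.1 p.2.1 :=
    hf.comp (f := fun p : α × Bits × Bits => (p.1, p.2.1)) (by fun_prop)
  have h2 : PolyTime fun p : α × Bits × Bits => f p.1 p.2.2 :=
    hf.comp (f := fun p : α × Bits × Bits => (p.1, p.2.2)) (by fun_prop)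
  unfold collisionPair
  fun_prop

end

/-! ## VSecGraph-A -/

namespace Primitives

variable (P : Primitives) (A : Adversary APub AView AAns)

/-- Coins of the adversary, public parameters and keys, with the unary security parameter. -/
abbrev AInput := Bits × Bits × APub × Keys

def aInp (x : AInput) : Bits × Bits × APub := (x.1, x.2.1, x.2.2.1)

def aSim (x : AInput) : Option (SimState AData) :=
  P.simulate x.1.length x.2.2.1.1.2.1 x.2.2.2 (P.aUpd x.1.length x.2.2.1) ([], [], [])
    (A.graph (aInp x))

def aSimView (s : SimState AData) : AView :=
  ((s.2.1.cnt, s.2.1.index, s.2.2.2.1),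
    (s.2.2.1.tset, s.2.2.1.itset, s.2.2.1.xset, s.2.2.2.2.1, s.2.2.2.2.2))

def aQuery (x : AInput) (s : SimState AData) : Query := A.query (aInp x, aSimView s)

def aStags (x : AInput) (s : SimState AData) : List Bits :=
  P.boundedStagList x.1.length x.2.2.2 (aQuery A x s).1 (A.graph (aInp x)).length
    ((s.2.1.cnt.lookup (aQuery A x s).1).getD 0)

def aAnswer (x : AInput) (s : SimState AData) : AAns :=
  A.posting ((aInp x, aSimView s), P.aStags A x s)

/-- Colliding multisets. -/
def aMultisets (x : AInput) : List Bits × List Bits :=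
  (P.aSim A x).elim ([], []) fun s =>
    P.multisetPair x.1.length x.2.2.2 s.1 s.2.1 (aQuery A x s).1 (P.aAnswer A x s).1

/-- Colliding sub-filters. -/
def aFilters (x : AInput) : SubFilter × SubFilter :=
  (P.aSim A x).elim ([], []) fun s =>
    P.filterPair x.1.length x.2.2.1.1.2.1 x.2.2.2 s.2.1 s.2.2.1 (aQuery A x s) (P.aAnswer A x s).1
      fun ids => A.subFilter (((aInp x, aSimView s), P.aStags A x s), ids)

/-- Colliding keywords. -/
def aKeywords (x : AInput) : Bits × Bits :=
  collisionPair (P.H4.hash x.1.length x.2.2.1.1.2.2.1) ((A.graph (aInp x)).map Prod.fst)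

/-- A forgery against the accumulator. -/
def aForgery (x : AInput) : List Bits × Bits × ℕ :=
  (P.aSim A x).elim ([], [], 0) fun s =>
    ((P.groupKeys (s.2.1.cnt.map Prod.fst) (P.group s.2.1 (aQuery A x s).1)).map
      (P.accString x.1.length x.2.2.1.1.1 x.2.2.1.1.2.2.1 s.1),
      P.H4.hash x.1.length x.2.2.1.1.2.2.1 (aQuery A x s).1 ++ (P.aAnswer A x s).2.1,
      (P.aAnswer A x s).2.2)

/-- The final graph and the query. -/
def aGraphQuery (x : AInput) : Graph × Query :=
  (P.aSim A x).elim ([], [], []) fun s => (s.1, aQuery A x s)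

section PolyTime

variable {α : Type} [Enc α]

@[fun_prop]
theorem polyTime_group {E : α → Enclave} {w : α → Bits} (hE : PolyTime E) (hw : PolyTime w) :
    PolyTime fun x => P.group (E x) (w x) := by
  unfold group
  fun_prop

@[fun_prop]
theorem polyTime_aInp {x : α → AInput} (hx : PolyTime x) : PolyTime fun y => aInp (x y) := by
  unfold aInp
  fun_prop

@[fun_prop]
theorem polyTime_aSimView {s : α → SimState AData} (hs : PolyTime s) :
    PolyTime fun y => aSimView (s y) := by
  unfold aSimView
  fun_prop

@[fun_prop]
theorem polyTime_aGraph {x : α → AInput} (hx : PolyTime x) :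
    PolyTime fun y => A.graph (aInp (x y)) :=
  A.graph_poly.comp (polyTime_aInp hx)

@[fun_prop]
theorem polyTime_aQuery {x : α → AInput} {s : α → SimState AData} (hx : PolyTime x)
    (hs : PolyTime s) : PolyTime fun y => aQuery A (x y) (s y) :=
  A.query_poly.comp ((polyTime_aInp hx).prodMk (polyTime_aSimView hs))

@[fun_prop]
theorem polyTime_aStags {x : α → AInput} {s : α → SimState AData} (hx : PolyTime x)
    (hs : PolyTime s) : PolyTime fun y => P.aStags A (x y) (s y) := by
  unfold aStags
  fun_prop

@[fun_prop]
theorem polyTime_aAnswer {x : α → AInput} {s : α → SimState AData} (hx : PolyTime x)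
    (hs : PolyTime s) : PolyTime fun y => P.aAnswer A (x y) (s y) :=
  A.posting_poly.comp (((polyTime_aInp hx).prodMk (polyTime_aSimView hs)).prodMk
    (P.polyTime_aStags A hx hs))

theorem polyTime_aUpd : PolyTime fun p : AInput × Graph × Graph × Enclave × Token × AData =>
    P.aUpd p.1.1.length p.1.2.2.1 p.2.1 p.2.2.1 p.2.2.2.1 p.2.2.2.2.1 p.2.2.2.2.2 := by
  unfold aUpd
  fun_prop

theorem group_le (E : Enclave) (w : Bits) : P.group E w ≤ E.cnt.length := by
  refine (Nat.div_le_self _ _).trans ?_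
  have := List.idxOf_le_length (a := w) (l := E.cnt.map Prod.fst)
  rwa [List.length_map] at this

theorem polyTime_aSim : PolyTime (P.aSim A) := by
  obtain ⟨R, hR, hrep⟩ := P.exists_rep_bdd (u := fun x : AInput => x.1) (seeds := fun x => x.2.2.1.1)
    (by fun_prop) (by fun_prop)
  have h4 := P.H4.polyBdd_outLen [] (u := fun x : AInput => x.1) (by fun_prop)
  have hM := P.MH.polyBdd_outLen (u := fun x : AInput => x.1) (by fun_prop)
  refine P.polyTime_simulate (u := fun x : AInput => x.1) (s3 := fun x => x.2.2.1.1.2.1)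
    (K := fun x => x.2.2.2) (ts := fun x => A.graph (aInp x)) (d := fun _ => ([], [], []))
    (upd := fun x => P.aUpd x.1.length x.2.2.1)
    (by fun_prop) (by fun_prop) (by fun_prop) (by fun_prop) (by fun_prop) P.polyTime_aUpd
    -- Accumulation values are residues modulo `n`, hashes have fixed lengths, and a product has at
    -- most one factor, a prime of bounded size, for every keyword.
    (fun x k d => (d.1.length ≤ k ∧ ∀ e ∈ d.1, esize e ≤ k + esize x.2.2.1.2.1 + 2) ∧
      (d.2.1.length ≤ k ∧ ∀ e ∈ d.2.1, esize e ≤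
        3 * P.H4.outLen x.1.length + 3 * P.MH.outLen x.1.length + 3) ∧
      d.2.2.length ≤ k ∧ ∀ e ∈ d.2.2, esize e ≤ k + (k * R x + 1) + 4)
    (fun x => by simp) ?_
    (B := fun x =>
      esize (A.graph (aInp x)) * (esize (A.graph (aInp x)) + esize x.2.2.1.2.1 + 2 + 1) + 1 +
      (esize (A.graph (aInp x)) *
        (3 * P.H4.outLen x.1.length + 3 * P.MH.outLen x.1.length + 3 + 1) + 1) +
      (esize (A.graph (aInp x)) * (esize (A.graph (aInp x)) +
        (esize (A.graph (aInp x)) * R x + 1) + 4 + 1) + 1) + 2) (by fun_prop) ?_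
  · rintro x k G G' E t d - hE ⟨⟨h1, h2⟩, ⟨h3, h4⟩, h5, h6⟩
    have hj : Nat.size (P.group E t.1) ≤ k :=
      (Nat.size_le.2 Nat.lt_two_pow_self).trans ((P.group_le E t.1).trans hE)
    refine ⟨⟨(length_put_le _ _ _).trans (Nat.succ_le_succ h1), fun e he => ?_⟩,
      ⟨(length_put_le _ _ _).trans (Nat.succ_le_succ h3), fun e he => ?_⟩,
      (length_put_le _ _ _).trans (Nat.succ_le_succ h5), fun e he => ?_⟩
    · rcases mem_put he with he | rfl
      · have := h2 e he
        omega
      · rw [esize_pair, esize_nat]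
        refine (Nat.add_le_add_right (Nat.add_le_add_left (size_powMod_le _ _ _) _) _).trans ?_
        omega
    · rcases mem_put he with he | rfl
      · exact h4 e he
      · exact esize_bitsPair_le ⟨(P.H4.hash_length _ _ _).le, (P.MH.hash_length _ _ _).le⟩
    · have hk : k * R x ≤ (k + 1) * R x := Nat.mul_le_mul_right _ (Nat.le_succ k)
      rcases mem_put he with he | rfl
      · have := h6 e he
        omega
      · have h7 := P.size_groupProduct_le (hrep x G') ((put E.cnt t.1 0).map Prod.fst)
          (P.group E t.1)
        have h8 : ((put E.cnt t.1 0).map Prod.fst).length * R x ≤ (k + 1) * R x := by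
          refine Nat.mul_le_mul_right _ ?_
          rw [List.length_map]
          exact (length_put_le _ _ _).trans (Nat.succ_le_succ hE)
        rw [esize_pair, esize_nat, esize_nat]
        omega
  · rintro x k d hk ⟨⟨h1, h2⟩, ⟨h3, h4⟩, h5, h6⟩
    have hl := length_le_esize (A.graph (aInp x))
    have g1 := esize_le_of_forall h2
    have g2 := esize_le_of_forall h4
    have g3 := esize_le_of_forall h6
    have e : esize d = esize d.1 + esize d.2.1 + esize d.2.2 + 2 := by
      rw [show d = (d.1, d.2.1, d.2.2) from rfl, esize_pair, esize_pair]
      dsimp only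
      omega
    rw [e]
    refine Nat.add_le_add_right (Nat.add_le_add (Nat.add_le_add (g1.trans ?_) (g2.trans ?_))
      (g3.trans ?_)) 2
    · gcongr <;> omega
    · gcongr
      omega
    · gcongr <;> omega

theorem polyTime_aMultisets : PolyTime (P.aMultisets A) := by
  refine PolyTime.option_elim (P.polyTime_aSim A) (by fun_prop) ?_
  fun_prop

theorem polyTime_aFilters : PolyTime (P.aFilters A) := by
  refine PolyTime.option_elim (P.polyTime_aSim A) (by fun_prop) (P.polyTime_filterPair (by fun_prop)
    (by fun_prop) (by fun_prop) (by fun_prop) (by fun_prop) (by fun_prop) (by fun_prop) ?_)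
  have h : PolyTime fun p : (AInput × SimState AData) × List Bits =>
    (((aInp p.1.1, aSimView p.1.2), P.aStags A p.1.1 p.1.2), p.2) := by fun_prop
  exact A.subFilter_poly.comp h

theorem polyTime_aKeywords : PolyTime (P.aKeywords A) :=
  polyTime_collisionPair (f := fun x : AInput => P.H4.hash x.1.length x.2.2.1.1.2.2.1)
    (l := fun x : AInput => (A.graph (aInp x)).map Prod.fst) (by fun_prop) (by fun_prop)

theorem polyTime_aForgery : PolyTime (P.aForgery A) := by
  refine PolyTime.option_elim (P.polyTime_aSim A) (by fun_prop) ?_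
  fun_prop

theorem polyTime_aGraphQuery : PolyTime (P.aGraphQuery A) := by
  refine PolyTime.option_elim (P.polyTime_aSim A) (by fun_prop) ?_
  fun_prop

end PolyTime

theorem aGame_eq_some {lam : ℕ} {coins : Bits} {seeds : Bits × Bits × Bits × Bits}
    {pqg : ℕ × ℕ × ℕ} {K : Keys} {G : Graph} {q : Query} {R : List Bits}
    (hsafe : P.Acc.Safe lam pqg)
    (hinj : Set.InjOn (P.H4.hash lam seeds.2.2.1) {w | w ∈ (A.graph (aInp
      (unary lam, coins, (seeds, pqg.1 * pqg.2.1, pqg.2.2), K))).map Prod.fst})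
    (h : P.aGame A lam coins seeds pqg K = some (G, q, R)) :
    ∃ st : AState, P.aSim A (unary lam, coins, (seeds, pqg.1 * pqg.2.1, pqg.2.2), K) =
        some (G, st.enc, st.srv, st.ac, st.mh, st.xp) ∧
      P.ARepresents lam (seeds, pqg.1 * pqg.2.1, pqg.2.2) G st ∧
      (∀ w ∈ st.enc.cnt.map Prod.fst, w ∈ (A.graph (aInp
        (unary lam, coins, (seeds, pqg.1 * pqg.2.1, pqg.2.2), K))).map Prod.fst) ∧
      q = A.query ((unary lam, coins, (seeds, pqg.1 * pqg.2.1, pqg.2.2)), st.view) ∧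
      P.aSearch lam (seeds, pqg.1 * pqg.2.1, pqg.2.2) K st q
        (fun sl => A.posting (((unary lam, coins, (seeds, pqg.1 * pqg.2.1, pqg.2.2)), st.view), sl))
        (fun sl ids => A.subFilter
          ((((unary lam, coins, (seeds, pqg.1 * pqg.2.1, pqg.2.2)), st.view), sl), ids)) = some R := by
  unfold aGame at h
  obtain ⟨G', hG, h⟩ := Option.bind_eq_some_iff.1 h
  obtain ⟨st, hst, h⟩ := Option.bind_eq_some_iff.1 h
  obtain ⟨R', hR, h⟩ := Option.bind_eq_some_iff.1 h
  cases h
  obtain ⟨h1, h2, h3⟩ := aUpdate_simulate hsafe hinj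
    (fun t ht => List.mem_map_of_mem (f := Prod.fst) ht) (fun w hw => by cases hw)
    (aRepresents_init lam (seeds, pqg.1 * pqg.2.1, pqg.2.2)) hG hst
  refine ⟨st, ?_, h2, h3, rfl, hR⟩
  simp only [aSim, simulate, aInp]
  rw [show (unary lam).length = lam by simp [unary]]
  exact h1

theorem aSim_cnt_le {x : AInput} {s : SimState AData} (h : P.aSim A x = some s)
    {w : Bits} {c : ℕ} (hc : s.2.1.cnt.lookup w = some c) : c ≤ (A.graph (aInp x)).length :=
  ((P.simulate_bdd (T := esize (A.graph (aInp x))) (I := fun _ _ => True)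
    (fun _ ht => (esize_lt_of_mem ht).le) trivial (fun _ _ _ _ _ _ _ _ _ => trivial) h).1.cnt_size _
    (mem_of_lookup_eq_some hc)).2

/-- This collision is found among the keywords of the updates, without running the protocol; so it
is available even where the simulation may deviate from the game. -/
theorem aKeywords_spec {lam : ℕ} {coins : Bits} {pub : APub} {K : Keys} {x : AInput}
    (hx : x = (unary lam, coins, pub, K))
    (hinj : ¬ Set.InjOn (P.H4.hash lam pub.1.2.2.1) {w | w ∈ (A.graph (aInp x)).map Prod.fst}) :
    (P.aKeywords A x).1 ≠ (P.aKeywords A x).2 ∧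
      P.H4.hash lam pub.1.2.2.1 (P.aKeywords A x).1 =
        P.H4.hash lam pub.1.2.2.1 (P.aKeywords A x).2 := by
  simp only [Set.InjOn, not_forall] at hinj
  obtain ⟨a, ha, b, hb, hab, hne⟩ := hinj
  have := collisionPair_spec ha hb hne hab
  subst hx
  unfold aKeywords
  dsimp only
  rw [show (unary lam).length = lam by simp [unary]]
  exact this

/-- A wrong result of an accepted search yields a collision or a forgery. -/
theorem aGame_collision {lam : ℕ} {coins : Bits} {seeds : Bits × Bits × Bits × Bits}
    {pqg : ℕ × ℕ × ℕ} {K : Keys} {x : AInput}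
    (hx : x = (unary lam, coins, (seeds, pqg.1 * pqg.2.1, pqg.2.2), K))
    (hsafe : P.Acc.Safe lam pqg)
    (h : Wrong (P.filterResult lam) (P.aGame A lam coins seeds pqg K)) :
    (((P.aMultisets A x).1 : Multiset Bits) ≠ (P.aMultisets A x).2 ∧
      P.MH.hash lam seeds.1 ((P.aMultisets A x).1 : Multiset Bits) =
        P.MH.hash lam seeds.1 ((P.aMultisets A x).2 : Multiset Bits)) ∨
    ((P.aFilters A x).1 ≠ (P.aFilters A x).2 ∧
      P.H3.hash lam seeds.2.1 (P.aFilters A x).1 = P.H3.hash lam seeds.2.1 (P.aFilters A x).2) ∨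
    ((P.aKeywords A x).1 ≠ (P.aKeywords A x).2 ∧
      P.H4.hash lam seeds.2.2.1 (P.aKeywords A x).1 =
        P.H4.hash lam seeds.2.2.1 (P.aKeywords A x).2) ∨
    ((P.aForgery A x).2.1 ∉ (P.aForgery A x).1 ∧
      accVerify (pqg.1 * pqg.2.1) (P.Acc.rep lam seeds.2.2.2 (P.aForgery A x).2.1)
        (P.aForgery A x).2.2 (pqg.2.2 ^ ((P.aForgery A x).1.map (P.Acc.rep lam seeds.2.2.2)).prod %
          (pqg.1 * pqg.2.1)) = true) := by
  have hu : (unary lam).length = lam := by simp [unary]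
  -- Injectivity makes the simulation faithful; its failure is itself a collision.
  by_cases hinj : Set.InjOn (P.H4.hash lam seeds.2.2.1) {w | w ∈ (A.graph (aInp x)).map Prod.fst}
  swap
  · exact Or.inr (Or.inr (Or.inl (P.aKeywords_spec A hx hinj)))
  subst hx
  obtain ⟨G, q, R, hgame, hwrong⟩ := h
  obtain ⟨st, hsim, hrep, hkeys, hq, hR⟩ := P.aGame_eq_some A hsafe hinj hgame
  unfold aSearch at hR
  dsimp only at hR
  cases hc : st.enc.cnt.lookup q.1 with
  | none =>
    rw [hc] at hR
    cases hR
    exact absurd hwrong (P.not_wrong_of_lookup_eq_none hrep.core hc)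
  | some c =>
    rw [hc] at hR
    simp only [Option.bind_eq_bind, guard_bind] at hR
    split_ifs at hR with hver
    obtain ⟨pl, hpl, hR⟩ := Option.bind_eq_some_iff.1 hR
    split_ifs at hR with hhash
    have hqs : aQuery A (unary lam, coins, (seeds, pqg.1 * pqg.2.1, pqg.2.2), K)
      (G, st.enc, st.srv, st.ac, st.mh, st.xp) = q := hq.symm
    have hst : P.aStags A (unary lam, coins, (seeds, pqg.1 * pqg.2.1, pqg.2.2), K)
        (G, st.enc, st.srv, st.ac, st.mh, st.xp) = P.stagList lam K q.1 c := by
      unfold aStags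
      rw [← P.boundedStagList_eq (P.aSim_cnt_le A hsim hc), hu, hqs]
      dsimp only
      rw [hc]
      rfl
    have hans : P.aAnswer A (unary lam, coins, (seeds, pqg.1 * pqg.2.1, pqg.2.2), K)
        (G, st.enc, st.srv, st.ac, st.mh, st.xp) =
        A.posting (((unary lam, coins, (seeds, pqg.1 * pqg.2.1, pqg.2.2)), st.view),
          P.stagList lam K q.1 c) := by
      unfold aAnswer
      rw [hst]
      rfl
    change accVerify _ (P.Acc.rep lam seeds.2.2.2 (P.H4.hash lam seeds.2.2.1 q.1 ++
      (A.posting (_, _)).2.1)) (A.posting (_, _)).2.2 _ = true at hver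
    change P.decryptPL lam K q.1 c (A.posting (_, _)).1 = some pl at hpl
    change P.hashPL lam seeds.1 pl = (A.posting (_, _)).2.1 at hhash
    rw [← hans] at hver hpl hhash
    -- If the server sent the true hash, the argument for VSecGraph applies. Otherwise the string
    -- accepted by the accumulator is not one of the accumulated strings.
    by_cases heq : (P.aAnswer A (unary lam, coins, (seeds, pqg.1 * pqg.2.1, pqg.2.2), K)
        (G, st.enc, st.srv, st.ac, st.mh, st.xp)).2.1 = P.postingHash lam seeds.1 G q.1
    · have := P.collision_of_wrong (sM := seeds.1) hrep.core hrep.lengths hc hpl (hhash.trans heq)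
        hR hwrong
      unfold aMultisets aFilters
      rw [hsim, Option.elim_some, Option.elim_some, hqs, hst]
      dsimp only
      rw [hu]
      exact this.imp_right Or.inl
    · right; right; right
      have hmem : q.1 ∈ st.enc.cnt.map Prod.fst := lookup_isSome_iff_mem.1 (by rw [hc]; rfl)
      unfold aForgery
      rw [hsim, Option.elim_some, hqs]
      dsimp only
      rw [hu]
      constructor
      · intro hin
        obtain ⟨w, hw, hwe⟩ := List.mem_map.1 hin
        rw [accString] at hwe
        -- Values of `H4` have a fixed length, so the string splits uniquely; its first part
        -- identifies the keyword.
        obtain ⟨h1, h2⟩ := List.append_inj hwe (by rw [P.H4.hash_length, P.H4.hash_length])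
        have : w = q.1 := hinj (hkeys w (P.mem_groupKeys.1 hw).1) (hkeys _ hmem) h1
        rw [this] at h2
        exact heq h2.symm
      · rw [List.map_map]
        have := hrep.ac (P.group st.enc q.1)
        rw [this] at hver
        exact hver

end Primitives

/-! ## Exact results -/

namespace Primitives

variable (P : Primitives)

/-- The cross tags that matter for a query. -/
def crossTags (x : Graph × Query) : List Bits :=
  (x.2.2.flatMap fun w => x.1.map fun e => w ++ e.2.1) ++ x.1.map fun e => e.1 ++ e.2.1

/-- Colliding cross tags. -/
def crossTagPair (lam : ℕ) (x : Graph × Query) : Bits × Bits :=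
  collisionPair (P.H2 lam) (crossTags x)

@[fun_prop]
theorem polyTime_crossTagPair {α : Type} [Enc α] {u : α → Bits} {x : α → Graph × Query}
    (hu : PolyTime u) (hx : PolyTime x) :
    PolyTime fun y => P.crossTagPair (u y).length (x y) :=
  polyTime_collisionPair (f := fun y => P.H2 (u y).length) (l := fun y => crossTags (x y))
    (by fun_prop) (by unfold crossTags; fun_prop)

/-- True edges always pass the filter. A false positive passes for some `w` because of an edge with
the same fingerprint; its cross tag is different, as equal tags would yield equal keywords and
identifiers, all identifiers having the same length. Both tags are in the polynomially long list
that is searched. -/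
theorem crossTagPair_spec {lam : ℕ} {G : Graph} {q : Query} (hG : P.GraphLengths lam G)
    (hne : P.filterResult lam G q ≠ exactResult lam G q) :
    (P.crossTagPair lam (G, q)).1 ≠ (P.crossTagPair lam (G, q)).2 ∧
      P.H2 lam (P.crossTagPair lam (G, q)).1 = P.H2 lam (P.crossTagPair lam (G, q)).2 := by
  by_contra hcon
  refine hne (Set.ext fun id => ⟨?_, ?_⟩)
  · rintro ⟨⟨wt, h1⟩, h2⟩ w hw
    rcases List.mem_cons.1 hw with rfl | hw
    · exact ⟨wt, h1⟩
    · obtain ⟨e, he, hs⟩ := h2 w hw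
      have heq : w ++ id = e.1 ++ e.2.1 := by
        by_contra hne'
        refine hcon (collisionPair_spec (a := w ++ id) (b := e.1 ++ e.2.1) ?_ ?_ hne' hs.1)
        · exact List.mem_append_left _ (List.mem_flatMap.2 ⟨w, hw, List.mem_map.2 ⟨_, h1, rfl⟩⟩)
        · exact List.mem_append_right _ (List.mem_map.2 ⟨e, he, rfl⟩)
      obtain ⟨h3, h4⟩ := List.append_inj' heq ((hG _ h1).1.trans (hG _ he).1.symm)
      refine ⟨e.2.2, ?_⟩
      rw [h3, h4]
      exact he
  · intro h
    refine ⟨h q.1 List.mem_cons_self, fun w hw => ?_⟩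
    obtain ⟨wt, hwt⟩ := h w (List.mem_cons_of_mem _ hw)
    exact ⟨_, hwt, rfl, Or.inl rfl⟩

theorem vGame_exact {A : Adversary VPub VView (List Bits)} {lam : ℕ} {coins : Bits} {pub : VPub}
    {K : Keys} (h : Wrong (exactResult lam) (P.vGame A lam coins pub K)) :
    Wrong (P.filterResult lam) (P.vGame A lam coins pub K) ∨
    ((P.crossTagPair lam (P.vGraphQuery A (unary lam, coins, pub, K))).1 ≠
        (P.crossTagPair lam (P.vGraphQuery A (unary lam, coins, pub, K))).2 ∧
      P.H2 lam (P.crossTagPair lam (P.vGraphQuery A (unary lam, coins, pub, K))).1 =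
        P.H2 lam (P.crossTagPair lam (P.vGraphQuery A (unary lam, coins, pub, K))).2) := by
  obtain ⟨G, q, R, hgame, hwrong⟩ := h
  by_cases heq : P.filterResult lam G q = exactResult lam G q
  · left
    exact ⟨G, q, R, hgame, heq ▸ hwrong⟩
  · right
    obtain ⟨st, hsim, -, hlen, -, hq, -⟩ := P.vGame_eq_some A hgame
    have : P.vGraphQuery A (unary lam, coins, pub, K) = (G, q) := by
      rw [vGraphQuery, hsim, Option.elim_some, hq]
      rfl
    rw [this]
    exact P.crossTagPair_spec hlen heq

theorem aGame_exact {A : Adversary APub AView AAns} {lam : ℕ} {coins : Bits}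
    {seeds : Bits × Bits × Bits × Bits} {pqg : ℕ × ℕ × ℕ} {K : Keys} {x : AInput}
    (hx : x = (unary lam, coins, (seeds, pqg.1 * pqg.2.1, pqg.2.2), K))
    (hsafe : P.Acc.Safe lam pqg)
    (h : Wrong (exactResult lam) (P.aGame A lam coins seeds pqg K)) :
    Wrong (P.filterResult lam) (P.aGame A lam coins seeds pqg K) ∨
    ((P.aKeywords A x).1 ≠ (P.aKeywords A x).2 ∧
      P.H4.hash lam seeds.2.2.1 (P.aKeywords A x).1 =
        P.H4.hash lam seeds.2.2.1 (P.aKeywords A x).2) ∨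
    ((P.crossTagPair lam (P.aGraphQuery A x)).1 ≠ (P.crossTagPair lam (P.aGraphQuery A x)).2 ∧
      P.H2 lam (P.crossTagPair lam (P.aGraphQuery A x)).1 =
        P.H2 lam (P.crossTagPair lam (P.aGraphQuery A x)).2) := by
  by_cases hinj : Set.InjOn (P.H4.hash lam seeds.2.2.1) {w | w ∈ (A.graph (aInp x)).map Prod.fst}
  swap
  · exact Or.inr (Or.inl (P.aKeywords_spec A hx hinj))
  subst hx
  obtain ⟨G, q, R, hgame, hwrong⟩ := h
  by_cases heq : P.filterResult lam G q = exactResult lam G q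
  · left
    exact ⟨G, q, R, hgame, heq ▸ hwrong⟩
  · right; right
    obtain ⟨st, hsim, hrep, -, hq, -⟩ := P.aGame_eq_some A hsafe hinj hgame
    have : P.aGraphQuery A (unary lam, coins, (seeds, pqg.1 * pqg.2.1, pqg.2.2), K) = (G, q) := by
      rw [aGraphQuery, hsim, Option.elim_some, hq]
      rfl
    rw [this]
    exact P.crossTagPair_spec hrep.lengths heq

end Primitives

/-! ## Probability -/

section Probability

variable {Ω Ω' : Type} [Fintype Ω] [Fintype Ω']

theorem prob_nonneg (E : Ω → Prop) : 0 ≤ prob E := by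
  unfold prob
  positivity

theorem prob_le_add {E F G : Ω → Prop} (h : ∀ o, E o → F o ∨ G o) : prob E ≤ prob F + prob G := by
  classical
  unfold prob
  rw [← add_div]
  gcongr
  rw [← Nat.cast_add, Nat.cast_le]
  refine (Finset.card_le_card ?_).trans (Finset.card_union_le _ _)
  intro o ho
  simpa using h o (by simpa using ho)

/-- Comparison of probabilities along an injection between sets of the same size. -/
theorem prob_le_of_injective {E : Ω → Prop} {F : Ω' → Prop} {f : Ω → Ω'}
    (hf : Function.Injective f) (hcard : Fintype.card Ω = Fintype.card Ω')
    (h : ∀ o, E o → F (f o)) : prob E ≤ prob F := by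
  classical
  unfold prob
  rw [hcard]
  gcongr
  rw [← Finset.card_image_of_injective _ hf]
  refine Finset.card_le_card ?_
  intro o ho
  obtain ⟨a, ha, rfl⟩ := Finset.mem_image.1 ho
  simpa using h a (by simpa using ha)

theorem prob_fst [Nonempty Ω'] (E : Ω → Prop) : prob (fun o : Ω × Ω' => E o.1) = prob E := by
  classical
  unfold prob
  have : (Finset.univ.filter fun o : Ω × Ω' => E o.1) = (Finset.univ.filter E) ×ˢ Finset.univ := by
    ext o
    simp
  rw [this, Finset.card_product, Fintype.card_prod, Finset.card_univ, Nat.cast_mul, Nat.cast_mul]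
  exact mul_div_mul_right _ _ (Nat.cast_ne_zero.2 Fintype.card_ne_zero)

theorem Negligible.of_prob_le {Ω : ℕ → Type} [∀ n, Fintype (Ω n)] {E : ∀ n, Ω n → Prop}
    {f : ℕ → ℝ} (hf : Negligible f) (h : ∀ n, prob (E n) ≤ f n) :
    Negligible fun n => prob (E n) :=
  hf.trans_abs_le fun n => by
    rw [abs_of_nonneg (prob_nonneg _)]
    exact (h n).trans (le_abs_self _)

theorem Negligible.of_imp_or {Ω : ℕ → Type} [∀ n, Fintype (Ω n)] {E F G : ∀ n, Ω n → Prop}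
    (hF : Negligible fun n => prob (F n)) (hG : Negligible fun n => prob (G n))
    (h : ∀ n o, E n o → F n o ∨ G n o) : Negligible fun n => prob (E n) :=
  Negligible.of_prob_le (hF.add hG) fun n => prob_le_add (h n)

/-- Concatenation of coin tosses. -/
def Tape.append {m n : ℕ} (r : Tape m) (s : Tape n) : Tape (m + n) := Fin.append r s

theorem Tape.bits_append {m n : ℕ} (r : Tape m) (s : Tape n) :
    (r.append s).bits = r.bits ++ s.bits := List.ofFn_fin_append r s

theorem Tape.bits_length {n : ℕ} (r : Tape n) : r.bits.length = n := List.length_ofFn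

theorem Tape.append_inj {m n : ℕ} {r r' : Tape m} {s s' : Tape n} :
    r.append s = r'.append s' ↔ r = r' ∧ s = s' := by
  constructor
  · intro h
    constructor
    · funext i
      have := congrFun h (Fin.castAdd n i)
      simpa [Tape.append] using this
    · funext i
      have := congrFun h (Fin.natAdd m i)
      simpa [Tape.append] using this
  · rintro ⟨rfl, rfl⟩
    rfl

theorem Tape.take_bits_append {n : ℕ} (r : Tape n) (l : Bits) : (r.bits ++ l).take n = r.bits :=
  List.take_left' r.bits_length

theorem Tape.drop_bits_append {n : ℕ} (r : Tape n) (l : Bits) : (r.bits ++ l).drop n = l :=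
  List.drop_left' r.bits_length

theorem card_tape (n : ℕ) : Fintype.card (Tape n) = 2 ^ n := by simp

theorem unary_length (n : ℕ) : (unary n).length = n := List.length_replicate

/-- A collision is found with negligible probability if a part of the random tape is the seed. -/
theorem CollisionResistant.negligible {X Y : Type} [Enc X] {seedLen : ℕ → ℕ} {rep : X → Y}
    {H : ℕ → Bits → Y → Bits} (h : CollisionResistant seedLen rep H) {Ω : ℕ → Type}
    [∀ n, Fintype (Ω n)] {c : ℕ → ℕ} (f : ∀ n, Ω n → Tape (c n) × Tape (seedLen n))
    (hf : ∀ n, Function.Injective (f n))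
    (hcard : ∀ n, Fintype.card (Ω n) = Fintype.card (Tape (c n) × Tape (seedLen n)))
    (B : PPT Bits (X × X)) (hB : B.coins = c)
    {s : ∀ n, Ω n → Bits} (hs : ∀ n o, s n o = (f n o).2.bits) {x : ∀ n, Ω n → X × X}
    (hx : ∀ n o, B.run (unary n, (f n o).1.bits, (f n o).2.bits) = x n o) :
    Negligible fun n => prob fun o : Ω n =>
      rep (x n o).1 ≠ rep (x n o).2 ∧ H n (s n o) (rep (x n o).1) = H n (s n o) (rep (x n o).2) := by
  subst hB
  exact Negligible.of_prob_le (h B) fun n => prob_le_of_injective (hf n) (hcard n) fun o ho => by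
    dsimp only
    rw [hx, ← hs]
    exact ho

end Probability

/-! ## Reductions -/

namespace Primitives

variable (P : Primitives)

/-- Three keys from the end of a random tape. -/
def keysOf (n : ℕ) (r : Bits) : Keys := (r.take n, (r.drop n).take n, (r.drop n).drop n)

section PolyTime

variable {α : Type} [Enc α] {u r : α → Bits}

@[fun_prop]
theorem polyTime_keysOf (hu : PolyTime u) (hr : PolyTime r) :
    PolyTime fun x => keysOf (u x).length (r x) := by
  unfold keysOf
  fun_prop

@[fun_prop]
theorem polyTime_seedLen_MH (hu : PolyTime u) : PolyTime fun x => P.MH.seedLen (u x).length :=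
  P.MH.seedLen_poly.length hu

@[fun_prop]
theorem polyTime_seedLen {X : Type} [Enc X] (H : HashFamily X) (hu : PolyTime u) :
    PolyTime fun x => H.seedLen (u x).length :=
  H.seedLen_poly.length hu

@[fun_prop]
theorem polyTime_repSeedLen (hu : PolyTime u) : PolyTime fun x => P.Acc.repSeedLen (u x).length :=
  P.Acc.repSeedLen_poly.length hu

@[fun_prop]
theorem polyTime_accCoins (hu : PolyTime u) : PolyTime fun x => P.Acc.coins (u x).length :=
  P.Acc.coins_poly.length hu

@[fun_prop]
theorem polyTime_adversaryCoins {Pub View Ans : Type} [Enc Pub] [Enc View] [Enc Ans]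
    (A : Adversary Pub View Ans) (hu : PolyTime u) : PolyTime fun x => A.coins (u x).length :=
  A.coins_poly.length hu

end PolyTime

theorem keysOf_bits {n : ℕ} (a b c : Tape n) :
    keysOf n (a.bits ++ (b.bits ++ c.bits)) = (a.bits, b.bits, c.bits) := by
  simp only [keysOf, Tape.take_bits_append, Tape.drop_bits_append]

theorem polyLength_keys : PolyLength fun n => n + (n + n) :=
  PolyLength.id.add (PolyLength.id.add PolyLength.id)

/-! ### Reductions from the attack on VSecGraph. -/

section VSecGraph

variable (A : Adversary VPub VView (List Bits))

/-- The random choices of the attack. -/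
abbrev VSpace (lam : ℕ) : Type :=
  Tape (A.coins lam) × (Tape (P.MH.seedLen lam) × Tape (P.H3.seedLen lam)) ×
    (Tape lam × Tape lam × Tape lam)

/-- The input that belongs to the random choices. -/
def vInput (lam : ℕ) (o : P.VSpace A lam) : VInput :=
  (unary lam, o.1.bits, (o.2.1.1.bits, o.2.1.2.bits),
    (o.2.2.1.bits, o.2.2.2.1.bits, o.2.2.2.2.bits))

/-- Finds colliding multisets. -/
def vMultisetFinder : PPT Bits (List Bits × List Bits) where
  coins n := A.coins n + (P.H3.seedLen n + (n + (n + n)))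
  coins_poly := A.coins_poly.add (P.H3.seedLen_poly.add polyLength_keys)
  run x := P.vMultisets A (x.1, x.2.1.take (A.coins x.1.length),
    (x.2.2, (x.2.1.drop (A.coins x.1.length)).take (P.H3.seedLen x.1.length)),
    keysOf x.1.length ((x.2.1.drop (A.coins x.1.length)).drop (P.H3.seedLen x.1.length)))
  run_poly := (P.polyTime_vMultisets A).comp (by fun_prop)

/-- Finds colliding sub-filters. -/
def vFilterFinder : PPT Bits (SubFilter × SubFilter) where
  coins n := A.coins n + (P.MH.seedLen n + (n + (n + n)))
  coins_poly := A.coins_poly.add (P.MH.seedLen_poly.add polyLength_keys)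
  run x := P.vFilters A (x.1, x.2.1.take (A.coins x.1.length),
    ((x.2.1.drop (A.coins x.1.length)).take (P.MH.seedLen x.1.length), x.2.2),
    keysOf x.1.length ((x.2.1.drop (A.coins x.1.length)).drop (P.MH.seedLen x.1.length)))
  run_poly := (P.polyTime_vFilters A).comp (by fun_prop)

/-- Finds colliding cross tags. -/
def vCrossTagFinder : PPT Bits (Bits × Bits) where
  coins n := A.coins n + (P.MH.seedLen n + (P.H3.seedLen n + (n + (n + n))))
  coins_poly := A.coins_poly.add (P.MH.seedLen_poly.add (P.H3.seedLen_poly.add polyLength_keys))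
  run x := P.crossTagPair x.1.length (P.vGraphQuery A (x.1, x.2.1.take (A.coins x.1.length),
    ((x.2.1.drop (A.coins x.1.length)).take (P.MH.seedLen x.1.length),
      ((x.2.1.drop (A.coins x.1.length)).drop (P.MH.seedLen x.1.length)).take
        (P.H3.seedLen x.1.length)),
    keysOf x.1.length (((x.2.1.drop (A.coins x.1.length)).drop (P.MH.seedLen x.1.length)).drop
        (P.H3.seedLen x.1.length))))
  run_poly := P.polyTime_crossTagPair (by fun_prop) ((P.polyTime_vGraphQuery A).comp (by fun_prop))

/-- The challenge seed takes the place of the seed of the multiset hash, and the finder's coins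
provide everything else. The rearrangement of the tape is an injection between sets of equal size,
so probabilities are preserved. -/
theorem negligible_vMultisets (h : P.MH.IsCollisionResistant) : Negligible fun lam =>
    prob fun o : P.VSpace A lam =>
      (((P.vMultisets A (P.vInput A lam o)).1 : Multiset Bits) ≠
          (P.vMultisets A (P.vInput A lam o)).2 ∧
        P.MH.hash lam o.2.1.1.bits ((P.vMultisets A (P.vInput A lam o)).1 : Multiset Bits) =
          P.MH.hash lam o.2.1.1.bits ((P.vMultisets A (P.vInput A lam o)).2 : Multiset Bits)) := by
  refine CollisionResistant.negligible h
    (fun n (o : P.VSpace A n) => (o.1.append (o.2.1.2.append (o.2.2.1.append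
      (o.2.2.2.1.append o.2.2.2.2))), o.2.1.1)) ?_ ?_ (P.vMultisetFinder A) rfl
    (fun _ _ => rfl) ?_
  · intro n o o' h
    simp only [Prod.ext_iff, Tape.append_inj] at h ⊢
    tauto
  · intro n
    simp only [Fintype.card_prod, card_tape, pow_add]
    ring
  · intro n o
    simp only [vMultisetFinder, vInput, unary_length, Tape.bits_append, Tape.take_bits_append,
      Tape.drop_bits_append, keysOf_bits]

theorem negligible_vFilters (h : P.H3.IsCollisionResistant) : Negligible fun lam =>
    prob fun o : P.VSpace A lam =>
      ((P.vFilters A (P.vInput A lam o)).1 ≠ (P.vFilters A (P.vInput A lam o)).2 ∧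
        P.H3.hash lam o.2.1.2.bits (P.vFilters A (P.vInput A lam o)).1 =
          P.H3.hash lam o.2.1.2.bits (P.vFilters A (P.vInput A lam o)).2) := by
  refine CollisionResistant.negligible h
    (fun n (o : P.VSpace A n) => (o.1.append (o.2.1.1.append (o.2.2.1.append
      (o.2.2.2.1.append o.2.2.2.2))), o.2.1.2)) ?_ ?_ (P.vFilterFinder A) rfl
    (fun _ _ => rfl) ?_
  · intro n o o' h
    simp only [Prod.ext_iff, Tape.append_inj] at h ⊢
    tauto
  · intro n
    simp only [Fintype.card_prod, card_tape, pow_add]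
    ring
  · intro n o
    simp only [vFilterFinder, vInput, unary_length, Tape.bits_append, Tape.take_bits_append,
      Tape.drop_bits_append, keysOf_bits]

/-- The fingerprint function has no seed: the challenge is the empty tape `Fin.elim0`, and all seeds
come from the finder's coins. -/
theorem negligible_vCrossTags (h : P.FingerprintCollisionResistant) : Negligible fun lam =>
    prob fun o : P.VSpace A lam =>
      ((P.crossTagPair lam (P.vGraphQuery A (P.vInput A lam o))).1 ≠
          (P.crossTagPair lam (P.vGraphQuery A (P.vInput A lam o))).2 ∧
        P.H2 lam (P.crossTagPair lam (P.vGraphQuery A (P.vInput A lam o))).1 =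
          P.H2 lam (P.crossTagPair lam (P.vGraphQuery A (P.vInput A lam o))).2) := by
  refine CollisionResistant.negligible h
    (fun n (o : P.VSpace A n) => (o.1.append (o.2.1.1.append (o.2.1.2.append (o.2.2.1.append
      (o.2.2.2.1.append o.2.2.2.2)))), Fin.elim0)) ?_ ?_ (P.vCrossTagFinder A) rfl
    (fun _ _ => rfl) ?_
  · intro n o o' h
    simp only [Prod.ext_iff, Tape.append_inj] at h ⊢
    tauto
  · intro n
    simp only [Fintype.card_prod, card_tape, pow_add]
    ring
  · intro n o
    simp only [vCrossTagFinder, vInput, unary_length, Tape.bits_append, Tape.take_bits_append,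
      Tape.drop_bits_append, keysOf_bits]

theorem vSecGraphCorrect_filterResult (hH : P.MH.IsCollisionResistant)
    (hH3 : P.H3.IsCollisionResistant) : P.VSecGraphCorrect P.filterResult := fun A =>
  Negligible.of_imp_or (P.negligible_vMultisets A hH) (P.negligible_vFilters A hH3)
    fun _ _ ho => P.vGame_collision A ho

theorem vSecGraphCorrect_exactResult (hH : P.MH.IsCollisionResistant)
    (hH3 : P.H3.IsCollisionResistant) (hH2 : P.FingerprintCollisionResistant) :
    P.VSecGraphCorrect exactResult := fun A =>
  Negligible.of_imp_or (P.vSecGraphCorrect_filterResult hH hH3 A) (P.negligible_vCrossTags A hH2)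
    fun _ _ ho => P.vGame_exact ho

end VSecGraph

/-! ### Reductions from the attack on VSecGraph-A. -/

section VSecGraphA

variable (A : Adversary APub AView AAns)

/-- The random choices of the attack. -/
abbrev ASpace (lam : ℕ) : Type :=
  Tape (A.coins lam) ×
    (Tape (P.MH.seedLen lam) × Tape (P.H3.seedLen lam) × Tape (P.H4.seedLen lam) ×
      Tape (P.Acc.repSeedLen lam)) ×
    Tape (P.Acc.coins lam) × (Tape lam × Tape lam × Tape lam)

/-- The input for an adversary with the given coins, seeds and keys, after the RSA setup. -/
def setupInput (u c : Bits) (seeds : Bits × Bits × Bits × Bits) (r : Bits) (K : Keys) : AInput :=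
  (u, c, (seeds, (P.Acc.setup u.length r).1 * (P.Acc.setup u.length r).2.1,
    (P.Acc.setup u.length r).2.2), K)

@[fun_prop]
theorem polyTime_setupInput {α : Type} [Enc α] {u c r : α → Bits}
    {seeds : α → Bits × Bits × Bits × Bits} {K : α → Keys} (hu : PolyTime u) (hc : PolyTime c)
    (hs : PolyTime seeds) (hr : PolyTime r) (hK : PolyTime K) :
    PolyTime fun x => P.setupInput (u x) (c x) (seeds x) (r x) (K x) := by
  unfold setupInput
  fun_prop

/-- The input that belongs to the random choices. -/
def aInput (lam : ℕ) (o : P.ASpace A lam) : AInput :=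
  P.setupInput (unary lam) o.1.bits
    (o.2.1.1.bits, o.2.1.2.1.bits, o.2.1.2.2.1.bits, o.2.1.2.2.2.bits) o.2.2.1.bits
    (o.2.2.2.1.bits, o.2.2.2.2.1.bits, o.2.2.2.2.2.bits)

/-- The first four parts, of the given lengths, of a string, and the rest. -/
def cut (a b c d : ℕ) (r : Bits) : Bits × Bits × Bits × Bits × Bits :=
  (r.take a, (r.drop a).take b, ((r.drop a).drop b).take c, (((r.drop a).drop b).drop c).take d,
    (((r.drop a).drop b).drop c).drop d)

theorem cut_bits {a b c d : ℕ} (r : Tape a) (s : Tape b) (t : Tape c) (v : Tape d) (l : Bits) :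
    cut a b c d (r.bits ++ (s.bits ++ (t.bits ++ (v.bits ++ l)))) =
      (r.bits, s.bits, t.bits, v.bits, l) := by
  simp only [cut, Tape.take_bits_append, Tape.drop_bits_append]

/-- Lengths of the coins and of the random tape that follows them. -/
theorem polyLength_setup : PolyLength fun n => P.Acc.coins n + (n + (n + n)) :=
  P.Acc.coins_poly.add polyLength_keys

/-- Finds colliding multisets. -/
def aMultisetFinder : PPT Bits (List Bits × List Bits) where
  coins n := A.coins n + (P.H3.seedLen n + (P.H4.seedLen n + (P.Acc.repSeedLen n +
    (P.Acc.coins n + (n + (n + n))))))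
  coins_poly := A.coins_poly.add (P.H3.seedLen_poly.add (P.H4.seedLen_poly.add
    (P.Acc.repSeedLen_poly.add P.polyLength_setup)))
  run x :=
    let y := cut (A.coins x.1.length) (P.H3.seedLen x.1.length) (P.H4.seedLen x.1.length)
      (P.Acc.repSeedLen x.1.length) x.2.1
    P.aMultisets A (P.setupInput x.1 y.1 (x.2.2, y.2.1, y.2.2.1, y.2.2.2.1)
      (y.2.2.2.2.take (P.Acc.coins x.1.length))
      (keysOf x.1.length (y.2.2.2.2.drop (P.Acc.coins x.1.length))))
  run_poly := (P.polyTime_aMultisets A).comp (by fun_prop)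

/-- Finds colliding sub-filters. -/
def aFilterFinder : PPT Bits (SubFilter × SubFilter) where
  coins n := A.coins n + (P.MH.seedLen n + (P.H4.seedLen n + (P.Acc.repSeedLen n +
    (P.Acc.coins n + (n + (n + n))))))
  coins_poly := A.coins_poly.add (P.MH.seedLen_poly.add (P.H4.seedLen_poly.add
    (P.Acc.repSeedLen_poly.add P.polyLength_setup)))
  run x :=
    let y := cut (A.coins x.1.length) (P.MH.seedLen x.1.length) (P.H4.seedLen x.1.length)
      (P.Acc.repSeedLen x.1.length) x.2.1
    P.aFilters A (P.setupInput x.1 y.1 (y.2.1, x.2.2, y.2.2.1, y.2.2.2.1)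
      (y.2.2.2.2.take (P.Acc.coins x.1.length))
      (keysOf x.1.length (y.2.2.2.2.drop (P.Acc.coins x.1.length))))
  run_poly := (P.polyTime_aFilters A).comp (by fun_prop)

/-- Finds colliding keywords. -/
def aKeywordFinder : PPT Bits (Bits × Bits) where
  coins n := A.coins n + (P.MH.seedLen n + (P.H3.seedLen n + (P.Acc.repSeedLen n +
    (P.Acc.coins n + (n + (n + n))))))
  coins_poly := A.coins_poly.add (P.MH.seedLen_poly.add (P.H3.seedLen_poly.add
    (P.Acc.repSeedLen_poly.add P.polyLength_setup)))
  run x :=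
    let y := cut (A.coins x.1.length) (P.MH.seedLen x.1.length) (P.H3.seedLen x.1.length)
      (P.Acc.repSeedLen x.1.length) x.2.1
    P.aKeywords A (P.setupInput x.1 y.1 (y.2.1, y.2.2.1, x.2.2, y.2.2.2.1)
      (y.2.2.2.2.take (P.Acc.coins x.1.length))
      (keysOf x.1.length (y.2.2.2.2.drop (P.Acc.coins x.1.length))))
  run_poly := (P.polyTime_aKeywords A).comp (by fun_prop)

/-- Finds colliding cross tags. -/
def aCrossTagFinder : PPT Bits (Bits × Bits) where
  coins n := A.coins n + (P.MH.seedLen n + (P.H3.seedLen n + (P.H4.seedLen n +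
    (P.Acc.repSeedLen n + (P.Acc.coins n + (n + (n + n)))))))
  coins_poly := A.coins_poly.add (P.MH.seedLen_poly.add (P.H3.seedLen_poly.add
    (P.H4.seedLen_poly.add (P.Acc.repSeedLen_poly.add P.polyLength_setup))))
  run x :=
    let y := cut (A.coins x.1.length) (P.MH.seedLen x.1.length) (P.H3.seedLen x.1.length)
      (P.H4.seedLen x.1.length) x.2.1
    let z := y.2.2.2.2.drop (P.Acc.repSeedLen x.1.length)
    P.crossTagPair x.1.length (P.aGraphQuery A (P.setupInput x.1 y.1
      (y.2.1, y.2.2.1, y.2.2.2.1, y.2.2.2.2.take (P.Acc.repSeedLen x.1.length))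
      (z.take (P.Acc.coins x.1.length)) (keysOf x.1.length (z.drop (P.Acc.coins x.1.length)))))
  run_poly := P.polyTime_crossTagPair (by fun_prop) ((P.polyTime_aGraphQuery A).comp (by fun_prop))

/-- Forges a witness. -/
def aForger : PPT (ℕ × ℕ × Bits) (List Bits × Bits × ℕ) where
  coins n := A.coins n + (P.MH.seedLen n + (P.H3.seedLen n + (P.H4.seedLen n + (n + (n + n)))))
  coins_poly := A.coins_poly.add (P.MH.seedLen_poly.add (P.H3.seedLen_poly.add
    (P.H4.seedLen_poly.add polyLength_keys)))
  run x :=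
    let y := cut (A.coins x.1.length) (P.MH.seedLen x.1.length) (P.H3.seedLen x.1.length)
      (P.H4.seedLen x.1.length) x.2.1
    P.aForgery A (x.1, y.1, ((y.2.1, y.2.2.1, y.2.2.2.1, x.2.2.2.2), x.2.2.1, x.2.2.2.1),
      keysOf x.1.length y.2.2.2.2)
  run_poly := (P.polyTime_aForgery A).comp (by fun_prop)

/-- The finder runs the RSA setup on its own coins, because the challenge concerns only the multiset
hash. -/
theorem negligible_aMultisets (h : P.MH.IsCollisionResistant) : Negligible fun lam =>
    prob fun o : P.ASpace A lam =>
      (((P.aMultisets A (P.aInput A lam o)).1 : Multiset Bits) ≠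
          (P.aMultisets A (P.aInput A lam o)).2 ∧
        P.MH.hash lam o.2.1.1.bits ((P.aMultisets A (P.aInput A lam o)).1 : Multiset Bits) =
          P.MH.hash lam o.2.1.1.bits ((P.aMultisets A (P.aInput A lam o)).2 : Multiset Bits)) := by
  refine CollisionResistant.negligible h
    (fun n (o : P.ASpace A n) => (o.1.append (o.2.1.2.1.append (o.2.1.2.2.1.append
      (o.2.1.2.2.2.append (o.2.2.1.append (o.2.2.2.1.append
      (o.2.2.2.2.1.append o.2.2.2.2.2)))))), o.2.1.1)) ?_ ?_ (P.aMultisetFinder A) rfl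
    (fun _ _ => rfl) ?_
  · intro n o o' h
    simp only [Prod.ext_iff, Tape.append_inj] at h ⊢
    tauto
  · intro n
    simp only [Fintype.card_prod, card_tape, pow_add]
    ring
  · intro n o
    simp only [aMultisetFinder, aInput, unary_length, Tape.bits_append, cut_bits,
      Tape.take_bits_append, Tape.drop_bits_append, keysOf_bits]

theorem negligible_aFilters (h : P.H3.IsCollisionResistant) : Negligible fun lam =>
    prob fun o : P.ASpace A lam =>
      ((P.aFilters A (P.aInput A lam o)).1 ≠ (P.aFilters A (P.aInput A lam o)).2 ∧
        P.H3.hash lam o.2.1.2.1.bits (P.aFilters A (P.aInput A lam o)).1 =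
          P.H3.hash lam o.2.1.2.1.bits (P.aFilters A (P.aInput A lam o)).2) := by
  refine CollisionResistant.negligible h
    (fun n (o : P.ASpace A n) => (o.1.append (o.2.1.1.append (o.2.1.2.2.1.append
      (o.2.1.2.2.2.append (o.2.2.1.append (o.2.2.2.1.append
      (o.2.2.2.2.1.append o.2.2.2.2.2)))))), o.2.1.2.1)) ?_ ?_ (P.aFilterFinder A) rfl
    (fun _ _ => rfl) ?_
  · intro n o o' h
    simp only [Prod.ext_iff, Tape.append_inj] at h ⊢
    tauto
  · intro n
    simp only [Fintype.card_prod, card_tape, pow_add]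
    ring
  · intro n o
    simp only [aFilterFinder, aInput, unary_length, Tape.bits_append, cut_bits,
      Tape.take_bits_append, Tape.drop_bits_append, keysOf_bits]

theorem negligible_aKeywords (h : P.H4.IsCollisionResistant) : Negligible fun lam =>
    prob fun o : P.ASpace A lam =>
      ((P.aKeywords A (P.aInput A lam o)).1 ≠ (P.aKeywords A (P.aInput A lam o)).2 ∧
        P.H4.hash lam o.2.1.2.2.1.bits (P.aKeywords A (P.aInput A lam o)).1 =
          P.H4.hash lam o.2.1.2.2.1.bits (P.aKeywords A (P.aInput A lam o)).2) := by
  refine CollisionResistant.negligible h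
    (fun n (o : P.ASpace A n) => (o.1.append (o.2.1.1.append (o.2.1.2.1.append
      (o.2.1.2.2.2.append (o.2.2.1.append (o.2.2.2.1.append
      (o.2.2.2.2.1.append o.2.2.2.2.2)))))), o.2.1.2.2.1)) ?_ ?_ (P.aKeywordFinder A) rfl
    (fun _ _ => rfl) ?_
  · intro n o o' h
    simp only [Prod.ext_iff, Tape.append_inj] at h ⊢
    tauto
  · intro n
    simp only [Fintype.card_prod, card_tape, pow_add]
    ring
  · intro n o
    simp only [aKeywordFinder, aInput, unary_length, Tape.bits_append, cut_bits,
      Tape.take_bits_append, Tape.drop_bits_append, keysOf_bits]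

theorem negligible_aCrossTags (h : P.FingerprintCollisionResistant) : Negligible fun lam =>
    prob fun o : P.ASpace A lam =>
      ((P.crossTagPair lam (P.aGraphQuery A (P.aInput A lam o))).1 ≠
          (P.crossTagPair lam (P.aGraphQuery A (P.aInput A lam o))).2 ∧
        P.H2 lam (P.crossTagPair lam (P.aGraphQuery A (P.aInput A lam o))).1 =
          P.H2 lam (P.crossTagPair lam (P.aGraphQuery A (P.aInput A lam o))).2) := by
  refine CollisionResistant.negligible h
    (fun n (o : P.ASpace A n) => (o.1.append (o.2.1.1.append (o.2.1.2.1.append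
      (o.2.1.2.2.1.append (o.2.1.2.2.2.append (o.2.2.1.append (o.2.2.2.1.append
      (o.2.2.2.2.1.append o.2.2.2.2.2))))))), Fin.elim0)) ?_ ?_ (P.aCrossTagFinder A) rfl
    (fun _ _ => rfl) ?_
  · intro n o o' h
    simp only [Prod.ext_iff, Tape.append_inj] at h ⊢
    tauto
  · intro n
    simp only [Fintype.card_prod, card_tape, pow_add]
    ring
  · intro n o
    simp only [aCrossTagFinder, aInput, unary_length, Tape.bits_append, cut_bits,
      Tape.take_bits_append, Tape.drop_bits_append, keysOf_bits]

/-- Here `n`, `g` and the seed of the representatives come from the challenge; the forger does not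
see the coins of the setup and simulates with `n` and `g` alone. -/
theorem negligible_aForgery (h : P.Acc.IsSecure) : Negligible fun lam =>
    prob fun o : P.ASpace A lam =>
      (P.aForgery A (P.aInput A lam o)).2.1 ∉ (P.aForgery A (P.aInput A lam o)).1 ∧
      accVerify ((P.Acc.setup lam o.2.2.1.bits).1 * (P.Acc.setup lam o.2.2.1.bits).2.1)
        (P.Acc.rep lam o.2.1.2.2.2.bits (P.aForgery A (P.aInput A lam o)).2.1)
        (P.aForgery A (P.aInput A lam o)).2.2
        ((P.Acc.setup lam o.2.2.1.bits).2.2 ^ ((P.aForgery A (P.aInput A lam o)).1.map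
          (P.Acc.rep lam o.2.1.2.2.2.bits)).prod %
          ((P.Acc.setup lam o.2.2.1.bits).1 * (P.Acc.setup lam o.2.2.1.bits).2.1)) = true := by
  refine Negligible.of_prob_le (h (P.aForger A)) fun n => prob_le_of_injective
    (Ω' := Tape (A.coins n + (P.MH.seedLen n + (P.H3.seedLen n + (P.H4.seedLen n +
      (n + (n + n)))))) × Tape (P.Acc.coins n) × Tape (P.Acc.repSeedLen n))
    (f := fun o : P.ASpace A n => (o.1.append (o.2.1.1.append (o.2.1.2.1.append
      (o.2.1.2.2.1.append (o.2.2.2.1.append (o.2.2.2.2.1.append o.2.2.2.2.2))))),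
        o.2.2.1, o.2.1.2.2.2)) ?_ ?_ ?_
  · intro o o' h
    simp only [Prod.ext_iff, Tape.append_inj] at h ⊢
    tauto
  · simp only [Fintype.card_prod, card_tape, pow_add]
    ring
  · intro o ho
    have hrun : (P.aForger A).run (unary n, (o.1.append (o.2.1.1.append (o.2.1.2.1.append
        (o.2.1.2.2.1.append (o.2.2.2.1.append (o.2.2.2.2.1.append o.2.2.2.2.2)))))).bits,
        ((P.Acc.setup n o.2.2.1.bits).1 * (P.Acc.setup n o.2.2.1.bits).2.1,
          (P.Acc.setup n o.2.2.1.bits).2.2, o.2.1.2.2.2.bits)) =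
        P.aForgery A (P.aInput A n o) := by
      simp only [aForger, aInput, setupInput, unary_length, Tape.bits_append, cut_bits, keysOf_bits]
    rw [← hrun] at ho
    exact ho

/-- The event depends only on the coins of the setup; `prob_fst` removes the other choices. -/
theorem negligible_not_safe : Negligible fun lam =>
    prob fun o : P.ASpace A lam => ¬ P.Acc.Safe lam (P.Acc.setup lam o.2.2.1.bits) := by
  have hsafe : Negligible fun lam => prob fun r : Tape (P.Acc.coins lam) =>
    ¬ P.Acc.Safe lam (P.Acc.setup lam r.bits) := P.Acc.setup_safe
  refine Negligible.of_prob_le hsafe fun n => ?_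
  rw [← prob_fst (Ω' := Tape (A.coins n) × (Tape (P.MH.seedLen n) × Tape (P.H3.seedLen n) ×
    Tape (P.H4.seedLen n) × Tape (P.Acc.repSeedLen n)) × (Tape n × Tape n × Tape n))
    fun r : Tape (P.Acc.coins n) => ¬ P.Acc.Safe n (P.Acc.setup n r.bits)]
  refine prob_le_of_injective (f := fun o : P.ASpace A n => (o.2.2.1, o.1, o.2.1, o.2.2.2)) ?_ ?_
    fun o ho => ho
  · intro o o' h
    simp only [Prod.ext_iff] at h ⊢
    tauto
  · simp only [Fintype.card_prod, card_tape]
    ring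

/-- Union bound over an unsafe setup and the four events of `aGame_collision`. -/
theorem vSecGraphACorrect_filterResult (hH : P.MH.IsCollisionResistant)
    (hH3 : P.H3.IsCollisionResistant) (hH4 : P.H4.IsCollisionResistant) (hAcc : P.Acc.IsSecure) :
    P.VSecGraphACorrect P.filterResult := fun A => by
  refine Negligible.of_imp_or (P.negligible_not_safe A) (Negligible.of_imp_or
    (P.negligible_aMultisets A hH) (Negligible.of_imp_or (P.negligible_aFilters A hH3)
    (Negligible.of_imp_or (P.negligible_aKeywords A hH4) (P.negligible_aForgery A hAcc)
      (fun _ _ ho => ho)) (fun _ _ ho => ho)) (fun _ _ ho => ho)) fun lam o ho => ?_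
  by_cases hsafe : P.Acc.Safe lam (P.Acc.setup lam o.2.2.1.bits)
  · exact Or.inr (P.aGame_collision A (by rw [aInput, setupInput, unary_length]) hsafe ho)
  · exact Or.inl hsafe

/-- Collisions of keywords are counted once more, because the cross tags are taken from the
simulated graph and the simulation is faithful only in their absence. -/
theorem vSecGraphACorrect_exactResult (hH : P.MH.IsCollisionResistant)
    (hH3 : P.H3.IsCollisionResistant) (hH4 : P.H4.IsCollisionResistant) (hAcc : P.Acc.IsSecure)
    (hH2 : P.FingerprintCollisionResistant) : P.VSecGraphACorrect exactResult := fun A => by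
  refine Negligible.of_imp_or (P.negligible_not_safe A) (Negligible.of_imp_or
    (P.vSecGraphACorrect_filterResult hH hH3 hH4 hAcc A) (Negligible.of_imp_or
    (P.negligible_aKeywords A hH4) (P.negligible_aCrossTags A hH2)
      (fun _ _ ho => ho)) (fun _ _ ho => ho)) fun lam o ho => ?_
  by_cases hsafe : P.Acc.Safe lam (P.Acc.setup lam o.2.2.1.bits)
  · exact Or.inr (P.aGame_exact (by rw [aInput, setupInput, unary_length]) hsafe ho)
  · exact Or.inl hsafe

end VSecGraphA

end Primitives

theorem theorem3 (P : Primitives)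
    (hH : P.MH.IsCollisionResistant) (hH3 : P.H3.IsCollisionResistant) :
    P.VSecGraphCorrect P.filterResult ∧
    (P.H4.IsCollisionResistant → P.Acc.IsSecure → P.VSecGraphACorrect P.filterResult) ∧
    (P.FingerprintCollisionResistant →
      P.VSecGraphCorrect Primitives.exactResult ∧
      (P.H4.IsCollisionResistant → P.Acc.IsSecure →
        P.VSecGraphACorrect Primitives.exactResult)) :=
  ⟨P.vSecGraphCorrect_filterResult hH hH3, P.vSecGraphACorrect_filterResult hH hH3, fun hH2 =>
    ⟨P.vSecGraphCorrect_exactResult hH hH3 hH2, fun hH4 hAcc =>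
      P.vSecGraphACorrect_exactResult hH hH3 hH4 hAcc hH2⟩⟩
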